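/- Conventions. A 2-category is a small strict 2-category, a 2-functor is strict, and $2\mathrm{Cat}$ is the category of 2-categories and 2-functors. A *normal pseudofunctor* $\mathcal A\to\mathcal D$ between 2-categories is a pseudofunctor that preserves identity 1-morphisms strictly; it has a natural, coherent, invertible compositor. **$\Theta_2$ and $d$.** For $i\ge 0$ and $j_1,\dots,j_i\ge 0$ let $[i\,|\,j_1,\dots,j_i]$ be the 2-category with objects $0,\dots,i$, whose category of morphisms $x\to y$ is the poset $[j_{x+1}]\times\dots\times[j_y]$ if $x\le y$ and is empty otherwise, with composition given by concatenation. $\Theta_2$ is the full subcategory of $2\mathrm{Cat}$ on these 2-categories. Let $d\colon\Delta\times\Delta\to\Theta_2$ be the functor $[i,j]\mapsto[i\,|\,j,\dots,j]$, and let $d_*\colon \mathrm{Set}^{(\Delta\times\Delta)^{op}}\to\mathrm{Set}^{\Theta_2^{op}}$ be the right adjoint (right Kan extension) of the restriction functor $d^*$. **Leinster's nerve.** For a 2-category $\mathcal D$, let $N^{\Theta_2}\mathcal D$ be the $\Theta_2$-set whose set of elements at $\theta$ is the set of normal pseudofunctors $\theta\to\mathcal D$. **The bisimplicial nerve.** Let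 $\widetilde{\mathcal O}[n]$ be the 2-category obtained from the 2-truncated $n$-th oriental by inverting all 2-morphisms: its objects are $0,\dots,n$, its 1-morphisms $x\to y$ are the subsets of $\{x,\dots,y\}$ containing $x$ and $y$ (for $x\le y$; none otherwise), composed by union, and there is exactly one 2-morphism between any two parallel 1-morphisms. For 2-categories $\mathcal B,\mathcal D$, let $\mathbb H\mathcal B$ and $\mathbb V\mathcal B$ be $\mathcal B$ regarded as a horizontal, respectively vertical, double category, and let $\mathbb H^{\simeq}\mathcal D$ be the double category with the objects of $\mathcal D$, whose horizontal morphisms are the 1-morphisms of $\mathcal D$, whose vertical morphisms are the adjoint equivalences of $\mathcal D$ (with all their data), and whose squares with top $a$, bottom $b$, left side $u$ and right side $v$ are the 2-morphisms $va\Rightarrow bu$ of $\mathcal D$. Let $L^{\simeq}$ be the left adjoint of $\mathbb H^{\simeq}$, let $\otimes$ be the pseudo Gray tensor product of double categories, and let $[\![-,-]\!]$ be the corresponding pseudo hom. Put $$N^{\Delta\times\Delta}_{i,j,0}\mathcal D \;=\; 2\mathrm{Cat}\bigl(L^{\simeq}(\mathbb V\widetilde{\mathcal O}[j]\otimes\mathbb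 H\widetilde{\mathcal O}[i]),\,\mathcal D\bigr).$$ By the defining adjunctions, this is the set of 2-functors from $\widetilde{\mathcal O}[j]$ to the underlying vertical 2-category of $[\![\mathbb H\widetilde{\mathcal O}[i],\mathbb H^{\simeq}\mathcal D]\!]$. The objects of the latter are the 2-functors $\widetilde{\mathcal O}[i]\to\mathcal D$; its 1-morphisms $F\to G$ are the oplax transformations with squares $\eta_b\circ Ff\Rightarrow Gf\circ\eta_a$ (for $f\colon a\to b$), not necessarily invertible, together with adjoint equivalence data on each component; its 2-morphisms are the modifications. Varying $i$ and $j$ gives a bisimplicial set $N^{\Delta\times\Delta}_{\bullet,0}\mathcal D$. **Theorem.** For every 2-category $\mathcal D$ there is an isomorphism of $\Theta_2$-sets $$d_*N^{\Delta\times\Delta}_{\bullet,0}\mathcal D\;\cong\;N^{\Theta_2}\mathcal D,$$ natural in $\mathcal D$ with respect to 2-functors; that is, the functors $d_*\circ N^{\Delta\times\Delta}_{\bullet,0}$ and $N^{\Theta_2}$ from $2\mathrm{Cat}$ to $\Theta_2$-sets are naturally isomorphic. -/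

import Mathlib

open CategoryTheory Bicategory Opposite

universe u

namespace TwoNerve

universe w₁ v₁ u₁ w₂ v₂ u₂ w₃ v₃ u₃

/-- A 2-functor between strict 2-categories. Throughout, a strict 2-category is a Mathlib
`Bicategory` with `Bicategory.Strict`. A `StrictPseudofunctorPreCore` is a map on objects,
1-morphisms and 2-morphisms preserving all identities and all compositions (whiskerings included)
on the nose. -/
abbrev TwoFunctor (B : Type u₁) [Bicategory.{w₁, v₁} B] (C : Type u₂) [Bicategory.{w₂, v₂} C] :=
  StrictPseudofunctorPreCore B C

namespace TwoFunctor

variable {B : Type u₁} [Bicategory.{w₁, v₁} B] {C : Type u₂} [Bicategory.{w₂, v₂} C]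
  {D : Type u₃} [Bicategory.{w₃, v₃} D]

variable (B) in
/-- The identity 2-functor. -/
def id : TwoFunctor B B where
  toPrelaxFunctor := PrelaxFunctor.id B
  map₂_whisker_left f g g' η := by
    change f ◁ η = 𝟙 _ ≫ f ◁ η ≫ 𝟙 _
    simp
  map₂_whisker_right η g := by
    change η ▷ g = 𝟙 _ ≫ η ▷ g ≫ 𝟙 _
    simp

/-- Composition of 2-functors. -/
def comp (F : TwoFunctor B C) (G : TwoFunctor C D) : TwoFunctor B D where
  toPrelaxFunctor := F.toPrelaxFunctor.comp G.toPrelaxFunctor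
  map_id X := by
    change G.map (F.map (𝟙 X)) = 𝟙 (G.obj (F.obj X))
    rw [F.map_id, G.map_id]
  map_comp f g := by
    change G.map (F.map (f ≫ g)) = G.map (F.map f) ≫ G.map (F.map g)
    rw [F.map_comp, G.map_comp]
  map₂_whisker_left f g g' η := by
    change G.map₂ (F.map₂ (f ◁ η)) =
      eqToHom _ ≫ G.map (F.map f) ◁ G.map₂ (F.map₂ η) ≫ eqToHom _
    simp [F.map₂_whisker_left, G.map₂_whisker_left, PrelaxFunctor.map₂_eqToHom]
  map₂_whisker_right η g := by
    change G.map₂ (F.map₂ (η ▷ g)) =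
      eqToHom _ ≫ G.map₂ (F.map₂ η) ▷ G.map (F.map g) ≫ eqToHom _
    simp [F.map₂_whisker_right, G.map₂_whisker_right, PrelaxFunctor.map₂_eqToHom]

theorem id_comp (F : TwoFunctor B C) : (id B).comp F = F := rfl
theorem comp_id (F : TwoFunctor B C) : F.comp (id C) = F := rfl

theorem ext_heq {F G : TwoFunctor B C} (h0 : F.obj = G.obj)
    (h1 : ∀ {a b : B} (f : a ⟶ b), HEq (F.map f) (G.map f))
    (h2 : ∀ {a b : B} {f g : a ⟶ b} (α : f ⟶ g), HEq (F.map₂ α) (G.map₂ α)) : F = G := by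
  obtain ⟨⟨⟨⟨o, m⟩, m2⟩, _, _⟩, _, _, _, _⟩ := F
  obtain ⟨⟨⟨⟨o', m'⟩, m2'⟩, _, _⟩, _, _, _, _⟩ := G
  obtain rfl : o = o' := h0
  obtain rfl : @m = @m' := by
    funext a b f; exact eq_of_heq (h1 f)
  obtain rfl : @m2 = @m2' := by
    funext a b f g α; exact eq_of_heq (h2 α)
  rfl

/-- A 2-functor between strict 2-categories as a strict pseudofunctor. -/
abbrev toStrict [Bicategory.Strict B] [Bicategory.Strict C] (F : TwoFunctor B C) :
    StrictPseudofunctor B C := StrictPseudofunctor.mk'' F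

end TwoFunctor

/-! ### The 2-categories `O~[n]` -/

/-- (The objects of) the 2-category `O~[n]`: the 2-truncated oriental `O₂[n]` with all 2-morphisms
made invertible. Its objects are `0, …, n`. In `O₂[n]` the category of morphisms from `x` to `y` is
the poset, under inclusion, of the subsets of `{x, …, y}` that contain `x` and `y` (empty unless
`x ≤ y`), with union as composition. This poset has a least element when it is nonempty, so
inverting all its arrows gives exactly one arrow between any two of its objects. -/
structure Osim (n : ℕ) : Type where
  /-- The underlying vertex. -/
  pt : Fin (n + 1)

namespace Osim

variable {n : ℕ}

/-- A 1-morphism `x ⟶ y` of `O~[n]`: a set of vertices with minimum `x` and maximum `y`. -/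
@[ext]
structure Hom (x y : Osim n) : Type where
  verts : Finset (Fin (n + 1))
  source_mem : x.pt ∈ verts
  target_mem : y.pt ∈ verts
  bounds : ∀ z ∈ verts, x.pt ≤ z ∧ z ≤ y.pt

instance : CategoryStruct (Osim n) where
  Hom := Hom
  id x := ⟨{x.pt}, by simp, by simp, by simp⟩
  comp f g := ⟨f.verts ∪ g.verts, Finset.mem_union_left _ f.source_mem,
    Finset.mem_union_right _ g.target_mem, by
      intro w hw
      rcases Finset.mem_union.mp hw with h | h
      · exact ⟨(f.bounds w h).1, (f.bounds w h).2.trans (g.bounds _ g.target_mem).1⟩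
      · exact ⟨(f.bounds _ f.target_mem).1.trans (g.bounds w h).1, (g.bounds w h).2⟩⟩

/-- There is exactly one 2-morphism between any two parallel 1-morphisms of `O~[n]`. -/
instance (x y : Osim n) : Category (x ⟶ y) where
  Hom _ _ := Unit
  id _ := ()
  comp _ _ := ()

instance (x y : Osim n) (f g : x ⟶ y) : Subsingleton (f ⟶ g) :=
  inferInstanceAs (Subsingleton Unit)

instance : Bicategory (Osim n) where
  whiskerLeft _ _ _ _ := ()
  whiskerRight _ _ := ()
  associator _ _ _ := ⟨(), (), rfl, rfl⟩
  leftUnitor _ := ⟨(), (), rfl, rfl⟩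
  rightUnitor _ := ⟨(), (), rfl, rfl⟩

theorem hom_ext {x y : Osim n} {f g : x ⟶ y} (h : f.verts = g.verts) : f = g :=
  Hom.ext h

instance : Bicategory.Strict (Osim n) where
  id_comp f := hom_ext (Finset.union_eq_right.mpr
    (Finset.singleton_subset_iff.mpr f.source_mem))
  comp_id f := hom_ext (Finset.union_eq_left.mpr
    (Finset.singleton_subset_iff.mpr f.target_mem))
  assoc _ _ _ := hom_ext (Finset.union_assoc _ _ _)
  leftUnitor_eqToIso _ := Iso.ext (Subsingleton.elim _ _)
  rightUnitor_eqToIso _ := Iso.ext (Subsingleton.elim _ _)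
  associator_eqToIso _ _ _ := Iso.ext (Subsingleton.elim _ _)

/-- The 2-functor `O~[m] ⥤ O~[n]` induced by a monotone map. -/
def map {m n : ℕ} (α : Fin (m + 1) →o Fin (n + 1)) : TwoFunctor (Osim m) (Osim n) where
  obj x := ⟨α x.pt⟩
  map {x y} f := ⟨f.verts.image α, Finset.mem_image_of_mem _ f.source_mem,
    Finset.mem_image_of_mem _ f.target_mem, by
      intro w hw
      obtain ⟨z, hz, rfl⟩ := Finset.mem_image.mp hw
      exact ⟨α.monotone (f.bounds z hz).1, α.monotone (f.bounds z hz).2⟩⟩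
  map₂ _ := ()
  map₂_id _ := rfl
  map₂_comp _ _ := rfl
  map_id x := hom_ext (Finset.image_singleton _ _)
  map_comp f g := hom_ext (Finset.image_union _ _)
  map₂_whisker_left _ _ _ _ := Subsingleton.elim _ _
  map₂_whisker_right _ _ := Subsingleton.elim _ _

theorem map_id (n : ℕ) : map (OrderHom.id : Fin (n + 1) →o Fin (n + 1)) = TwoFunctor.id _ :=
  TwoFunctor.ext_heq rfl (fun _ => heq_of_eq (hom_ext Finset.image_id)) (fun _ => HEq.rfl)

theorem map_comp {l m n : ℕ} (α : Fin (l + 1) →o Fin (m + 1)) (β : Fin (m + 1) →o Fin (n + 1)) :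
    map (β.comp α) = (map α).comp (map β) :=
  TwoFunctor.ext_heq rfl
    (fun f => heq_of_eq (hom_ext (Finset.image_image (s := f.verts) (f := α) (g := β)).symm))
    (fun _ => HEq.rfl)

end Osim

/-! ### The category `Θ₂` -/

/-- An object `[i | j₁, …, jᵢ]` of `Θ₂`; `len` is `i` and `width` is the sequence of the `jₖ`. -/
structure Theta2 : Type where
  len : ℕ
  width : Fin len → ℕ

namespace Theta2

/-- (The objects of) the 2-category `[i | j₁, …, jᵢ]`, namely `0, …, i`. It is free on `i` composable
1-morphisms replaced by chains `[j₁], …, [jᵢ]` of 2-morphisms: for `x ≤ y` the category of morphisms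
`x ⟶ y` is the poset `[j_{x+1}] × ⋯ × [j_y]`, for `x > y` it is empty, and composition is
concatenation. -/
structure Cell (θ : Theta2) : Type where
  pt : Fin (θ.len + 1)

variable {θ : Theta2}

/-- A 1-morphism `x ⟶ y` of `[i | j₁, …, jᵢ]`: a level for each elementary step between `x` and
`y`. -/
@[ext]
structure Arrow (x y : θ.Cell) : Type where
  le : x.pt ≤ y.pt
  level : ∀ k : Fin θ.len, x.pt ≤ k.castSucc → k.succ ≤ y.pt → Fin (θ.width k + 1)

instance (x y : θ.Cell) : PartialOrder (Arrow x y) where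
  le f g := ∀ k hx hy, f.level k hx hy ≤ g.level k hx hy
  le_refl _ _ _ _ := le_rfl
  le_trans _ _ _ h h' k hx hy := (h k hx hy).trans (h' k hx hy)
  le_antisymm _ _ h h' := Arrow.ext (by
      funext k hx hy; exact le_antisymm (h k hx hy) (h' k hx hy))

theorem le_def {x y : θ.Cell} {f g : Arrow x y} :
    f ≤ g ↔ ∀ k hx hy, f.level k hx hy ≤ g.level k hx hy := Iff.rfl

/-- Composition of 1-morphisms: concatenation. -/
def Arrow.comp {x y z : θ.Cell} (f : Arrow x y) (g : Arrow y z) : Arrow x z where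
  le := f.le.trans g.le
  level k hx hz :=
    if h : k.succ ≤ y.pt then f.level k hx h
    else g.level k (Fin.le_castSucc_iff.mpr (not_le.mp h)) hz

instance : CategoryStruct θ.Cell where
  Hom := Arrow
  id _ := ⟨le_rfl, fun k h h' =>
    absurd (h'.trans h) (not_le.mpr k.castSucc_lt_succ)⟩
  comp f g := f.comp g

instance (x y : θ.Cell) : PartialOrder (x ⟶ y) := inferInstanceAs (PartialOrder (Arrow x y))

instance (x y : θ.Cell) : Category (x ⟶ y) := Preorder.smallCategory _

theorem hom_ext {x y : θ.Cell} {f g : x ⟶ y}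
    (h : ∀ k hx hy, Arrow.level f k hx hy = Arrow.level g k hx hy) : f = g :=
  Arrow.ext (by funext k hx hy; exact h k hx hy)

theorem comp_level_left {x y z : θ.Cell} (f : x ⟶ y) (g : y ⟶ z) (k : Fin θ.len)
    (hx : x.pt ≤ k.castSucc) (hz : k.succ ≤ z.pt) (hy : k.succ ≤ y.pt) :
    Arrow.level (f ≫ g) k hx hz = Arrow.level f k hx hy := dif_pos hy

theorem comp_level_right {x y z : θ.Cell} (f : x ⟶ y) (g : y ⟶ z) (k : Fin θ.len)
    (hx : x.pt ≤ k.castSucc) (hz : k.succ ≤ z.pt) (hy : y.pt ≤ k.castSucc) :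
    Arrow.level (f ≫ g) k hx hz = Arrow.level g k hy hz :=
  dif_neg (fun h => absurd (h.trans hy) (not_le.mpr k.castSucc_lt_succ))

theorem comp_le_comp {x y z : θ.Cell} {f f' : x ⟶ y} {g g' : y ⟶ z} (hf : f ≤ f') (hg : g ≤ g') :
    f ≫ g ≤ f' ≫ g' := by
  refine le_def.mpr fun k hx hz => ?_
  rcases le_or_gt k.succ y.pt with h | h
  · rw [comp_level_left _ _ _ _ _ h, comp_level_left _ _ _ _ _ h]
    exact le_def.mp hf k hx h
  · have h' := Fin.le_castSucc_iff.mpr h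
    rw [comp_level_right _ _ _ _ _ h', comp_level_right _ _ _ _ _ h']
    exact le_def.mp hg k h' hz

theorem cell_id_comp {x y : θ.Cell} (f : x ⟶ y) : 𝟙 x ≫ f = f :=
  hom_ext fun k hx hy => comp_level_right _ _ k hx hy hx

theorem cell_comp_id {x y : θ.Cell} (f : x ⟶ y) : f ≫ 𝟙 y = f :=
  hom_ext fun k hx hy => comp_level_left _ _ k hx hy hy

theorem cell_assoc {x y z w : θ.Cell} (f : x ⟶ y) (g : y ⟶ z) (h : z ⟶ w) :
    (f ≫ g) ≫ h = f ≫ g ≫ h := by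
  refine hom_ext fun k hx hw => ?_
  rcases le_or_gt k.succ y.pt with hy | hy
  · rw [comp_level_left _ _ _ _ _ (hy.trans (Arrow.le g)), comp_level_left _ _ _ _ _ hy,
      comp_level_left _ _ _ _ _ hy]
  · have hy' := Fin.le_castSucc_iff.mpr hy
    rw [comp_level_right f _ _ _ _ hy']
    rcases le_or_gt k.succ z.pt with hz | hz
    · rw [comp_level_left _ _ _ _ _ hz, comp_level_left _ _ _ _ _ hz,
        comp_level_right _ _ _ _ _ hy']
    · have hz' := Fin.le_castSucc_iff.mpr hz
      rw [comp_level_right _ _ _ _ _ hz', comp_level_right _ _ _ _ _ hz']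

instance : Bicategory θ.Cell where
  whiskerLeft _ _ _ η := homOfLE (comp_le_comp le_rfl (leOfHom η))
  whiskerRight η _ := homOfLE (comp_le_comp (leOfHom η) le_rfl)
  associator f g h := eqToIso (cell_assoc f g h)
  leftUnitor f := eqToIso (cell_id_comp f)
  rightUnitor f := eqToIso (cell_comp_id f)

instance : Bicategory.Strict θ.Cell where
  id_comp := cell_id_comp
  comp_id := cell_comp_id
  assoc := cell_assoc

/-- `Θ₂` is the full subcategory of strict 2-categories and 2-functors on the `[i | j₁, …, jᵢ]`. -/
instance : Category Theta2 where
  Hom θ θ' := TwoFunctor θ.Cell θ'.Cell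
  id θ := TwoFunctor.id θ.Cell
  comp F G := F.comp G

end Theta2

/-! ### The functor `d : Δ × Δ ⥤ Θ₂`, `[i, j] ↦ [i | j, …, j]` -/

/-- The object `[i | j, …, j]` of `Θ₂`. -/
def dObj (i j : ℕ) : Theta2 := ⟨i, fun _ => j⟩

theorem exists_step {i i' : ℕ} (α : Fin (i + 1) →o Fin (i' + 1)) {x y : Fin (i + 1)}
    {l : Fin i'} (hx : α x ≤ l.castSucc) (hy : l.succ ≤ α y) :
    ∃ k : Fin i, (x ≤ k.castSucc ∧ k.succ ≤ y) ∧ α k.castSucc ≤ l.castSucc ∧ l.succ ≤ α k.succ := by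
  induction y using Fin.induction with
  | zero =>
    exact absurd (hy.trans ((α.monotone (Fin.zero_le x)).trans hx))
      (not_le.mpr l.castSucc_lt_succ)
  | succ k ih =>
    rcases le_or_gt l.succ (α k.castSucc) with h | h
    · obtain ⟨k', ⟨h1, h2⟩, h3⟩ := ih h
      exact ⟨k', ⟨h1, h2.trans k.castSucc_lt_succ.le⟩, h3⟩
    · refine ⟨k, ⟨?_, le_rfl⟩, Fin.le_castSucc_iff.mpr h, hy⟩
      by_contra hc
      have : k.succ ≤ x := Fin.castSucc_lt_iff_succ_le.mp (not_le.mp hc)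
      exact absurd (hy.trans ((α.monotone this).trans hx)) (not_le.mpr l.castSucc_lt_succ)

theorem step_unique {i i' : ℕ} (α : Fin (i + 1) →o Fin (i' + 1)) {l : Fin i'} {k k' : Fin i}
    (h : α k.castSucc ≤ l.castSucc ∧ l.succ ≤ α k.succ)
    (h' : α k'.castSucc ≤ l.castSucc ∧ l.succ ≤ α k'.succ) : k = k' := by
  have key : ∀ {k k' : Fin i}, α k'.castSucc ≤ l.castSucc → l.succ ≤ α k.succ → k' ≤ k := by
    intro k k' h1 h2
    by_contra hc
    have : k.succ ≤ k'.castSucc := Fin.succ_le_castSucc_iff.mpr (not_le.mp hc)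
    exact absurd (h2.trans ((α.monotone this).trans h1)) (not_le.mpr l.castSucc_lt_succ)
  exact le_antisymm (key h.1 h'.2) (key h'.1 h.2)

/-- The action on 1-morphisms of the 2-functor `[i | j, …, j] ⥤ [i' | j', …, j']` induced by
`α : [i] ⟶ [i']` and `β : [j] ⟶ [j']`: the level of the image at a step is the image under `β` of
the level at the unique step whose image under `α` covers it. -/
noncomputable def dArrow {i i' j j' : ℕ} (α : Fin (i + 1) →o Fin (i' + 1))
    (β : Fin (j + 1) →o Fin (j' + 1)) {x y : (dObj i j).Cell} (f : x ⟶ y) :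
    (⟨α x.pt⟩ : (dObj i' j').Cell) ⟶ ⟨α y.pt⟩ where
  le := α.monotone (Theta2.Arrow.le f)
  level _ hx hy := β (Theta2.Arrow.level f (exists_step α hx hy).choose
    (exists_step α hx hy).choose_spec.1.1 (exists_step α hx hy).choose_spec.1.2)

theorem dArrow_level {i i' j j' : ℕ} (α : Fin (i + 1) →o Fin (i' + 1))
    (β : Fin (j + 1) →o Fin (j' + 1)) {x y : (dObj i j).Cell} (f : x ⟶ y) (l : Fin i')
    (hx : α x.pt ≤ l.castSucc) (hy : l.succ ≤ α y.pt) (k : Fin i) (hkx : x.pt ≤ k.castSucc)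
    (hky : k.succ ≤ y.pt) (h : α k.castSucc ≤ l.castSucc ∧ l.succ ≤ α k.succ) :
    Theta2.Arrow.level (dArrow α β f) l hx hy = β (Theta2.Arrow.level f k hkx hky) := by
  obtain rfl := step_unique α h (exists_step α hx hy).choose_spec.2
  rfl

/-- The 2-functor `[i | j, …, j] ⥤ [i' | j', …, j']` induced by a pair of monotone maps. -/
noncomputable def dMap {i i' j j' : ℕ} (α : Fin (i + 1) →o Fin (i' + 1))
    (β : Fin (j + 1) →o Fin (j' + 1)) : TwoFunctor (dObj i j).Cell (dObj i' j').Cell where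
  obj x := ⟨α x.pt⟩
  map f := dArrow α β f
  map₂ {x y f g} η := homOfLE (Theta2.le_def.mpr fun _ _ _ =>
    β.monotone (Theta2.le_def.mp (leOfHom η) _ _ _))
  map₂_id _ := Subsingleton.elim _ _
  map₂_comp _ _ := Subsingleton.elim _ _
  map_id _ := Theta2.hom_ext fun l hx hy =>
    absurd (hy.trans hx) (not_le.mpr l.castSucc_lt_succ)
  map_comp {x y z} f g := Theta2.hom_ext fun l hx hz => by
    obtain ⟨k, ⟨hkx, hkz⟩, hk⟩ := exists_step α hx hz
    rw [dArrow_level α β (f ≫ g) l hx hz k hkx hkz hk]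
    rcases le_or_gt k.succ y.pt with hy | hy
    · have hy' := hk.2.trans (α.monotone hy)
      rw [Theta2.comp_level_left f g k hkx hkz hy,
        Theta2.comp_level_left (dArrow α β f) (dArrow α β g) l hx hz hy',
        dArrow_level α β f l hx hy' k hkx hy hk]
    · have hy1 := Fin.le_castSucc_iff.mpr hy
      have hy' := (α.monotone hy1).trans hk.1
      rw [Theta2.comp_level_right f g k hkx hkz hy1,
        Theta2.comp_level_right (dArrow α β f) (dArrow α β g) l hx hz hy',
        dArrow_level α β g l hy' hz k hy1 hkz hk]
  map₂_whisker_left _ _ _ _ := Subsingleton.elim _ _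
  map₂_whisker_right _ _ := Subsingleton.elim _ _

theorem ext_thin {B : Type u₁} [Bicategory.{w₁, v₁} B] {θ : Theta2}
    {F G : TwoFunctor B θ.Cell} (h0 : F.obj = G.obj)
    (h1 : ∀ {a b : B} (f : a ⟶ b), HEq (F.map f) (G.map f)) : F = G := by
  obtain ⟨⟨⟨⟨o, m⟩, m2⟩, _, _⟩, _, _, _, _⟩ := F
  obtain ⟨⟨⟨⟨o', m'⟩, m2'⟩, _, _⟩, _, _, _, _⟩ := G
  obtain rfl : o = o' := h0
  obtain rfl : @m = @m' := by
    funext a b f; exact eq_of_heq (h1 f)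
  obtain rfl : @m2 = @m2' := by
    funext a b f g α; exact Subsingleton.elim _ _
  rfl

/-- The functor `d : Δ × Δ ⥤ Θ₂`, `[i, j] ↦ [i | j, …, j]`. -/
noncomputable def d : SimplexCategory × SimplexCategory ⥤ Theta2 where
  obj p := dObj p.1.len p.2.len
  map φ := dMap φ.1.toOrderHom φ.2.toOrderHom
  map_id _ := ext_thin rfl fun f => heq_of_eq (Theta2.hom_ext fun l hx hy =>
    dArrow_level _ _ f l hx hy l hx hy ⟨le_rfl, le_rfl⟩)
  map_comp {p q r} φ ψ := ext_thin rfl fun {x y} f => heq_of_eq (Theta2.hom_ext fun l hx hy => by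
    obtain ⟨k, ⟨hkx, hky⟩, hk⟩ := exists_step ψ.1.toOrderHom hx hy
    obtain ⟨m, ⟨hmx, hmy⟩, hm⟩ := exists_step φ.1.toOrderHom hkx hky
    exact (dArrow_level _ _ f l hx hy m hmx hmy
      ⟨(ψ.1.toOrderHom.monotone hm.1).trans hk.1, hk.2.trans (ψ.1.toOrderHom.monotone hm.2)⟩).trans
      ((dArrow_level ψ.1.toOrderHom ψ.2.toOrderHom (dArrow φ.1.toOrderHom φ.2.toOrderHom f) l hx hy
        k hkx hky hk).trans (congrArg _ (dArrow_level _ _ f k hkx hky m hmx hmy hm))).symm)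

/-! ### The vertical 2-category of the pseudo-hom double category `[[H B, H^≃ D]]` -/

section Vert

set_option linter.unusedSectionVars false
set_option linter.unusedVariables false

attribute [-instance] CategoryTheory.StrictBicategory.category

open scoped CategoryTheory.Oplax.OplaxTrans CategoryTheory.Oplax.OplaxTrans.OplaxFunctor

variable {B : Type u₁} [Bicategory.{w₁, v₁} B] [Bicategory.Strict B]
  {D : Type u₃} [Bicategory.{w₃, v₃} D] [Bicategory.Strict D]

variable (B D) in
/-- (The objects of) the 2-category `V[[H B, H^≃ D]]` for strict 2-categories `B` and `D`.

Here `H B` is `B` regarded as a horizontal double category; `H^≃ D` is the double category with the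
objects of `D`, the 1-morphisms of `D` as horizontal morphisms, the adjoint equivalence data
`(v, v', unit, counit)` of `D` as vertical morphisms, and the 2-morphisms `a ≫ v ⟶ u ≫ b` of `D`
as squares with top `a`, bottom `b`, left side `u` and right side `v`; `[[-, -]]` is the pseudo-hom
double category; and `V` takes the underlying vertical 2-category. Explicitly:
* objects are double functors `H B → H^≃ D`, that is, 2-functors `B → D`;
* 1-morphisms `F ⟶ G` are vertical pseudo-transformations: an adjoint equivalence
  `F b ⟶ G b` for every object `b` and a square `F f ≫ η_b ⟶ η_a ≫ G f`, not necessarily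
  invertible, for every 1-morphism `f : a ⟶ b`, compatible with identities, composition and
  2-morphisms; this is an oplax transformation with a choice of adjoint equivalence data on each
  component (`B` has no nontrivial vertical morphisms, so there is no further data);
* 2-morphisms are the modifications. -/
structure Vert where
  /-- The underlying 2-functor. -/
  fn : TwoFunctor B D

namespace Vert

/-- The underlying oplax functor. -/
abbrev toOplax (F : Vert B D) : OplaxFunctor B D := F.fn.toStrict.toPseudofunctor.toOplax

/-- A 1-morphism of `V[[H B, H^≃ D]]`: an oplax transformation with adjoint equivalence data on
each component. -/
structure Hom (F G : Vert B D) where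
  trans : F.toOplax ⟶ G.toOplax
  right (b : B) : G.fn.obj b ⟶ F.fn.obj b
  adj (b : B) : Bicategory.Adjunction (trans.app b) (right b)
  isIso_unit (b : B) : IsIso (adj b).unit
  isIso_counit (b : B) : IsIso (adj b).counit

theorem isIso_compUnit {a b c : D} {f₁ : a ⟶ b} {g₁ : b ⟶ a} {f₂ : b ⟶ c} {g₂ : c ⟶ b}
    (adj₁ : Bicategory.Adjunction f₁ g₁) (adj₂ : Bicategory.Adjunction f₂ g₂)
    [IsIso adj₁.unit] [IsIso adj₂.unit] : IsIso (adj₁.comp adj₂).unit := by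
  rw [Bicategory.Adjunction.comp_unit]
  simp only [Bicategory.Adjunction.compUnit, bicategoricalComp]
  infer_instance

theorem isIso_compCounit {a b c : D} {f₁ : a ⟶ b} {g₁ : b ⟶ a} {f₂ : b ⟶ c} {g₂ : c ⟶ b}
    (adj₁ : Bicategory.Adjunction f₁ g₁) (adj₂ : Bicategory.Adjunction f₂ g₂)
    [IsIso adj₁.counit] [IsIso adj₂.counit] : IsIso (adj₁.comp adj₂).counit := by
  rw [Bicategory.Adjunction.comp_counit]
  simp only [Bicategory.Adjunction.compCounit, bicategoricalComp]
  infer_instance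

variable {F G H : Vert B D}

/-- The identity: identity squares and identity adjoint equivalences. -/
def Hom.id (F : Vert B D) : Hom F F where
  trans := 𝟙 F.toOplax
  right b := 𝟙 (F.fn.obj b)
  adj b := Bicategory.Adjunction.id (F.fn.obj b)
  isIso_unit b := (ρ_ (𝟙 (F.fn.obj b))).isIso_inv
  isIso_counit b := (ρ_ (𝟙 (F.fn.obj b))).isIso_hom

/-- Composition: pasting of squares and composition of adjoint equivalences. -/
def Hom.comp (η : Hom F G) (θ : Hom G H) : Hom F H where
  trans := η.trans ≫ θ.trans
  right b := θ.right b ≫ η.right b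
  adj b := (η.adj b).comp (θ.adj b)
  isIso_unit b := by
    have := η.isIso_unit b
    have := θ.isIso_unit b
    exact isIso_compUnit (η.adj b) (θ.adj b)
  isIso_counit b := by
    have := η.isIso_counit b
    have := θ.isIso_counit b
    exact isIso_compCounit (η.adj b) (θ.adj b)

instance : CategoryStruct (Vert B D) where
  Hom := Hom
  id := Hom.id
  comp := Hom.comp

/-- The oplax transformation underlying a morphism. -/
abbrev tr (η : F ⟶ G) : F.toOplax ⟶ G.toOplax := Hom.trans η

/-- The 2-morphisms are the modifications of the underlying oplax transformations. -/
instance (F G : Vert B D) : Category (F ⟶ G) where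
  Hom η θ := tr η ⟶ tr θ
  id η := 𝟙 (tr η)
  comp {η θ ι} m n := (show tr η ⟶ tr θ from m) ≫ (show tr θ ⟶ tr ι from n)
  id_comp m := Category.id_comp (obj := F.toOplax ⟶ G.toOplax) m
  comp_id m := Category.comp_id (obj := F.toOplax ⟶ G.toOplax) m
  assoc m n k := Category.assoc (obj := F.toOplax ⟶ G.toOplax) m n k

/-- An invertible modification is an invertible 2-morphism. -/
def isoMk {η θ : F ⟶ G} (e : tr η ≅ tr θ) : η ≅ θ where
  hom := e.hom
  inv := e.inv
  hom_inv_id := e.hom_inv_id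
  inv_hom_id := e.inv_hom_id

instance : Bicategory (Vert B D) where
  whiskerLeft {_ _ _} η θ ι m := tr η ◁ (show tr θ ⟶ tr ι from m)
  whiskerRight {_ _ _ η θ} m ι := (show tr η ⟶ tr θ from m) ▷ tr ι
  associator η θ ι := isoMk (α_ (tr η) (tr θ) (tr ι))
  leftUnitor η := isoMk (λ_ (tr η))
  rightUnitor η := isoMk (ρ_ (tr η))
  whiskerLeft_id _ _ := Bicategory.whiskerLeft_id (B := OplaxFunctor B D) _ _
  whiskerLeft_comp _ _ _ _ _ _ := Bicategory.whiskerLeft_comp (B := OplaxFunctor B D) _ _ _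
  id_whiskerLeft _ := Bicategory.id_whiskerLeft (B := OplaxFunctor B D) _
  comp_whiskerLeft _ _ _ _ _ := Bicategory.comp_whiskerLeft (B := OplaxFunctor B D) _ _ _
  id_whiskerRight _ _ := Bicategory.id_whiskerRight (B := OplaxFunctor B D) _ _
  comp_whiskerRight _ _ _ := Bicategory.comp_whiskerRight (B := OplaxFunctor B D) _ _ _
  whiskerRight_id _ := Bicategory.whiskerRight_id (B := OplaxFunctor B D) _
  whiskerRight_comp _ _ _ := Bicategory.whiskerRight_comp (B := OplaxFunctor B D) _ _ _
  whisker_assoc _ _ _ _ _ := Bicategory.whisker_assoc (B := OplaxFunctor B D) _ _ _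
  whisker_exchange _ _ := Bicategory.whisker_exchange (B := OplaxFunctor B D) _ _
  pentagon _ _ _ _ := Bicategory.pentagon (B := OplaxFunctor B D) _ _ _ _
  triangle _ _ := Bicategory.triangle (B := OplaxFunctor B D) _ _

/-- The component at `b` of a 2-morphism. -/
def cmp {η θ : F ⟶ G} (m : η ⟶ θ) (b : B) : (tr η).app b ⟶ (tr θ).app b :=
  Oplax.OplaxTrans.Modification.app (Oplax.OplaxTrans.Hom.as (show tr η ⟶ tr θ from m)) b

theorem hom₂_ext {η θ : F ⟶ G} {m n : η ⟶ θ} (h : ∀ b, cmp m b = cmp n b) : m = n :=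
  Oplax.OplaxTrans.homCategory.ext h

theorem hom₂_heq {η η' θ θ' : F ⟶ G} (hη : η = η') (hθ : θ = θ') {m : η ⟶ θ} {n : η' ⟶ θ'}
    (h : ∀ b, HEq (cmp m b) (cmp n b)) : HEq m n := by
  subst hη hθ
  exact heq_of_eq (hom₂_ext fun b => eq_of_heq (h b))

theorem cmp_eqToHom {η θ : F ⟶ G} (h : η = θ) (b : B) :
    cmp (eqToHom h) b = eqToHom (by rw [h]) := by
  subst h; rfl

theorem hom_ext {η θ : F ⟶ G} (happ : ∀ b, (tr η).app b = (tr θ).app b)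
    (hnat : ∀ {a b : B} (f : a ⟶ b),
      (tr η).naturality f = eqToHom (by rw [happ]) ≫ (tr θ).naturality f ≫
        eqToHom (by rw [happ]))
    (hright : ∀ b, Hom.right η b = Hom.right θ b)
    (hunit : ∀ b, (Hom.adj η b).unit = (Hom.adj θ b).unit ≫ eqToHom (by rw [happ, hright]))
    (hcounit : ∀ b, (Hom.adj η b).counit =
      eqToHom (by rw [happ, hright]) ≫ (Hom.adj θ b).counit) : η = θ := by
  obtain ⟨⟨a, n, _, _, _⟩, r, adj, _, _⟩ := η
  obtain ⟨⟨a', n', _, _, _⟩, r', adj', _, _⟩ := θ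
  obtain rfl : a = a' := funext happ
  obtain rfl : r = r' := funext hright
  obtain rfl : @n = @n' := by
    funext x y f
    simpa using hnat f
  obtain rfl : adj = adj' := by
    funext b
    exact Bicategory.Adjunction.ext (by simpa using hunit b) (by simpa using hcounit b)
  rfl

section Coherence

attribute [local simp] bicategoricalComp Bicategory.Adjunction.id
  Bicategory.Strict.leftUnitor_eqToIso Bicategory.Strict.rightUnitor_eqToIso
  Bicategory.Strict.associator_eqToIso

variable {a b c d : D} {f : a ⟶ b} {f' : b ⟶ a} {g : b ⟶ c} {g' : c ⟶ b}
  {h : c ⟶ d} {h' : d ⟶ c}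

theorem id_comp_unit (adj : Bicategory.Adjunction f f') :
    ((Bicategory.Adjunction.id a).comp adj).unit = adj.unit ≫
      eqToHom (by rw [Bicategory.Strict.id_comp, Bicategory.Strict.comp_id]) := by
  rw [Bicategory.Adjunction.comp_unit]
  simp

theorem id_comp_counit (adj : Bicategory.Adjunction f f') :
    ((Bicategory.Adjunction.id a).comp adj).counit =
      eqToHom (by rw [Bicategory.Strict.id_comp, Bicategory.Strict.comp_id]) ≫ adj.counit := by
  rw [Bicategory.Adjunction.comp_counit]
  simp

theorem comp_id_unit (adj : Bicategory.Adjunction f f') :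
    (adj.comp (Bicategory.Adjunction.id b)).unit = adj.unit ≫
      eqToHom (by rw [Bicategory.Strict.id_comp, Bicategory.Strict.comp_id]) := by
  rw [Bicategory.Adjunction.comp_unit]
  simp

theorem comp_id_counit (adj : Bicategory.Adjunction f f') :
    (adj.comp (Bicategory.Adjunction.id b)).counit =
      eqToHom (by rw [Bicategory.Strict.id_comp, Bicategory.Strict.comp_id]) ≫ adj.counit := by
  rw [Bicategory.Adjunction.comp_counit]
  simp

theorem assoc_unit (adj : Bicategory.Adjunction f f') (adj' : Bicategory.Adjunction g g')
    (adj'' : Bicategory.Adjunction h h') :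
    ((adj.comp adj').comp adj'').unit = (adj.comp (adj'.comp adj'')).unit ≫
      eqToHom (by simp only [Bicategory.Strict.assoc]) := by
  simp only [Bicategory.Adjunction.comp_unit, Bicategory.Adjunction.compUnit]
  simp

theorem assoc_counit (adj : Bicategory.Adjunction f f') (adj' : Bicategory.Adjunction g g')
    (adj'' : Bicategory.Adjunction h h') :
    ((adj.comp adj').comp adj'').counit = eqToHom (by simp only [Bicategory.Strict.assoc]) ≫
      (adj.comp (adj'.comp adj'')).counit := by
  simp only [Bicategory.Adjunction.comp_counit, Bicategory.Adjunction.compCounit]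
  simp

variable {F' G' H' K' : OplaxFunctor B D}

theorem trans_id_comp (η : F' ⟶ G') {x y : B} (k : x ⟶ y) :
    (𝟙 F' ≫ η).naturality k = eqToHom (congrArg (F'.map k ≫ ·) (Bicategory.Strict.id_comp _)) ≫
      η.naturality k ≫ eqToHom (congrArg (· ≫ G'.map k) (Bicategory.Strict.id_comp _).symm) := by
  change (α_ (F'.map k) (𝟙 _) (η.app y)).inv ≫
    ((ρ_ (F'.map k)).hom ≫ (λ_ (F'.map k)).inv) ▷ η.app y ≫
    (α_ (𝟙 _) (F'.map k) (η.app y)).hom ≫ 𝟙 _ ◁ η.naturality k ≫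
    (α_ (𝟙 _) (η.app x) (G'.map k)).inv = _
  simp

theorem trans_comp_id (η : F' ⟶ G') {x y : B} (k : x ⟶ y) :
    (η ≫ 𝟙 G').naturality k = eqToHom (congrArg (F'.map k ≫ ·) (Bicategory.Strict.comp_id _)) ≫
      η.naturality k ≫ eqToHom (congrArg (· ≫ G'.map k) (Bicategory.Strict.comp_id _).symm) := by
  change (α_ (F'.map k) (η.app y) (𝟙 _)).inv ≫ η.naturality k ▷ 𝟙 _ ≫
    (α_ (η.app x) (G'.map k) (𝟙 _)).hom ≫
    η.app x ◁ ((ρ_ (G'.map k)).hom ≫ (λ_ (G'.map k)).inv) ≫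
    (α_ (η.app x) (𝟙 _) (G'.map k)).inv = _
  simp

theorem trans_assoc (η : F' ⟶ G') (θ : G' ⟶ H') (ι : H' ⟶ K') {x y : B} (k : x ⟶ y) :
    ((η ≫ θ) ≫ ι).naturality k =
      eqToHom (congrArg (F'.map k ≫ ·) (Bicategory.Strict.assoc _ _ _)) ≫
      (η ≫ θ ≫ ι).naturality k ≫
        eqToHom (congrArg (· ≫ K'.map k) (Bicategory.Strict.assoc _ _ _).symm) := by
  change (α_ (F'.map k) (η.app y ≫ θ.app y) (ι.app y)).inv ≫
      ((α_ (F'.map k) (η.app y) (θ.app y)).inv ≫ η.naturality k ▷ θ.app y ≫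
        (α_ (η.app x) (G'.map k) (θ.app y)).hom ≫ η.app x ◁ θ.naturality k ≫
        (α_ (η.app x) (θ.app x) (H'.map k)).inv) ▷ ι.app y ≫
      (α_ (η.app x ≫ θ.app x) (H'.map k) (ι.app y)).hom ≫
      (η.app x ≫ θ.app x) ◁ ι.naturality k ≫
      (α_ (η.app x ≫ θ.app x) (ι.app x) (K'.map k)).inv =
    eqToHom (show F'.map k ≫ (η.app y ≫ θ.app y) ≫ ι.app y = F'.map k ≫ η.app y ≫ θ.app y ≫ ι.app y
        from congrArg (F'.map k ≫ ·) (Bicategory.Strict.assoc _ _ _)) ≫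
      ((α_ (F'.map k) (η.app y) (θ.app y ≫ ι.app y)).inv ≫
      η.naturality k ▷ (θ.app y ≫ ι.app y) ≫
      (α_ (η.app x) (G'.map k) (θ.app y ≫ ι.app y)).hom ≫
      η.app x ◁ ((α_ (G'.map k) (θ.app y) (ι.app y)).inv ≫ θ.naturality k ▷ ι.app y ≫
        (α_ (θ.app x) (H'.map k) (ι.app y)).hom ≫ θ.app x ◁ ι.naturality k ≫
        (α_ (θ.app x) (ι.app x) (K'.map k)).inv) ≫
      (α_ (η.app x) (θ.app x ≫ ι.app x) (K'.map k)).inv) ≫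
      eqToHom (show (η.app x ≫ θ.app x ≫ ι.app x) ≫ K'.map k =
        ((η.app x ≫ θ.app x) ≫ ι.app x) ≫ K'.map k
        from congrArg (· ≫ K'.map k) (Bicategory.Strict.assoc _ _ _).symm)
  simp

end Coherence

instance : Bicategory.Strict (Vert B D) where
  id_comp η := hom_ext (fun _ => Bicategory.Strict.id_comp _) (fun f => trans_id_comp (tr η) f)
    (fun _ => Bicategory.Strict.comp_id _) (fun _ => id_comp_unit _) (fun _ => id_comp_counit _)
  comp_id η := hom_ext (fun _ => Bicategory.Strict.comp_id _) (fun f => trans_comp_id (tr η) f)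
    (fun _ => Bicategory.Strict.id_comp _) (fun _ => comp_id_unit _) (fun _ => comp_id_counit _)
  assoc η θ ι := hom_ext (fun _ => Bicategory.Strict.assoc _ _ _)
    (fun f => trans_assoc (tr η) (tr θ) (tr ι) f)
    (fun _ => (Bicategory.Strict.assoc _ _ _).symm) (fun _ => assoc_unit _ _ _)
    (fun _ => assoc_counit _ _ _)
  leftUnitor_eqToIso η := by
    refine Iso.ext (hom₂_ext fun b => ?_)
    rw [eqToIso.hom, cmp_eqToHom]
    exact congrArg Iso.hom (Bicategory.Strict.leftUnitor_eqToIso _)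
  rightUnitor_eqToIso η := by
    refine Iso.ext (hom₂_ext fun b => ?_)
    rw [eqToIso.hom, cmp_eqToHom]
    exact congrArg Iso.hom (Bicategory.Strict.rightUnitor_eqToIso _)
  associator_eqToIso η θ ι := by
    refine Iso.ext (hom₂_ext fun b => ?_)
    rw [eqToIso.hom, cmp_eqToHom]
    exact congrArg Iso.hom (Bicategory.Strict.associator_eqToIso _ _ _)

section Coherence

attribute [local simp] Bicategory.Strict.leftUnitor_eqToIso Bicategory.Strict.rightUnitor_eqToIso
  Bicategory.Strict.associator_eqToIso

/-- The component of a transformation at an object. -/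
abbrev app (η : F.toOplax ⟶ G.toOplax) (x : B) : F.fn.obj x ⟶ G.fn.obj x := η.app x

/-- The square of a transformation at a 1-morphism. -/
abbrev nat (η : F.toOplax ⟶ G.toOplax) {x y : B} (f : x ⟶ y) :
    F.fn.map f ≫ app η y ⟶ app η x ≫ G.fn.map f := η.naturality f

theorem nat_natural (η : F.toOplax ⟶ G.toOplax) {x y : B} {f g : x ⟶ y} (s : f ⟶ g) :
    F.fn.map₂ s ▷ app η y ≫ nat η g = nat η f ≫ app η x ◁ G.fn.map₂ s :=
  η.naturality_naturality s

theorem nat_id (η : F.toOplax ⟶ G.toOplax) (x : B) :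
    nat η (𝟙 x) = eqToHom (by
      rw [F.fn.map_id, G.fn.map_id, Bicategory.Strict.id_comp, Bicategory.Strict.comp_id]) := by
  have h : nat η (𝟙 x) ≫ app η x ◁ eqToHom (G.fn.map_id x) =
    eqToHom (F.fn.map_id x) ▷ app η x ≫ (λ_ (app η x)).hom ≫ (ρ_ (app η x)).inv := η.naturality_id x
  rw [Bicategory.whiskerLeft_eqToHom, comp_eqToHom_iff] at h
  rw [h]
  simp

theorem nat_comp (η : F.toOplax ⟶ G.toOplax) {x y z : B} (f : x ⟶ y) (g : y ⟶ z) :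
    nat η (f ≫ g) =
      eqToHom (by rw [F.fn.map_comp, Bicategory.Strict.assoc]) ≫
      F.fn.map f ◁ nat η g ≫
      eqToHom (by rw [Bicategory.Strict.assoc]) ≫
      nat η f ▷ G.fn.map g ≫
      eqToHom (by rw [G.fn.map_comp, Bicategory.Strict.assoc]) := by
  have h : nat η (f ≫ g) ≫ app η x ◁ eqToHom (G.fn.map_comp f g) =
    eqToHom (F.fn.map_comp f g) ▷ app η z ≫ (α_ (F.fn.map f) (F.fn.map g) (app η z)).hom ≫
      F.fn.map f ◁ nat η g ≫ (α_ (F.fn.map f) (app η y) (G.fn.map g)).inv ≫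
      nat η f ▷ G.fn.map g ≫ (α_ (app η x) (G.fn.map f) (G.fn.map g)).hom :=
    η.naturality_comp f g
  rw [Bicategory.whiskerLeft_eqToHom, comp_eqToHom_iff] at h
  rw [h]
  simp

theorem nat_congr (η : F.toOplax ⟶ G.toOplax) {x y : B} {f g : x ⟶ y} (h : f = g) :
    nat η f = eqToHom (by rw [h]) ≫ nat η g ≫ eqToHom (by rw [h]) := by
  subst h
  simp

/-- Construct an oplax transformation between 2-functors from strict forms of the axioms. -/
def mkTrans (a : ∀ x, F.fn.obj x ⟶ G.fn.obj x)
    (n : ∀ {x y : B} (f : x ⟶ y), F.fn.map f ≫ a y ⟶ a x ≫ G.fn.map f)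
    (n_natural : ∀ {x y : B} {f g : x ⟶ y} (s : f ⟶ g),
      F.fn.map₂ s ▷ a y ≫ n g = n f ≫ a x ◁ G.fn.map₂ s)
    (n_id : ∀ x : B, n (𝟙 x) = eqToHom (by
      rw [F.fn.map_id, G.fn.map_id, Bicategory.Strict.id_comp, Bicategory.Strict.comp_id]))
    (n_comp : ∀ {x y z : B} (f : x ⟶ y) (g : y ⟶ z), n (f ≫ g) =
      eqToHom (by rw [F.fn.map_comp, Bicategory.Strict.assoc]) ≫
      F.fn.map f ◁ n g ≫
      eqToHom (by rw [Bicategory.Strict.assoc]) ≫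
      n f ▷ G.fn.map g ≫
      eqToHom (by rw [G.fn.map_comp, Bicategory.Strict.assoc])) :
    F.toOplax ⟶ G.toOplax where
  app := a
  naturality := n
  naturality_naturality := n_natural
  naturality_id x := by
    change n (𝟙 x) ≫ a x ◁ eqToHom (G.fn.map_id x) =
      eqToHom (F.fn.map_id x) ▷ a x ≫ (λ_ (a x)).hom ≫ (ρ_ (a x)).inv
    rw [n_id]
    simp
  naturality_comp {x y z} f g := by
    change n (f ≫ g) ≫ a x ◁ eqToHom (G.fn.map_comp f g) =
      eqToHom (F.fn.map_comp f g) ▷ a z ≫ (α_ (F.fn.map f) (F.fn.map g) (a z)).hom ≫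
      F.fn.map f ◁ n g ≫ (α_ (F.fn.map f) (a y) (G.fn.map g)).inv ≫
      n f ▷ G.fn.map g ≫ (α_ (a x) (G.fn.map f) (G.fn.map g)).hom
    rw [n_comp]
    simp

variable {B' : Type u₂} [Bicategory.{w₂, v₂} B'] [Bicategory.Strict B']

/-- Construct a 2-morphism from its components. -/
def mk₂ {η θ : F ⟶ G} (m : ∀ x, app (tr η) x ⟶ app (tr θ) x)
    (hm : ∀ {x y : B} (f : x ⟶ y), F.fn.map f ◁ m y ≫ nat (tr θ) f =
      nat (tr η) f ≫ m x ▷ G.fn.map f) : η ⟶ θ :=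
  Oplax.OplaxTrans.Hom.of (η := tr η) (θ := tr θ)
    { app := m, naturality := hm }

theorem cmp_natural {η θ : F ⟶ G} (m : η ⟶ θ) {x y : B} (f : x ⟶ y) :
    F.fn.map f ◁ (show app (tr η) y ⟶ app (tr θ) y from cmp m y) ≫ nat (tr θ) f =
      nat (tr η) f ≫ (show app (tr η) x ⟶ app (tr θ) x from cmp m x) ▷ G.fn.map f :=
  Oplax.OplaxTrans.Modification.naturality
    (Oplax.OplaxTrans.Hom.as (show tr η ⟶ tr θ from m)) f

theorem eq_conj {C : Type*} [Category* C] {X Y : C} (f : X ⟶ Y) (h : X = X) (h' : Y = Y) :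
    f = eqToHom h ≫ f ≫ eqToHom h' := by
  simp

/-- Precomposition on 1-morphisms. -/
def preMap (P : TwoFunctor B B') {F G : Vert B' D} (η : F ⟶ G) :
    (⟨P.comp F.fn⟩ : Vert B D) ⟶ ⟨P.comp G.fn⟩ :=
  { trans := mkTrans (F := ⟨P.comp F.fn⟩) (G := ⟨P.comp G.fn⟩) (fun x => app (tr η) (P.obj x))
        (fun f => nat (tr η) (P.map f))
        (fun s => nat_natural (tr η) (P.map₂ s))
        (fun x => by
          rw [nat_congr (tr η) (P.map_id x), nat_id]
          simp
          rfl)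
        (fun f g => by
          rw [nat_congr (tr η) (P.map_comp f g), nat_comp]
          simp
          rfl)
    right := fun x => Hom.right η (P.obj x)
    adj := fun x => Hom.adj η (P.obj x)
    isIso_unit := fun x => Hom.isIso_unit η (P.obj x)
    isIso_counit := fun x => Hom.isIso_counit η (P.obj x) }

/-- Precomposition on 2-morphisms. -/
def preMap₂ (P : TwoFunctor B B') {F G : Vert B' D} {η θ : F ⟶ G} (m : η ⟶ θ) :
    preMap P η ⟶ preMap P θ :=
  mk₂ (fun x => cmp m (P.obj x)) (fun f => cmp_natural m (P.map f))

theorem preMap₂_whiskerLeft (P : TwoFunctor B B') {F G H : Vert B' D} (ι : F ⟶ G) {η θ : G ⟶ H}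
    (m : η ⟶ θ) : preMap₂ P (ι ◁ m) = preMap P ι ◁ preMap₂ P m :=
  hom₂_ext fun _ => rfl

theorem preMap₂_whiskerRight (P : TwoFunctor B B') {F G H : Vert B' D} {η θ : F ⟶ G}
    (m : η ⟶ θ) (ι : G ⟶ H) : preMap₂ P (m ▷ ι) = preMap₂ P m ▷ preMap P ι :=
  hom₂_ext fun _ => rfl

/-- The 2-functor `V[[H B', H^≃ D]] ⥤ V[[H B, H^≃ D]]` given by precomposition with `P`. -/
def pre (P : TwoFunctor B B') : TwoFunctor (Vert B' D) (Vert B D) where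
  obj F := ⟨P.comp F.fn⟩
  map η := preMap P η
  map₂ m := preMap₂ P m
  map₂_id _ := rfl
  map₂_comp _ _ := rfl
  map_id _ := rfl
  map_comp _ _ := rfl
  map₂_whisker_left ι _ _ m := (preMap₂_whiskerLeft P ι m).trans (eq_conj _ _ _)
  map₂_whisker_right m ι := (preMap₂_whiskerRight P m ι).trans (eq_conj _ _ _)

variable {D' : Type u₂} [Bicategory.{w₂, v₂} D'] [Bicategory.Strict D']

section Post

attribute [local simp] PrelaxFunctor.map₂_eqToHom

/-- The image under a strict 2-functor `Q` of a 2-morphism between composites. -/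
def sq (Q : TwoFunctor D D') {a b b' c : D} {p : a ⟶ b} {s : b ⟶ c} {r : a ⟶ b'} {q : b' ⟶ c}
    (n : p ≫ s ⟶ r ≫ q) : Q.map p ≫ Q.map s ⟶ Q.map r ≫ Q.map q :=
  eqToHom (Q.map_comp p s).symm ≫ Q.map₂ n ≫ eqToHom (Q.map_comp r q)

theorem sq_natural (Q : TwoFunctor D D') {a b b' c : D} {p p' : a ⟶ b} {s : b ⟶ c}
    {r : a ⟶ b'} {q q' : b' ⟶ c} (n : p ≫ s ⟶ r ≫ q) (n' : p' ≫ s ⟶ r ≫ q')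
    (u : p ⟶ p') (v : q ⟶ q') (h : u ▷ s ≫ n' = n ≫ r ◁ v) :
    Q.map₂ u ▷ Q.map s ≫ sq Q n' = sq Q n ≫ Q.map r ◁ Q.map₂ v := by
  have h' := congrArg (fun t => eqToHom (Q.map_comp _ _).symm ≫ Q.map₂ t ≫
        eqToHom (Q.map_comp _ _)) h
  simpa [sq, Q.map₂_whisker_left, Q.map₂_whisker_right] using h'

theorem sq_natural' (Q : TwoFunctor D D') {a b b' c : D} {p : a ⟶ b} {s s' : b ⟶ c}
    {r r' : a ⟶ b'} {q : b' ⟶ c} (n : p ≫ s ⟶ r ≫ q) (n' : p ≫ s' ⟶ r' ≫ q)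
    (u : s ⟶ s') (v : r ⟶ r') (h : p ◁ u ≫ n' = n ≫ v ▷ q) :
    Q.map p ◁ Q.map₂ u ≫ sq Q n' = sq Q n ≫ Q.map₂ v ▷ Q.map q := by
  have h' := congrArg (fun t => eqToHom (Q.map_comp _ _).symm ≫ Q.map₂ t ≫
        eqToHom (Q.map_comp _ _)) h
  simpa [sq, Q.map₂_whisker_left, Q.map₂_whisker_right] using h'

theorem sq_congr (Q : TwoFunctor D D') {a b b' c : D} {p p' : a ⟶ b} {s s' : b ⟶ c}
    {r r' : a ⟶ b'} {q q' : b' ⟶ c} (n : p ≫ s ⟶ r ≫ q) (n' : p' ≫ s' ⟶ r' ≫ q')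
    (hp : p = p') (hs : s = s') (hr : r = r') (hq : q = q')
    (h : n = eqToHom (by rw [hp, hs]) ≫ n' ≫ eqToHom (by rw [hr, hq])) :
    sq Q n = eqToHom (by rw [hp, hs]) ≫ sq Q n' ≫ eqToHom (by rw [hr, hq]) := by
  subst hp hs hr hq
  simpa using congrArg (sq Q) h

theorem sq_eqToHom (Q : TwoFunctor D D') {a b b' c : D} {p : a ⟶ b} {s : b ⟶ c} {r : a ⟶ b'}
    {q : b' ⟶ c} (h : p ≫ s = r ≫ q) :
    sq Q (eqToHom h) = eqToHom (by rw [← Q.map_comp, ← Q.map_comp, h]) := by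
  simp [sq]

theorem sq_comp (Q : TwoFunctor D D') {a b c a' b' c' : D} {p : a ⟶ b} {p' : b ⟶ c} {pp : a ⟶ c}
    {r : a ⟶ a'} {s : b ⟶ b'} {t : c ⟶ c'} {q : a' ⟶ b'} {q' : b' ⟶ c'} {qq : a' ⟶ c'}
    (n : p ≫ s ⟶ r ≫ q) (n' : p' ≫ t ⟶ s ≫ q') (h : pp ≫ t = p ≫ p' ≫ t)
    (h' : p ≫ s ≫ q' = (p ≫ s) ≫ q') (h'' : (r ≫ q) ≫ q' = r ≫ qq)
    (k : Q.map pp ≫ Q.map t = Q.map p ≫ Q.map p' ≫ Q.map t)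
    (k' : Q.map p ≫ Q.map s ≫ Q.map q' = (Q.map p ≫ Q.map s) ≫ Q.map q')
    (k'' : (Q.map r ≫ Q.map q) ≫ Q.map q' = Q.map r ≫ Q.map qq) :
    sq Q (eqToHom h ≫ p ◁ n' ≫ eqToHom h' ≫ n ▷ q' ≫ eqToHom h'') =
      eqToHom k ≫ Q.map p ◁ sq Q n' ≫ eqToHom k' ≫ sq Q n ▷ Q.map q' ≫ eqToHom k'' := by
  simp [sq, Q.map₂_whisker_left, Q.map₂_whisker_right]

/-- Postcomposition on transformations. -/
def postTrans (Q : TwoFunctor D D') {F G : Vert B D} (η : F.toOplax ⟶ G.toOplax) :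
    toOplax ⟨F.fn.comp Q⟩ ⟶ toOplax ⟨G.fn.comp Q⟩ :=
  mkTrans (F := ⟨F.fn.comp Q⟩) (G := ⟨G.fn.comp Q⟩) (fun x => Q.map (app η x))
    (fun f => sq Q (nat η f))
    (fun s => sq_natural Q (nat η _) (nat η _) _ _ (nat_natural η s))
    (fun x => (congrArg (sq Q) (nat_id η x)).trans (sq_eqToHom Q _))
    (fun f g => (congrArg (sq Q) (nat_comp η f g)).trans (sq_comp Q _ _ _ _ _ _ _ _))

/-- The image of an adjunction under a strict 2-functor. -/
def mapAdj (Q : TwoFunctor D D') {a b : D} {f : a ⟶ b} {f' : b ⟶ a}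
    (adj : Bicategory.Adjunction f f') : Bicategory.Adjunction (Q.map f) (Q.map f') where
  unit := eqToHom (Q.map_id a).symm ≫ Q.map₂ adj.unit ≫ eqToHom (Q.map_comp f f')
  counit := eqToHom (Q.map_comp f' f).symm ≫ Q.map₂ adj.counit ≫ eqToHom (Q.map_id b)
  left_triangle := by
    have h := (Q.toStrict.mapAdjunction adj).left_triangle
    rw [StrictPseudofunctor.mapAdjunction_unit', StrictPseudofunctor.mapAdjunction_counit'] at h
    exact h
  right_triangle := by
    have h := (Q.toStrict.mapAdjunction adj).right_triangle
    rw [StrictPseudofunctor.mapAdjunction_unit', StrictPseudofunctor.mapAdjunction_counit'] at h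
    exact h

theorem isIso_mapUnit (Q : TwoFunctor D D') {a b : D} {f : a ⟶ b} {f' : b ⟶ a}
    (adj : Bicategory.Adjunction f f') (_ : IsIso adj.unit) :
    IsIso (mapAdj Q adj).unit := by
  dsimp only [mapAdj]
  infer_instance

theorem isIso_mapCounit (Q : TwoFunctor D D') {a b : D} {f : a ⟶ b} {f' : b ⟶ a}
    (adj : Bicategory.Adjunction f f') (_ : IsIso adj.counit) :
    IsIso (mapAdj Q adj).counit := by
  dsimp only [mapAdj]
  infer_instance

theorem nat_one (F : Vert B D) {x y : B} (f : x ⟶ y) :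
    nat (𝟙 F.toOplax) f = eqToHom ((Bicategory.Strict.comp_id (F.fn.map f)).trans
      (Bicategory.Strict.id_comp (F.fn.map f)).symm) := by
  change (ρ_ (F.fn.map f)).hom ≫ (λ_ (F.fn.map f)).inv = _
  simp

theorem nat_trans {F G H : Vert B D} (η : F.toOplax ⟶ G.toOplax) (θ : G.toOplax ⟶ H.toOplax)
    {x y : B} (f : x ⟶ y) :
    nat (η ≫ θ) f = eqToHom (Bicategory.Strict.assoc (F.fn.map f) (app η y) (app θ y)).symm ≫
      nat η f ▷ app θ y ≫ eqToHom (Bicategory.Strict.assoc _ _ _) ≫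
      app η x ◁ nat θ f ≫
      eqToHom (Bicategory.Strict.assoc (app η x) (app θ x) (H.fn.map f)).symm := by
  change (α_ (F.fn.map f) (app η y) (app θ y)).inv ≫ nat η f ▷ app θ y ≫
    (α_ (app η x) (G.fn.map f) (app θ y)).hom ≫ app η x ◁ nat θ f ≫
    (α_ (app η x) (app θ x) (H.fn.map f)).inv = _
  simp

theorem sq_trans (Q : TwoFunctor D D') {a b a' b' a'' b'' : D} {p : a ⟶ b} {q : a' ⟶ b'}
    {r : a'' ⟶ b''} {s : a ⟶ a'} {t : b ⟶ b'} {s' : a' ⟶ a''} {t' : b' ⟶ b''}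
    (n : p ≫ t ⟶ s ≫ q) (n' : q ≫ t' ⟶ s' ≫ r) :
    sq Q (eqToHom (Bicategory.Strict.assoc p t t').symm ≫ n ▷ t' ≫
      eqToHom (Bicategory.Strict.assoc _ _ _) ≫ s ◁ n' ≫
      eqToHom (Bicategory.Strict.assoc s s' r).symm) =
    eqToHom (congrArg (Q.map p ≫ ·) (Q.map_comp t t')) ≫
    (eqToHom (Bicategory.Strict.assoc (Q.map p) (Q.map t) (Q.map t')).symm ≫ sq Q n ▷ Q.map t' ≫
      eqToHom (Bicategory.Strict.assoc _ _ _) ≫ Q.map s ◁ sq Q n' ≫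
      eqToHom (Bicategory.Strict.assoc (Q.map s) (Q.map s') (Q.map r)).symm) ≫
    eqToHom (congrArg (· ≫ Q.map r) (Q.map_comp s s').symm) := by
  simp [sq, Q.map₂_whisker_left, Q.map₂_whisker_right]

theorem mapAdj_id_unit (Q : TwoFunctor D D') (a : D) :
    (mapAdj Q (Bicategory.Adjunction.id a)).unit =
      (Bicategory.Adjunction.id (Q.obj a)).unit ≫ eqToHom (by rw [Q.map_id]) := by
  simp [Bicategory.Adjunction.id, mapAdj]

theorem mapAdj_id_counit (Q : TwoFunctor D D') (a : D) :
    (mapAdj Q (Bicategory.Adjunction.id a)).counit =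
      eqToHom (by rw [Q.map_id]) ≫ (Bicategory.Adjunction.id (Q.obj a)).counit := by
  simp [Bicategory.Adjunction.id, mapAdj]

theorem mapAdj_comp_unit (Q : TwoFunctor D D') {a b c : D} {f : a ⟶ b} {f' : b ⟶ a}
    {g : b ⟶ c} {g' : c ⟶ b} (adj : Bicategory.Adjunction f f')
    (adj' : Bicategory.Adjunction g g') :
    (mapAdj Q (adj.comp adj')).unit = ((mapAdj Q adj).comp (mapAdj Q adj')).unit ≫
      eqToHom (by rw [Q.map_comp, Q.map_comp]) := by
  simp [mapAdj, Bicategory.Adjunction.compUnit, bicategoricalComp, Q.map₂_whisker_left,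
    Q.map₂_whisker_right]

theorem mapAdj_comp_counit (Q : TwoFunctor D D') {a b c : D} {f : a ⟶ b} {f' : b ⟶ a}
    {g : b ⟶ c} {g' : c ⟶ b} (adj : Bicategory.Adjunction f f')
    (adj' : Bicategory.Adjunction g g') :
    (mapAdj Q (adj.comp adj')).counit = eqToHom (by rw [Q.map_comp, Q.map_comp]) ≫
      ((mapAdj Q adj).comp (mapAdj Q adj')).counit := by
  simp [mapAdj, Bicategory.Adjunction.compCounit, bicategoricalComp, Q.map₂_whisker_left,
    Q.map₂_whisker_right]

/-- Postcomposition on 1-morphisms. -/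
def postMap (Q : TwoFunctor D D') {F G : Vert B D} (η : F ⟶ G) :
    (⟨F.fn.comp Q⟩ : Vert B D') ⟶ ⟨G.fn.comp Q⟩ :=
  { trans := postTrans Q (tr η)
    right := fun x => Q.map (Hom.right η x)
    adj := fun x => mapAdj Q (Hom.adj η x)
    isIso_unit := fun x => isIso_mapUnit Q _ (Hom.isIso_unit η x)
    isIso_counit := fun x => isIso_mapCounit Q _ (Hom.isIso_counit η x) }

/-- Postcomposition on 2-morphisms. -/
def postMap₂ (Q : TwoFunctor D D') {F G : Vert B D} {η θ : F ⟶ G} (m : η ⟶ θ) :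
    postMap Q η ⟶ postMap Q θ :=
  mk₂ (fun x => Q.map₂ (cmp m x))
    (fun f => sq_natural' Q (nat (tr η) f) (nat (tr θ) f) _ _ (cmp_natural m f))

theorem eqToHom_conj {C : Type*} [Category* C] {X Y Z W : C} (h : X = Y) (a : X = Z) (b : Z = W)
    (c : W = Y) : eqToHom h = eqToHom a ≫ eqToHom b ≫ eqToHom c := by
  simp

theorem postMap_id (Q : TwoFunctor D D') (F : Vert B D) :
    postMap Q (𝟙 F) = 𝟙 (⟨F.fn.comp Q⟩ : Vert B D') :=
  hom_ext (fun x => Q.map_id _)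
    (fun {x y} f => ((congrArg (sq Q) (nat_one F f)).trans (sq_eqToHom Q _)).trans (by
      change _ = eqToHom _ ≫ nat (𝟙 (toOplax ⟨F.fn.comp Q⟩)) f ≫ eqToHom _
      rw [nat_one]
      exact eqToHom_conj _ _ _ _))
    (fun x => Q.map_id _) (fun x => mapAdj_id_unit Q _) (fun x => mapAdj_id_counit Q _)

theorem postMap_comp (Q : TwoFunctor D D') {F G H : Vert B D} (η : F ⟶ G) (θ : G ⟶ H) :
    postMap Q (η ≫ θ) = postMap Q η ≫ postMap Q θ :=
  hom_ext (fun x => Q.map_comp _ _)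
    (fun {x y} f => ((congrArg (sq Q) (nat_trans (tr η) (tr θ) f)).trans
      (sq_trans Q _ _)).trans (by
        change _ = eqToHom _ ≫ nat (postTrans Q (tr η) ≫ postTrans Q (tr θ)) f ≫ eqToHom _
        rw [nat_trans]
        rfl))
    (fun x => Q.map_comp _ _) (fun x => mapAdj_comp_unit Q _ _)
    (fun x => mapAdj_comp_counit Q _ _)

theorem cmp_conj {F G : Vert B D} {η η' θ θ' : F ⟶ G} (h : η = η') (h' : θ' = θ) (m : η' ⟶ θ')
    (x : B) : cmp (eqToHom h ≫ m ≫ eqToHom h') x =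
      eqToHom (congrArg (fun t => (tr t).app x) h) ≫ cmp m x ≫
        eqToHom (congrArg (fun t => (tr t).app x) h') := by
  subst h h'
  simp

/-- The 2-functor `V[[H B, H^≃ D]] ⥤ V[[H B, H^≃ D']]` given by postcomposition with `Q`. -/
def post (Q : TwoFunctor D D') : TwoFunctor (Vert B D) (Vert B D') where
  obj F := ⟨F.fn.comp Q⟩
  map η := postMap Q η
  map₂ m := postMap₂ Q m
  map₂_id _ := hom₂_ext fun x => Q.map₂_id _
  map₂_comp _ _ := hom₂_ext fun x => Q.map₂_comp _ _
  map_id _ := postMap_id Q _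
  map_comp _ _ := postMap_comp Q _ _
  map₂_whisker_left ι _ _ m := hom₂_ext fun x =>
    (Q.map₂_whisker_left _ (cmp m x)).trans (cmp_conj (postMap_comp Q ι _)
      (postMap_comp Q ι _).symm (postMap Q ι ◁ postMap₂ Q m) x).symm
  map₂_whisker_right m ι := hom₂_ext fun x =>
    (Q.map₂_whisker_right (cmp m x) _).trans (cmp_conj (postMap_comp Q _ ι)
      (postMap_comp Q _ ι).symm (postMap₂ Q m ▷ postMap Q ι) x).symm

theorem pre_id : pre (D := D) (TwoFunctor.id B) = TwoFunctor.id (Vert B D) := rfl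

theorem sq_id {a b b' c : D} {p : a ⟶ b} {s : b ⟶ c} {r : a ⟶ b'} {q : b' ⟶ c}
    (n : p ≫ s ⟶ r ≫ q) : sq (TwoFunctor.id D) n = n :=
  (Category.id_comp _).trans (Category.comp_id _)

theorem mapAdj_id' {a b : D} {f : a ⟶ b} {f' : b ⟶ a} (adj : Bicategory.Adjunction f f') :
    mapAdj (TwoFunctor.id D) adj = adj :=
  Bicategory.Adjunction.ext ((Category.id_comp _).trans (Category.comp_id _))
    ((Category.id_comp _).trans (Category.comp_id _))

theorem postMap_id_eq {F G : Vert B D} (η : F ⟶ G) : postMap (TwoFunctor.id D) η = η :=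
  hom_ext (fun _ => rfl) (fun f => (sq_id _).trans (eq_conj _ _ _)) (fun _ => rfl)
    (fun _ => (congrArg Bicategory.Adjunction.unit (mapAdj_id' _)).trans (Category.comp_id _).symm)
    (fun _ => (congrArg Bicategory.Adjunction.counit (mapAdj_id' _)).trans
      (Category.id_comp _).symm)

theorem post_id : post (B := B) (TwoFunctor.id D) = TwoFunctor.id (Vert B D) :=
  TwoFunctor.ext_heq rfl (fun η => heq_of_eq (postMap_id_eq η))
    (fun {F G η θ} m => hom₂_heq (postMap_id_eq η) (postMap_id_eq θ) fun x => HEq.rfl)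

variable {E : Type*} [Bicategory E] [Bicategory.Strict E]

theorem sq_sq (Q : TwoFunctor D D') (R : TwoFunctor D' E) {a b b' c : D} {p : a ⟶ b} {s : b ⟶ c}
    {r : a ⟶ b'} {q : b' ⟶ c} (n : p ≫ s ⟶ r ≫ q) : sq (Q.comp R) n = sq R (sq Q n) := by
  change eqToHom _ ≫ R.map₂ (Q.map₂ n) ≫ eqToHom _ = _
  simp [sq]
  rfl

theorem mapAdj_mapAdj (Q : TwoFunctor D D') (R : TwoFunctor D' E) {a b : D} {f : a ⟶ b}
    {f' : b ⟶ a} (adj : Bicategory.Adjunction f f') :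
    mapAdj (Q.comp R) adj = mapAdj R (mapAdj Q adj) := by
  refine Bicategory.Adjunction.ext ?_ ?_
  · change eqToHom _ ≫ R.map₂ (Q.map₂ adj.unit) ≫ eqToHom _ = _
    simp [mapAdj]
    rfl
  · change eqToHom _ ≫ R.map₂ (Q.map₂ adj.counit) ≫ eqToHom _ = _
    simp [mapAdj]
    rfl

theorem postMap_postMap (Q : TwoFunctor D D') (R : TwoFunctor D' E) {F G : Vert B D} (η : F ⟶ G) :
    postMap (Q.comp R) η = postMap R (postMap Q η) :=
  hom_ext (fun _ => rfl) (fun f => (sq_sq Q R _).trans (eq_conj _ _ _)) (fun _ => rfl)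
    (fun _ => (congrArg Bicategory.Adjunction.unit (mapAdj_mapAdj Q R _)).trans
      (Category.comp_id _).symm)
    (fun _ => (congrArg Bicategory.Adjunction.counit (mapAdj_mapAdj Q R _)).trans
      (Category.id_comp _).symm)

theorem post_comp (Q : TwoFunctor D D') (R : TwoFunctor D' E) :
    post (B := B) (Q.comp R) = (post Q).comp (post R) :=
  TwoFunctor.ext_heq rfl (fun η => heq_of_eq (postMap_postMap Q R η))
    (fun {F G η θ} m => hom₂_heq (postMap_postMap Q R η) (postMap_postMap Q R θ)
      fun x => HEq.rfl)

theorem pre_post (P : TwoFunctor B' B) (Q : TwoFunctor D D') :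
    (pre P).comp (post Q) = (post Q).comp (pre P) := rfl

variable {B'' : Type*} [Bicategory B''] [Bicategory.Strict B'']

theorem pre_comp (P : TwoFunctor B B') (P' : TwoFunctor B' B'') :
    pre (D := D) (P.comp P') = (pre P').comp (pre P) := rfl

end Post
end Coherence
end Vert
end Vert

/-! ### The nerves -/

/-- A (small, strict) 2-category. -/
structure TwoCat : Type (u + 1) where
  /-- The objects. -/
  carrier : Type u
  [bicategory : Bicategory.{u, u} carrier]
  [strict : Bicategory.Strict carrier]

attribute [instance] TwoCat.bicategory TwoCat.strict

/-- The category of 2-categories and 2-functors. -/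
instance : Category TwoCat.{u} where
  Hom C D := TwoFunctor C.carrier D.carrier
  id C := TwoFunctor.id C.carrier
  comp F G := F.comp G

/-- The bisimplicial set `N^{Δ×Δ}_{•,•,0} D`.

By definition `N^{Δ×Δ}_{i,j,0} D` is the set of 2-functors `L^≃ (V O~[j] ⊗ H O~[i]) → D`, where `⊗`
is the pseudo Gray tensor product of double categories, left adjoint to `[[-, -]]`, and `L^≃` is
left adjoint to `H^≃`. (The space direction is `0`, so that the third tensor factor is the
unit.) Both are only characterized by their adjunctions, through which these 2-functors are the
double functors `V O~[j] → [[H O~[i], H^≃ D]]`, i.e. the 2-functors `O~[j] → V[[H O~[i], H^≃ D]]`.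
The simplicial operators act through `O~[i]` and `O~[j]`. As all 2-morphisms of `O~[j]` are
invertible, it does not matter which of the two directions is chosen for the 2-morphisms of
the vertical 2-category. -/
def bisimplicialNerveZeroObj (D : TwoCat.{u}) : (SimplexCategory × SimplexCategory)ᵒᵖ ⥤ Type u where
  obj p := TwoFunctor (Osim p.unop.2.len) (Vert (Osim p.unop.1.len) D.carrier)
  map φ := ↾fun F => (Osim.map φ.unop.2.toOrderHom).comp
    (F.comp (Vert.pre (Osim.map φ.unop.1.toOrderHom)))
  map_id p := by
    ext F
    change (Osim.map OrderHom.id).comp (F.comp (Vert.pre (Osim.map OrderHom.id))) = F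
    rw [Osim.map_id, Osim.map_id]
    rfl
  map_comp {p q r} φ ψ := by
    ext F
    change (Osim.map (φ.unop.2.toOrderHom.comp ψ.unop.2.toOrderHom)).comp
      (F.comp (Vert.pre (Osim.map (φ.unop.1.toOrderHom.comp ψ.unop.1.toOrderHom)))) = _
    rw [Osim.map_comp, Osim.map_comp]
    rfl

/-- The bisimplicial nerve `D ↦ N^{Δ×Δ}_{•,•,0} D`, as a functor of the 2-category `D`. -/
def bisimplicialNerveZero : TwoCat.{u} ⥤ ((SimplexCategory × SimplexCategory)ᵒᵖ ⥤ Type u) where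
  obj D := bisimplicialNerveZeroObj D
  map G := { app := fun p => ↾fun F => F.comp (Vert.post G) }
  map_id D := by
    ext p F
    exact congrArg F.comp (Vert.post_id (B := Osim p.unop.1.len) (D := D.carrier))
  map_comp G H := by
    ext p F
    exact congrArg F.comp (Vert.post_comp G H)

section Leinster

set_option linter.unusedSectionVars false

theorem normal_ext {B : Type u₁} [Bicategory.{w₁, v₁} B] {C : Type u₂} [Bicategory.{w₂, v₂} C]
    {F G : StrictlyUnitaryPseudofunctor B C} (h : F.toPrelaxFunctor = G.toPrelaxFunctor)
    (h' : ∀ {a b c : B} (f : a ⟶ b) (g : b ⟶ c), HEq (F.mapComp f g).hom (G.mapComp f g).hom) :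
    F = G := by
  obtain ⟨⟨P, i, m, _, _, _, _, _⟩, hid, hi⟩ := F
  obtain ⟨⟨P', i', m', _, _, _, _, _⟩, hid', hi'⟩ := G
  obtain rfl : P = P' := h
  obtain rfl : i = i' := funext fun x => (hi x).trans (hi' x).symm
  obtain rfl : @m = @m' := by
    funext a b c f g
    exact Iso.ext (eq_of_heq (h' f g))
  rfl

variable {B : Type u₁} [Bicategory.{w₁, v₁} B] [Bicategory.Strict B]
  {C : Type u₂} [Bicategory.{w₂, v₂} C] [Bicategory.Strict C]
  {D : Type u₃} [Bicategory.{w₃, v₃} D] [Bicategory.Strict D]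

/-- Precomposition of a normal pseudofunctor with a 2-functor. -/
def normalPre (P : TwoFunctor B C) (F : StrictlyUnitaryPseudofunctor C D) :
    StrictlyUnitaryPseudofunctor B D :=
  P.toStrict.toStrictlyUnitaryPseudofunctor.comp F

/-- Postcomposition of a normal pseudofunctor with a 2-functor. -/
def normalPost (G : TwoFunctor C D) (F : StrictlyUnitaryPseudofunctor B C) :
    StrictlyUnitaryPseudofunctor B D :=
  F.comp G.toStrict.toStrictlyUnitaryPseudofunctor

theorem normalPre_mapComp (P : TwoFunctor B C) (F : StrictlyUnitaryPseudofunctor C D) {a b c : B}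
    (f : a ⟶ b) (g : b ⟶ c) : ((normalPre P F).mapComp f g).hom =
      F.map₂ (eqToHom (P.map_comp f g)) ≫ (F.mapComp (P.map f) (P.map g)).hom := rfl

theorem normalPost_mapComp (G : TwoFunctor C D) (F : StrictlyUnitaryPseudofunctor B C) {a b c : B}
    (f : a ⟶ b) (g : b ⟶ c) : ((normalPost G F).mapComp f g).hom =
      G.map₂ (F.mapComp f g).hom ≫ eqToHom (G.map_comp (F.map f) (F.map g)) := rfl

theorem normalPre_id (F : StrictlyUnitaryPseudofunctor B D) :
    normalPre (TwoFunctor.id B) F = F :=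
  normal_ext rfl fun f g => heq_of_eq
    ((congrArg (· ≫ (F.mapComp f g).hom) (F.map₂_id (f ≫ g))).trans (Category.id_comp _))

theorem normalPost_id (F : StrictlyUnitaryPseudofunctor B D) :
    normalPost (TwoFunctor.id D) F = F :=
  normal_ext rfl fun _ _ => heq_of_eq (Category.comp_id _)

theorem map₂_aux₁ (G : PrelaxFunctor C D) {a b : C} {f g h : a ⟶ b} (m : f ⟶ g) (n : g ⟶ h)
    {k : G.obj a ⟶ G.obj b} (t : G.map h ⟶ k) :
    G.map₂ (m ≫ n) ≫ t = G.map₂ m ≫ G.map₂ n ≫ t := by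
  rw [PrelaxFunctor.map₂_comp, Category.assoc]

theorem map₂_aux₂ {E : Type*} [Bicategory E] (P : PrelaxFunctor B C) (F : PrelaxFunctor C E)
    {a b : B} {x y : a ⟶ b} (h : x = y) {z : P.obj a ⟶ P.obj b} (h' : P.map y = z)
    (h'' : P.map x = z) {k : F.obj (P.obj a) ⟶ F.obj (P.obj b)} (t : F.map z ⟶ k) :
    F.map₂ (eqToHom h'') ≫ t = F.map₂ (P.map₂ (eqToHom h)) ≫ F.map₂ (eqToHom h') ≫ t := by
  subst h h'
  simp

theorem map₂_aux₃ (H : PrelaxFunctor C D) {a b : C} {x y z : a ⟶ b} (m : x ⟶ y) (h : y = z)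
    {w : H.obj a ⟶ H.obj b} (h' : H.map z = w) (h'' : H.map y = w) :
    H.map₂ m ≫ eqToHom h'' = H.map₂ (m ≫ eqToHom h) ≫ eqToHom h' := by
  subst h h'
  simp

theorem normalPost_normalPre {E : Type*} [Bicategory E] [Bicategory.Strict E]
    (P : TwoFunctor B C) (G : TwoFunctor D E) (F : StrictlyUnitaryPseudofunctor C D) :
    normalPost G (normalPre P F) = normalPre P (normalPost G F) :=
  normal_ext rfl fun f g => heq_of_eq (map₂_aux₁ G.toPrelaxFunctor
    (F.map₂ (eqToHom (P.map_comp f g))) (F.mapComp (P.map f) (P.map g)).hom _)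

theorem normalPre_comp {E : Type*} [Bicategory E] [Bicategory.Strict E]
    (P : TwoFunctor B C) (Q : TwoFunctor C D) (F : StrictlyUnitaryPseudofunctor D E) :
    normalPre (P.comp Q) F = normalPre P (normalPre Q F) :=
  normal_ext rfl fun f g => heq_of_eq (map₂_aux₂ Q.toPrelaxFunctor F.toPrelaxFunctor
    (P.map_comp f g) (Q.map_comp _ _) ((P.comp Q).map_comp f g) (F.mapComp _ _).hom)

theorem normalPost_comp {E : Type*} [Bicategory E] [Bicategory.Strict E]
    (G : TwoFunctor C D) (H : TwoFunctor D E) (F : StrictlyUnitaryPseudofunctor B C) :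
    normalPost (G.comp H) F = normalPost H (normalPost G F) :=
  normal_ext rfl fun f g => heq_of_eq (map₂_aux₃ H.toPrelaxFunctor (G.map₂ (F.mapComp f g).hom)
    (G.map_comp _ _) (H.map_comp _ _) ((G.comp H).map_comp _ _))

end Leinster

/-- Leinster's nerve `N^{Θ₂} D` of a 2-category `D`: its elements at `θ` are the normal pseudofunctors
from `θ` to `D`, that is, the pseudofunctors that preserve identity 1-morphisms strictly. -/
def leinsterNerveObj (D : TwoCat.{u}) : Theta2ᵒᵖ ⥤ Type u where
  obj θ := StrictlyUnitaryPseudofunctor θ.unop.Cell D.carrier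
  map P := ↾fun F => normalPre P.unop F
  map_id p := by
    ext F
    exact normalPre_id F
  map_comp {p q r} φ ψ := by
    ext F
    exact normalPre_comp ψ.unop φ.unop F

/-- Leinster's nerve `D ↦ N^{Θ₂} D`, as a functor of the 2-category `D`. -/
def leinsterNerve : TwoCat.{u} ⥤ (Theta2ᵒᵖ ⥤ Type u) where
  obj D := leinsterNerveObj D
  map G :=
    { app := fun θ => ↾fun F => normalPost G F
      naturality := fun θ θ' P => by
        ext F
        exact normalPost_normalPre P.unop G F }
  map_id D := by
    ext θ F
    exact normalPost_id F
  map_comp G H := by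
    ext θ F
    exact normalPost_comp G H F

end TwoNerve

namespace TwoNerve

universe w₁ v₁ u₁ w₂ v₂ u₂ w₃ v₃ u₃

/-! ### Total types of 1-morphisms and 2-morphisms -/

section Total

attribute [-instance] CategoryTheory.StrictBicategory.category

/-! An element of the right Kan extension at `θ` is a family of elements of the bisimplicial nerve,
indexed by the 2-functors `[i | j, …, j] ⟶ θ` and compatible with the simplicial operators
(`NerveFamily`). The point is that such a family is the same thing as a normal pseudofunctor on `θ`.

From pseudofunctors to families: for each level `k`, the 1-morphisms of `[i | j, …, j]` all of whose
levels are `k` form a copy of the category `[i]`. So a normal pseudofunctor `F` on `[i | j, …, j]`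
restricts to one from `[i]` to the 2-category `Diag` of `[j]`-shaped chains of 2-morphisms of `D`.
Every 1-morphism of `O~[n]` is a composite of edges in exactly one nondegenerate way and parallel
1-morphisms are uniquely isomorphic, so a normal pseudofunctor on `[n]` extends to a 2-functor on
`O~[n]` (`SimplexData.lift`). A 2-functor from `O~[i]` to `Diag` is a chain of 2-functors joined by
icons, hence an element of the bisimplicial nerve with identity components (`Diag.toVert`). The
composite construction `toBisimplex` is natural, and gives `comparison`. In general this is not
invertible: it forgets `F` on nonconstant 1-morphisms, and it misses the elements with nontrivial
adjoint equivalences as components. It becomes invertible only after passing to the right Kan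
extension.

The crux is `NerveFamily.isIconic`: the members of a compatible family have identity components. A
component lives over a vertex, and `[0 | ]` does not involve `j`; so the restriction of a member to
a vertex is degenerate in the vertical direction.

What remains of a family is exactly a normal pseudofunctor. Its objects, 1-morphisms, 2-morphisms
and compositors are read off at `[0 | ]`, `[1 | 0]`, `[1 | 1]` and `[2 | 0, 0]`; vertical
functoriality, naturality of the compositor and associativity come from `[1 | 2]`, `[2 | 1, 1]` and
`[3 | 0, 0, 0]`; the unit laws come from degenerate simplices. These values determine the whole
family: a 2-functor `[i | j, …, j] ⟶ θ` is fixed by its vertices and its longest constant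
1-morphisms (`Theta2.ext_const`), which identifies its small faces, and an element with identity
components is fixed by edges, triangles and squares (`IsIconic.ext`).

Equalities of 2-morphisms whose boundaries agree only propositionally are stated in the total type
`Cell`. -/

/-- The type of all 1-morphisms of a bicategory. -/
structure Mor (D : Type u₁) [Bicategory.{w₁, v₁} D] where
  src : D
  tgt : D
  hom : src ⟶ tgt

/-- The type of all 2-morphisms of a bicategory. -/
structure Cell (D : Type u₁) [Bicategory.{w₁, v₁} D] where
  src : D
  tgt : D
  dom : src ⟶ tgt
  cod : src ⟶ tgt
  hom : dom ⟶ cod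

variable {D : Type u₁} [Bicategory.{w₁, v₁} D]

/-- A 1-morphism as an element of the type of all 1-morphisms. -/
abbrev mor {a b : D} (f : a ⟶ b) : Mor D := ⟨a, b, f⟩

/-- A 2-morphism as an element of the type of all 2-morphisms. -/
abbrev cell {a b : D} {f g : a ⟶ b} (α : f ⟶ g) : Cell D := ⟨a, b, f, g, α⟩

variable {a b c a' b' c' : D}

/-! ### Congruence of the bicategory operations in the total types. -/

theorem mor_inj {f g : a ⟶ b} (h : mor f = mor g) : f = g := by
  cases h; rfl

theorem cell_inj {f g : a ⟶ b} {α β : f ⟶ g} (h : cell α = cell β) : α = β := by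
  cases h; rfl

theorem cell_heq {f g : a ⟶ b} {f' g' : a' ⟶ b'} {α : f ⟶ g} {α' : f' ⟶ g'}
    (h : cell α = cell α') : HEq α α' := by
  cases h; rfl

theorem mor_heq {f : a ⟶ b} {f' : a' ⟶ b'} (h : mor f = mor f') : HEq f f' := by
  cases h; rfl

theorem mor_congr {f g : a ⟶ b} (h : f = g) : mor f = mor g := by
  rw [h]

theorem cell_congr {f g : a ⟶ b} {α β : f ⟶ g} (h : α = β) : cell α = cell β := by
  rw [h]

theorem cell_dom {f g : a ⟶ b} {f' g' : a' ⟶ b'} {α : f ⟶ g} {α' : f' ⟶ g'}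
    (h : cell α = cell α') : mor f = mor f' :=
  congrArg (fun x : Cell D => mor x.dom) h

theorem cell_cod {f g : a ⟶ b} {f' g' : a' ⟶ b'} {α : f ⟶ g} {α' : f' ⟶ g'}
    (h : cell α = cell α') : mor g = mor g' :=
  congrArg (fun x : Cell D => mor x.cod) h

theorem mor_comp {f : a ⟶ b} {g : b ⟶ c} {f' : a' ⟶ b'} {g' : b' ⟶ c'} (h : mor f = mor f')
    (h' : mor g = mor g') : mor (f ≫ g) = mor (f' ≫ g') := by
  cases h; cases h'; rfl

theorem mor_one (h : a = a') : mor (𝟙 a) = mor (𝟙 a') := by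
  rw [h]

theorem cell_one {f : a ⟶ b} {f' : a' ⟶ b'} (h : mor f = mor f') :
    cell (𝟙 f) = cell (𝟙 f') := by
  cases h; rfl

theorem cell_comp {f g h : a ⟶ b} {f' g' h' : a' ⟶ b'} {α : f ⟶ g} {β : g ⟶ h}
    {α' : f' ⟶ g'} {β' : g' ⟶ h'} (hα : cell α = cell α') (hβ : cell β = cell β') :
    cell (α ≫ β) = cell (α' ≫ β') := by
  cases hα; cases hβ; rfl

theorem cell_whiskerLeft {f : a ⟶ b} {g h : b ⟶ c} {f' : a' ⟶ b'} {g' h' : b' ⟶ c'}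
    {α : g ⟶ h} {α' : g' ⟶ h'} (hf : mor f = mor f') (hα : cell α = cell α') :
    cell (f ◁ α) = cell (f' ◁ α') := by
  cases hf; cases hα; rfl

theorem cell_whiskerRight {f g : a ⟶ b} {h : b ⟶ c} {f' g' : a' ⟶ b'} {h' : b' ⟶ c'}
    {α : f ⟶ g} {α' : f' ⟶ g'} (hα : cell α = cell α') (hf : mor h = mor h') :
    cell (α ▷ h) = cell (α' ▷ h') := by
  cases hf; cases hα; rfl

theorem cell_inv {f g : a ⟶ b} {f' g' : a' ⟶ b'} {α : f ≅ g} {α' : f' ≅ g'}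
    (h : cell α.hom = cell α'.hom) : cell α.inv = cell α'.inv := by
  have h1 := cell_dom h
  have h2 := cell_cod h
  cases h1; cases h2
  obtain rfl : α = α' := Iso.ext (cell_inj h)
  rfl

-- The reason for using the total types: transports along equalities of 1-morphisms become
-- invisible, so pastings that differ only by strictness identifications can be compared factor by
-- factor.
@[simp]
theorem cell_eqToHom {f g : a ⟶ b} (h : f = g) : cell (eqToHom h) = cell (𝟙 f) := by
  subst h; rfl

@[simp]
theorem cell_eqToHom_comp {f g h : a ⟶ b} (e : f = g) (α : g ⟶ h) :
    cell (eqToHom e ≫ α) = cell α := by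
  subst e; simp

@[simp]
theorem cell_comp_eqToHom {f g h : a ⟶ b} (α : f ⟶ g) (e : g = h) :
    cell (α ≫ eqToHom e) = cell α := by
  subst e; simp

theorem cell_conj {f f' g g' : a ⟶ b} (e : f = f') (α : f' ⟶ g') (e' : g' = g) :
    cell (eqToHom e ≫ α ≫ eqToHom e') = cell α := by
  simp

/-- Equality up to conjugation with `eqToHom`, from equality in the type of all 2-morphisms. -/
theorem eq_conj_of_cell {f f' g g' : a ⟶ b} {α : f ⟶ g} {α' : f' ⟶ g'} (h : cell α = cell α')
    (e : f = f') (e' : g' = g) : α = eqToHom e ≫ α' ≫ eqToHom e' :=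
  cell_inj (h.trans (cell_conj e α' e').symm)

/-! ### Unit and associativity laws of a strict 2-category in the total types. -/

section Strict

variable [Bicategory.Strict D]

@[simp]
theorem mor_id_comp (f : a ⟶ b) : mor (𝟙 a ≫ f) = mor f := by
  rw [Bicategory.Strict.id_comp]

@[simp]
theorem mor_comp_id (f : a ⟶ b) : mor (f ≫ 𝟙 b) = mor f := by
  rw [Bicategory.Strict.comp_id]

theorem cell_id_whiskerLeft {f g : a ⟶ b} (α : f ⟶ g) : cell (𝟙 a ◁ α) = cell α := by
  rw [Bicategory.id_whiskerLeft]
  simp [Bicategory.Strict.leftUnitor_eqToIso]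

theorem cell_whiskerRight_id {f g : a ⟶ b} (α : f ⟶ g) : cell (α ▷ 𝟙 b) = cell α := by
  rw [Bicategory.whiskerRight_id]
  simp [Bicategory.Strict.rightUnitor_eqToIso]

variable {d : D}

theorem cell_comp_whiskerLeft (f : a ⟶ b) (g : b ⟶ c) {h k : c ⟶ d} (α : h ⟶ k) :
    cell ((f ≫ g) ◁ α) = cell (f ◁ g ◁ α) := by
  rw [Bicategory.comp_whiskerLeft]
  simp [Bicategory.Strict.associator_eqToIso]

theorem cell_whiskerRight_comp {f g : a ⟶ b} (α : f ⟶ g) (h : b ⟶ c) (k : c ⟶ d) :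
    cell (α ▷ (h ≫ k)) = cell (α ▷ h ▷ k) := by
  rw [Bicategory.whiskerRight_comp]
  simp [Bicategory.Strict.associator_eqToIso]

theorem cell_whisker_assoc (f : a ⟶ b) {g h : b ⟶ c} (α : g ⟶ h) (k : c ⟶ d) :
    cell ((f ◁ α) ▷ k) = cell (f ◁ α ▷ k) := by
  rw [Bicategory.whisker_assoc]
  simp [Bicategory.Strict.associator_eqToIso]

theorem cell_rightUnitor_inv (f : a ⟶ b) : cell (ρ_ f).inv = cell (𝟙 f) := by
  rw [Bicategory.Strict.rightUnitor_eqToIso]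
  simp

theorem cell_rightUnitor_hom (f : a ⟶ b) : cell (ρ_ f).hom = cell (𝟙 f) := by
  rw [Bicategory.Strict.rightUnitor_eqToIso]
  simpa using cell_one (mor_comp_id f)

end Strict

/-! Transport of 1-morphisms and 2-morphisms. -/

/-- Transport of a 1-morphism along equalities of its endpoints. -/
def castHom (ha : a = a') (hb : b = b') (f : a ⟶ b) : a' ⟶ b' :=
  cast (by rw [ha, hb]) f

@[simp]
theorem mor_castHom (ha : a = a') (hb : b = b') (f : a ⟶ b) : mor (castHom ha hb f) = mor f := by
  subst ha hb; rfl

/-- Transport of a 2-morphism along equalities of its boundary. -/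
def castCell {f g : a ⟶ b} {f' g' : a' ⟶ b'} (hf : mor f = mor f') (hg : mor g = mor g')
    (α : f ⟶ g) : f' ⟶ g' :=
  cast (by cases hf; cases hg; rfl) α

@[simp]
theorem cell_castCell {f g : a ⟶ b} {f' g' : a' ⟶ b'} (hf : mor f = mor f') (hg : mor g = mor g')
    (α : f ⟶ g) : cell (castCell hf hg α) = cell α := by
  cases hf; cases hg; rfl

/-- Transport of an invertible 2-morphism along equalities of its boundary. -/
def castIso {f g : a ⟶ b} {f' g' : a' ⟶ b'} (hf : mor f = mor f') (hg : mor g = mor g')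
    (α : f ≅ g) : f' ≅ g' where
  hom := castCell hf hg α.hom
  inv := castCell hg hf α.inv
  hom_inv_id := by cases hf; cases hg; exact α.hom_inv_id
  inv_hom_id := by cases hf; cases hg; exact α.inv_hom_id

@[simp]
theorem cell_castIso_hom {f g : a ⟶ b} {f' g' : a' ⟶ b'} (hf : mor f = mor f')
    (hg : mor g = mor g') (α : f ≅ g) : cell (castIso hf hg α).hom = cell α.hom :=
  cell_castCell hf hg α.hom

/-! Functoriality. -/

variable {E : Type u₂} [Bicategory.{w₂, v₂} E]

theorem mor_map (Q : PrelaxFunctor D E) {f : a ⟶ b} {f' : a' ⟶ b'} (h : mor f = mor f') :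
    mor (Q.map f) = mor (Q.map f') := by
  cases h; rfl

theorem cell_map₂ (Q : PrelaxFunctor D E) {f g : a ⟶ b} {f' g' : a' ⟶ b'} {α : f ⟶ g}
    {α' : f' ⟶ g'} (h : cell α = cell α') : cell (Q.map₂ α) = cell (Q.map₂ α') := by
  cases h; rfl

theorem prelax_ext {F G : PrelaxFunctor D E} (h0 : ∀ x, F.obj x = G.obj x)
    (h1 : ∀ {a b : D} (f : a ⟶ b), mor (F.map f) = mor (G.map f))
    (h2 : ∀ {a b : D} {f g : a ⟶ b} (α : f ⟶ g), cell (F.map₂ α) = cell (G.map₂ α)) : F = G := by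
  obtain ⟨⟨⟨o, m⟩, m2⟩, _, _⟩ := F
  obtain ⟨⟨⟨o', m'⟩, m2'⟩, _, _⟩ := G
  obtain rfl : o = o' := funext h0
  obtain rfl : @m = @m' := by
    funext a b f; exact mor_inj (h1 f)
  obtain rfl : @m2 = @m2' := by
    funext a b f g α; exact cell_inj (h2 α)
  rfl

theorem twoFunctor_ext {F G : TwoFunctor D E} (h0 : ∀ x, F.obj x = G.obj x)
    (h1 : ∀ {a b : D} (f : a ⟶ b), mor (F.map f) = mor (G.map f))
    (h2 : ∀ {a b : D} {f g : a ⟶ b} (α : f ⟶ g), cell (F.map₂ α) = cell (G.map₂ α)) : F = G :=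
  TwoFunctor.ext_heq (funext h0) (fun f => mor_heq (h1 f)) (fun α => cell_heq (h2 α))

theorem normal_ext_cell {F G : StrictlyUnitaryPseudofunctor D E} (h0 : ∀ x, F.obj x = G.obj x)
    (h1 : ∀ {a b : D} (f : a ⟶ b), mor (F.map f) = mor (G.map f))
    (h2 : ∀ {a b : D} {f g : a ⟶ b} (α : f ⟶ g), cell (F.map₂ α) = cell (G.map₂ α))
    (h3 : ∀ {a b c : D} (f : a ⟶ b) (g : b ⟶ c),
      cell (F.mapComp f g).hom = cell (G.mapComp f g).hom) : F = G :=
  normal_ext (prelax_ext h0 h1 h2) fun f g => cell_heq (h3 f g)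

theorem cell_map₂_whiskerLeft (F : TwoFunctor D E) (f : a ⟶ b) {g g' : b ⟶ c} (α : g ⟶ g') :
    cell (F.map₂ (f ◁ α)) = cell (F.map f ◁ F.map₂ α) := by
  rw [F.map₂_whisker_left, cell_conj]

theorem cell_map₂_whiskerRight (F : TwoFunctor D E) {f f' : a ⟶ b} (α : f ⟶ f') (g : b ⟶ c) :
    cell (F.map₂ (α ▷ g)) = cell (F.map₂ α ▷ F.map g) := by
  rw [F.map₂_whisker_right, cell_conj]

theorem mor_map_comp (F : TwoFunctor D E) (f : a ⟶ b) (g : b ⟶ c) :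
    mor (F.map (f ≫ g)) = mor (F.map f ≫ F.map g) :=
  mor_congr (F.map_comp f g)

end Total

/-! ### 2-functors out of `O~[n]` -/

namespace Osim

section

set_option linter.unusedSectionVars false

attribute [-instance] CategoryTheory.StrictBicategory.category

variable {n : ℕ}

/-- The 1-morphism `{p, q}` of `O~[n]`. -/
def edge {p q : Osim n} (h : p.pt ≤ q.pt) : p ⟶ q :=
  (⟨{p.pt, q.pt}, by simp, by simp, by simp [h]⟩ : Hom p q)

theorem edge_refl (p : Osim n) : edge (le_refl p.pt) = 𝟙 p :=
  hom_ext (by simp [edge]; rfl)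

theorem hom_le {p q : Osim n} (f : p ⟶ q) : p.pt ≤ q.pt :=
  (f.bounds _ f.source_mem).2

/-- The 2-morphism between two parallel 1-morphisms. -/
def two {p q : Osim n} (f g : p ⟶ q) : f ⟶ g := ()

theorem two_eq_eqToHom {p q : Osim n} {f g : p ⟶ q} (h : f = g) : two f g = eqToHom h :=
  Subsingleton.elim _ _

/-- The 2-morphism from `{p, r}` to `{p, q, r}`. -/
abbrev tri {p q r : Osim n} (h : p.pt ≤ q.pt) (h' : q.pt ≤ r.pt) :
    edge (h.trans h') ⟶ edge h ≫ edge h' := two _ _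

/-- The invertible 2-morphism between two parallel 1-morphisms. -/
def twoIso {p q : Osim n} (f g : p ⟶ q) : f ≅ g where
  hom := two f g
  inv := two g f

theorem map_edge {m : ℕ} (α : Fin (m + 1) →o Fin (n + 1)) {p q : Osim m} (h : p.pt ≤ q.pt) :
    (map α).map (edge h) = edge (p := (map α).obj p) (q := (map α).obj q) (α.monotone h) :=
  hom_ext (by simp [edge, map, Finset.image_insert])

/-! ### 1-morphisms of `O~[n]` as chains of vertices. -/

/-- A strictly increasing sequence of vertices from `p` to `q`. -/
inductive Chain : Osim n → Osim n → Type
  | nil (p : Osim n) : Chain p p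
  | cons {p q r : Osim n} (h : p.pt < q.pt) (c : Chain q r) : Chain p r

namespace Chain

/-- The 1-morphism of `O~[n]` given by a chain. -/
def toHom : {p q : Osim n} → Chain p q → (p ⟶ q)
  | _, _, nil p => 𝟙 p
  | _, _, cons h c => edge h.le ≫ toHom c

/-- Concatenation. -/
def append : {p q r : Osim n} → Chain p q → Chain q r → Chain p r
  | _, _, _, nil _, c' => c'
  | _, _, _, cons h c, c' => cons h (append c c')

theorem toHom_append {p q r : Osim n} (c : Chain p q) (c' : Chain q r) :
    toHom (append c c') = toHom c ≫ toHom c' := by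
  induction c with
  | nil p => exact (Bicategory.Strict.id_comp _).symm
  | cons h c ih =>
    change edge h.le ≫ toHom (append c c') = (edge h.le ≫ toHom c) ≫ toHom c'
    rw [ih, Bicategory.Strict.assoc]

theorem verts_cons {p q r : Osim n} (h : p.pt < q.pt) (c : Chain q r) :
    (toHom (cons h c)).verts = insert p.pt (toHom c).verts := by
  change {p.pt, q.pt} ∪ (toHom c).verts = _
  have := (toHom c).source_mem
  ext z
  simp only [Finset.mem_union, Finset.mem_insert, Finset.mem_singleton]
  constructor
  · rintro ((h | rfl) | h)
    · exact Or.inl h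
    · exact Or.inr this
    · exact Or.inr h
  · tauto

theorem notMem_verts {p q r : Osim n} (h : p.pt < q.pt) (f : q ⟶ r) : p.pt ∉ f.verts :=
  fun hp => absurd (f.bounds _ hp).1 (not_le.mpr h)

/-- A chain can be read off from its vertex set: removing the source leaves the vertices of the
tail, and the least of these is the next vertex. -/
theorem toHom_injective {p q : Osim n} (c c' : Chain p q) (h : toHom c = toHom c') : c = c' := by
  induction c with
  | nil p =>
    cases c' with
    | nil => rfl
    | cons hpq c => exact absurd (hom_le (toHom c)) (not_le.mpr hpq)
  | @cons p q r hpq c ih =>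
    cases c' with
    | nil => exact absurd (hom_le (toHom c)) (not_le.mpr hpq)
    | @cons _ q' _ hpq' c' =>
      have hv := congrArg Hom.verts h
      rw [verts_cons, verts_cons] at hv
      have hv' : (toHom c).verts = (toHom c').verts := by
        rw [← Finset.erase_insert (notMem_verts hpq (toHom c)),
          ← Finset.erase_insert (notMem_verts hpq' (toHom c')), hv]
      -- Both second vertices are the minimum of the same set.
      have hq : q.pt = q'.pt := le_antisymm
        ((toHom c).bounds _ (hv' ▸ (toHom c').source_mem)).1
        ((toHom c').bounds _ (hv' ▸ (toHom c).source_mem)).1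
      obtain ⟨q⟩ := q
      obtain ⟨q'⟩ := q'
      obtain rfl : q = q' := hq
      rw [ih c' (hom_ext hv')]

/-- Induction on the number of vertices, splitting off the least one. -/
theorem exists_toHom {p q : Osim n} (f : p ⟶ q) : ∃ c : Chain p q, toHom c = f := by
  induction hm : f.verts.card generalizing p with
  | zero =>
    exact absurd f.source_mem (by rw [Finset.card_eq_zero.mp hm]; simp)
  | succ m ih =>
    rcases (hom_le f).eq_or_lt with h | h
    · obtain ⟨p⟩ := p
      obtain ⟨q⟩ := q
      obtain rfl : p = q := h
      refine ⟨nil _, hom_ext ?_⟩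
      refine (Finset.eq_singleton_iff_unique_mem.mpr ⟨f.source_mem, fun z hz => ?_⟩).symm
      exact le_antisymm (f.bounds z hz).2 (f.bounds z hz).1
    · have hq : q.pt ∈ f.verts.erase p.pt := Finset.mem_erase.mpr ⟨h.ne', f.target_mem⟩
      -- The second smallest vertex: `f` is the edge from `p` to `r` followed by the remaining
      -- vertices.
      let r : Osim n := ⟨(f.verts.erase p.pt).min' ⟨_, hq⟩⟩
      have hr : r.pt ∈ f.verts.erase p.pt := Finset.min'_mem _ ⟨_, hq⟩
      have hpr : p.pt < r.pt := lt_of_le_of_ne (f.bounds _ (Finset.mem_of_mem_erase hr)).1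
        (Finset.ne_of_mem_erase hr).symm
      let f' : r ⟶ q := (⟨f.verts.erase p.pt, hr, hq, fun z hz =>
        ⟨Finset.min'_le _ _ hz, (f.bounds z (Finset.mem_of_mem_erase hz)).2⟩⟩ : Hom r q)
      obtain ⟨c, hc⟩ := ih f' (by
        change (f.verts.erase p.pt).card = m
        rw [Finset.card_erase_of_mem f.source_mem, hm, Nat.add_sub_cancel])
      refine ⟨cons hpr c, hom_ext ?_⟩
      rw [verts_cons, hc]
      exact Finset.insert_erase f.source_mem

end Chain

/-- The chain of vertices of a 1-morphism of `O~[n]`. -/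
noncomputable def toChain {p q : Osim n} (f : p ⟶ q) : Chain p q :=
  (Chain.exists_toHom f).choose

theorem toHom_toChain {p q : Osim n} (f : p ⟶ q) : (toChain f).toHom = f :=
  (Chain.exists_toHom f).choose_spec

theorem toChain_eq {p q : Osim n} {f : p ⟶ q} (c : Chain p q) (h : c.toHom = f) :
    toChain f = c :=
  Chain.toHom_injective _ _ ((toHom_toChain f).trans h.symm)

theorem toChain_id (p : Osim n) : toChain (𝟙 p) = Chain.nil p := toChain_eq _ rfl

theorem toChain_comp {p q r : Osim n} (f : p ⟶ q) (g : q ⟶ r) :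
    toChain (f ≫ g) = (toChain f).append (toChain g) :=
  toChain_eq _ (by rw [Chain.toHom_append, toHom_toChain, toHom_toChain])

theorem toChain_edge {p q : Osim n} (h : p.pt < q.pt) :
    toChain (edge h.le) = Chain.cons h (Chain.nil q) :=
  toChain_eq _ (Bicategory.Strict.comp_id _)

/-- Induction over the 1-morphisms of `O~[n]`. -/
theorem hom_induction {P : ∀ {p q : Osim n}, (p ⟶ q) → Prop} (h1 : ∀ p, P (𝟙 p))
    (h2 : ∀ {p q r : Osim n} (h : p.pt ≤ q.pt) (f : q ⟶ r), P f → P (edge h ≫ f))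
    {p q : Osim n} (f : p ⟶ q) : P f := by
  have key : ∀ {p q : Osim n} (c : Chain p q), P c.toHom := fun c => by
    induction c with
    | nil p => exact h1 p
    | cons h c ih => exact h2 h.le _ ih
  rw [← toHom_toChain f]
  exact key _

/-! ### 2-functors on `O~[n]` from normal pseudofunctors on `[n]`. -/

variable {E : Type u₂} [Bicategory.{w₂, v₂} E]

/-- 2-functors out of `O~[n]` are determined by their values on vertices, on the 1-morphisms
`{p, q}`, and on the 2-morphisms `{p, r} ⟶ {p, q, r}`. -/
theorem twoFunctor_ext_edge {F G : TwoFunctor (Osim n) E} (h0 : ∀ p, F.obj p = G.obj p)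
    (h1 : ∀ {p q : Osim n} (h : p.pt ≤ q.pt), mor (F.map (edge h)) = mor (G.map (edge h)))
    (h2 : ∀ {p q r : Osim n} (h : p.pt ≤ q.pt) (h' : q.pt ≤ r.pt),
      cell (F.map₂ (tri h h')) = cell (G.map₂ (tri h h'))) : F = G := by
  have hm : ∀ {p q : Osim n} (f : p ⟶ q), mor (F.map f) = mor (G.map f) := fun f => by
    induction f using hom_induction with
    | h1 p => rw [F.map_id, G.map_id, h0]
    | h2 h f ih => rw [F.map_comp, G.map_comp]; exact mor_comp (h1 h) ih
  have hc : ∀ {p q : Osim n} (f : p ⟶ q),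
      cell (F.map₂ (two (edge (hom_le f)) f)) = cell (G.map₂ (two (edge (hom_le f)) f)) :=
    fun f => by
    induction f using hom_induction with
    | h1 p =>
      rw [two_eq_eqToHom (edge_refl p), PrelaxFunctor.map₂_eqToHom, PrelaxFunctor.map₂_eqToHom,
        cell_eqToHom, cell_eqToHom]
      exact cell_one (hm _)
    | @h2 p q r h f ih =>
      -- The 2-morphism from the long edge to a composite is a triangle followed by a whiskered
      -- shorter case, so triangles generate.
      have : two (edge (hom_le (edge h ≫ f))) (edge h ≫ f) =
        tri h (hom_le f) ≫ edge h ◁ two (edge (hom_le f)) f := Subsingleton.elim _ _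
      rw [this, F.map₂_comp, G.map₂_comp]
      refine cell_comp (h2 _ _) ?_
      rw [cell_map₂_whiskerLeft, cell_map₂_whiskerLeft]
      exact cell_whiskerLeft (hm _) ih
  refine twoFunctor_ext h0 hm fun {p q f g} α => ?_
  -- Every 2-morphism passes through the long edge. Its first half is the inverse of a 2-morphism
  -- covered by `hc`, and inverses agree when the isomorphisms do.
  have : α = two f (edge (hom_le f)) ≫ two (edge (hom_le f)) g := Subsingleton.elim _ _
  rw [this, F.map₂_comp, G.map₂_comp]
  exact cell_comp (cell_inv (α := F.map₂Iso (twoIso (edge (hom_le f)) f))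
    (α' := G.map₂Iso (twoIso (edge (hom_le f)) f)) (hc f)) (hc g)

/-- A normal pseudofunctor from the category `[n]` to a strict 2-category. -/
structure SimplexData (n : ℕ) (E : Type u₂) [Bicategory.{w₂, v₂} E] where
  obj : Osim n → E
  map : ∀ {p q : Osim n}, p.pt ≤ q.pt → (obj p ⟶ obj q)
  map_refl : ∀ p, map (le_refl p.pt) = 𝟙 (obj p)
  comp : ∀ {p q r : Osim n} (h : p.pt ≤ q.pt) (h' : q.pt ≤ r.pt),
    map (h.trans h') ≅ map h ≫ map h'
  comp_refl_left : ∀ {p q : Osim n} (h : p.pt ≤ q.pt),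
    cell (comp (le_refl p.pt) h).hom = cell (𝟙 (map h))
  comp_refl_right : ∀ {p q : Osim n} (h : p.pt ≤ q.pt),
    cell (comp h (le_refl q.pt)).hom = cell (𝟙 (map h))
  comp_assoc : ∀ {p q r s : Osim n} (h : p.pt ≤ q.pt) (h' : q.pt ≤ r.pt) (h'' : r.pt ≤ s.pt),
    cell ((comp (h.trans h') h'').hom ≫ (comp h h').hom ▷ map h'') =
      cell ((comp h (h'.trans h'')).hom ≫ map h ◁ (comp h' h'').hom)

namespace SimplexData

variable (X : SimplexData n E)

/-- The composite of the 1-morphisms in a chain. -/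
def eval : {p q : Osim n} → Chain p q → (X.obj p ⟶ X.obj q)
  | _, _, .nil p => 𝟙 (X.obj p)
  | _, _, .cons h c => X.map h.le ≫ eval c

theorem chain_le {p q : Osim n} (c : Chain p q) : p.pt ≤ q.pt := hom_le c.toHom

/-- The coherence isomorphism from the long edge of a chain to its composite. -/
def coh : {p q : Osim n} → (c : Chain p q) → (X.map (chain_le c) ≅ X.eval c)
  | _, _, .nil p => eqToIso (X.map_refl p)
  | _, _, .cons h c => X.comp h.le (chain_le c) ≪≫ whiskerLeftIso (X.map h.le) (coh c)

variable [Bicategory.Strict E]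

theorem eval_append {p q r : Osim n} (c : Chain p q) (c' : Chain q r) :
    X.eval (c.append c') = X.eval c ≫ X.eval c' := by
  induction c with
  | nil p => exact (Bicategory.Strict.id_comp _).symm
  | cons h c ih =>
    change X.map h.le ≫ X.eval (c.append c') = (X.map h.le ≫ X.eval c) ≫ X.eval c'
    rw [ih, Bicategory.Strict.assoc]

/-- Generalized associativity of the compositor: splitting the long edge in two and refining both
halves agrees with refining it link by link from the left. The induction peels off the first link of
`c` by `comp_assoc`; the empty chain is `comp_refl_left`. -/
theorem coh_append {p q r : Osim n} (c : Chain p q) (c' : Chain q r) :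
    cell (X.coh (c.append c')).hom = cell ((X.comp (chain_le c) (chain_le c')).hom ≫
      (X.coh c).hom ▷ X.map (chain_le c') ≫ X.eval c ◁ (X.coh c').hom) := by
  induction c with
  | nil p =>
    change cell (X.coh c').hom = cell ((X.comp (le_refl p.pt) (chain_le c')).hom ≫
      eqToHom (X.map_refl p) ▷ X.map (chain_le c') ≫ 𝟙 (X.obj p) ◁ (X.coh c').hom)
    rw [← Category.id_comp (X.coh c').hom]
    refine cell_comp (X.comp_refl_left _).symm ?_
    rw [eqToHom_whiskerRight, cell_eqToHom_comp, Category.id_comp, cell_id_whiskerLeft]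
  | @cons p q s h c ih =>
    change cell ((X.comp h.le (chain_le (c.append c'))).hom ≫
      X.map h.le ◁ (X.coh (c.append c')).hom) =
      cell ((X.comp (h.le.trans (chain_le c)) (chain_le c')).hom ≫
      ((X.comp h.le (chain_le c)).hom ≫ X.map h.le ◁ (X.coh c).hom) ▷ X.map (chain_le c') ≫
      (X.map h.le ≫ X.eval c) ◁ (X.coh c').hom)
    refine (cell_comp (β' := X.map h.le ◁ ((X.comp (chain_le c) (chain_le c')).hom ≫
      (X.coh c).hom ▷ X.map (chain_le c') ≫ X.eval c ◁ (X.coh c').hom)) rfl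
      (cell_whiskerLeft rfl (ih c'))).trans ?_
    rw [whiskerLeft_comp, Bicategory.comp_whiskerRight, Category.assoc, ← Category.assoc, ← Category.assoc]
    refine cell_comp (X.comp_assoc _ _ _).symm ?_
    rw [whiskerLeft_comp]
    exact cell_comp (cell_whisker_assoc _ _ _).symm (cell_comp_whiskerLeft _ _ _).symm

/-- The coherence isomorphism to the image of a 1-morphism. -/
noncomputable def cohHom {p q : Osim n} (f : p ⟶ q) :
    X.map (hom_le f) ≅ X.eval (toChain f) :=
  X.coh (toChain f)

theorem cohHom_comp {p q r : Osim n} (f : p ⟶ q) (g : q ⟶ r) :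
    cell (X.cohHom (f ≫ g)).hom = cell ((X.comp (hom_le f) (hom_le g)).hom ≫
      (X.cohHom f).hom ▷ X.map (hom_le g) ≫ X.eval (toChain f) ◁ (X.cohHom g).hom) := by
  refine Eq.trans ?_ (X.coh_append (toChain f) (toChain g))
  dsimp only [cohHom]
  rw [toChain_comp]

theorem map_comp_eq {p q r : Osim n} (f : p ⟶ q) (g : q ⟶ r) :
    X.eval (toChain (f ≫ g)) = X.eval (toChain f) ≫ X.eval (toChain g) := by
  rw [toChain_comp, eval_append]

theorem cohHom_comp' {p q r : Osim n} (f : p ⟶ q) (g : q ⟶ r) :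
    (X.cohHom (f ≫ g)).hom = (X.comp (hom_le f) (hom_le g)).hom ≫
      (X.cohHom f).hom ▷ X.map (hom_le g) ≫ X.eval (toChain f) ◁ (X.cohHom g).hom ≫
      eqToHom (X.map_comp_eq f g).symm := by
  refine cell_inj ((X.cohHom_comp f g).trans ?_)
  rw [← cell_comp_eqToHom _ (X.map_comp_eq f g).symm]
  simp only [Category.assoc]

/-- The 2-functor out of `O~[n]` determined by a normal pseudofunctor out of `[n]`. -/
noncomputable def lift : TwoFunctor (Osim n) E where
  obj := X.obj
  map f := X.eval (toChain f)
  map₂ {_ _ f g} _ := (X.cohHom f).inv ≫ (X.cohHom g).hom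
  map₂_id _ := Iso.inv_hom_id _
  map₂_comp _ _ := by simp
  map_id p := by rw [toChain_id]; rfl
  map_comp f g := X.map_comp_eq f g
  map₂_whisker_left f g g' _ := by
    rw [Iso.inv_comp_eq, cohHom_comp', cohHom_comp']
    simp
  map₂_whisker_right {_ _ _ f f'} _ g := by
    rw [Iso.inv_comp_eq, cohHom_comp', cohHom_comp']
    simp only [Category.assoc, eqToHom_trans_assoc, eqToHom_refl, Category.id_comp]
    -- By interchange the coherence of `g` moves in front of those of `f` and `f'`. Both sides then
    -- begin alike, and the inverse coherence of `f` cancels.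
    rw [← whisker_exchange_assoc, ← whisker_exchange_assoc, ← comp_whiskerRight_assoc]
    simp

theorem lift_map_edge {p q : Osim n} (h : p.pt ≤ q.pt) : X.lift.map (edge h) = X.map h := by
  change X.eval (toChain _) = _
  rcases h.eq_or_lt with h' | h'
  · obtain ⟨p⟩ := p
    obtain ⟨q⟩ := q
    obtain rfl : p = q := h'
    rw [edge_refl, toChain_id]
    exact (X.map_refl _).symm
  · rw [toChain_edge h']
    exact Bicategory.Strict.comp_id _

/-- The chain of an edge has at most one link: with none, the coherence is the transport along
`map_refl`; with one, it is trivial by `comp_refl_right`. -/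
theorem cohHom_edge {p q : Osim n} (h : p.pt ≤ q.pt) :
    cell (X.cohHom (edge h)).hom = cell (𝟙 (X.map h)) := by
  dsimp only [cohHom]
  rcases h.eq_or_lt with h' | h'
  · obtain ⟨p⟩ := p
    obtain ⟨q⟩ := q
    obtain rfl : p = q := h'
    have := toChain_id (⟨p⟩ : Osim n)
    rw [← edge_refl] at this
    have h1 : ∀ c : Chain (⟨p⟩ : Osim n) ⟨p⟩, c = Chain.nil _ →
        cell (X.coh c).hom = cell (𝟙 (X.map h)) := by
      rintro _ rfl
      exact cell_eqToHom (X.map_refl ⟨p⟩)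
    exact h1 _ this
  · rw [toChain_edge h']
    change cell ((X.comp h (le_refl q.pt)).hom ≫ X.map h ◁ eqToHom (X.map_refl q)) = _
    rw [whiskerLeft_eqToHom, cell_comp_eqToHom]
    exact X.comp_refl_right h

/-- Single edges have trivial coherence, so in the coherence of a composite of two edges only the
compositor survives. -/
theorem lift_map₂_tri {p q r : Osim n} (h : p.pt ≤ q.pt) (h' : q.pt ≤ r.pt) :
    cell (X.lift.map₂ (tri h h')) = cell (X.comp h h').hom := by
  change cell ((X.cohHom _).inv ≫ (X.cohHom _).hom) = _
  have h1 : cell (X.cohHom (edge (h.trans h'))).inv = cell (𝟙 (X.map (h.trans h'))) :=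
    cell_inv (α' := Iso.refl _) (X.cohHom_edge _)
  refine (cell_comp h1 (X.cohHom_comp (edge h) (edge h'))).trans ?_
  rw [Category.id_comp]
  refine Eq.trans ?_ (cell_congr (Category.comp_id (X.comp h h').hom))
  refine cell_comp rfl ?_
  have h2 := cell_whiskerRight (X.cohHom_edge h) (rfl : mor (X.map h') = mor (X.map h'))
  have h3 := cell_whiskerLeft (show mor (X.eval (toChain (edge h))) = mor (X.map h) from
    mor_congr (X.lift_map_edge h)) (X.cohHom_edge h')
  rw [id_whiskerRight] at h2
  rw [whiskerLeft_id] at h3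
  exact (cell_comp h2 h3).trans (by rw [Category.id_comp])

end SimplexData

end

end Osim

/-! ### The 2-category of `J`-indexed diagrams of 1-morphisms -/

section

set_option linter.unusedSectionVars false

attribute [-instance] CategoryTheory.StrictBicategory.category

/-- (The objects of) the 2-category with the objects of `D` and with the functors
`J ⥤ (a ⟶ b)` as 1-morphisms `a ⟶ b`. -/
structure Diag (J : Type) (D : Type u₁) where
  pt : D

namespace Diag

variable {J : Type} [SmallCategory J] {D : Type u₁} [Bicategory.{w₁, v₁} D]

/-- On a morphism of `J` the composite is a horizontal composite of 2-morphisms, written in one of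
its two equal forms; the interchange law makes this functorial. -/
instance : CategoryStruct (Diag J D) where
  Hom a b := J ⥤ (a.pt ⟶ b.pt)
  id a := (CategoryTheory.Functor.const J).obj (𝟙 a.pt)
  comp f g :=
    { obj := fun k => f.obj k ≫ g.obj k
      map := fun u => f.map u ▷ g.obj _ ≫ f.obj _ ◁ g.map u
      map_id := fun k => by simp
      map_comp := fun u v => by simp [whisker_exchange_assoc] }

instance (a b : Diag J D) : Category (a ⟶ b) :=
  inferInstanceAs (Category (J ⥤ (a.pt ⟶ b.pt)))

/-- The value of a 1-morphism at an index. -/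
abbrev at₁ {a b : Diag J D} (f : a ⟶ b) (k : J) : a.pt ⟶ b.pt := CategoryTheory.Functor.obj f k

/-- The action of a 1-morphism on a morphism of indices. -/
abbrev step {a b : Diag J D} (f : a ⟶ b) {k l : J} (u : k ⟶ l) : at₁ f k ⟶ at₁ f l :=
  CategoryTheory.Functor.map f u

/-- The value of a 2-morphism at an index. -/
abbrev at₂ {a b : Diag J D} {f g : a ⟶ b} (α : f ⟶ g) (k : J) : at₁ f k ⟶ at₁ g k :=
  NatTrans.app α k

theorem step_natural {a b : Diag J D} {f g : a ⟶ b} (α : f ⟶ g) {k l : J} (u : k ⟶ l) :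
    step f u ≫ at₂ α l = at₂ α k ≫ step g u :=
  NatTrans.naturality α u

theorem step_id {a b : Diag J D} (f : a ⟶ b) (k : J) : step f (𝟙 k) = 𝟙 _ :=
  CategoryTheory.Functor.map_id f k

theorem step_comp {a b : Diag J D} (f : a ⟶ b) {k l m : J} (u : k ⟶ l) (v : l ⟶ m) :
    step f (u ≫ v) = step f u ≫ step f v :=
  CategoryTheory.Functor.map_comp f u v

/-- Construct a 2-morphism. -/
def mk₂ {a b : Diag J D} {f g : a ⟶ b} (α : ∀ k, at₁ f k ⟶ at₁ g k)
    (h : ∀ {k l : J} (u : k ⟶ l), step f u ≫ α l = α k ≫ step g u) : f ⟶ g :=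
  ({ app := α, naturality := fun _ _ u => h u } : NatTrans f g)

/-- Construct an invertible 2-morphism. -/
def mkIso {a b : Diag J D} {f g : a ⟶ b} (α : ∀ k, at₁ f k ≅ at₁ g k)
    (h : ∀ {k l : J} (u : k ⟶ l), step f u ≫ (α l).hom = (α k).hom ≫ step g u) : f ≅ g where
  hom := mk₂ (fun k => (α k).hom) h
  inv := mk₂ (fun k => (α k).inv) (fun {k l} u => by
    rw [Iso.comp_inv_eq, Category.assoc, h, Iso.inv_hom_id_assoc])
  hom_inv_id := NatTrans.ext (funext fun k => (α k).hom_inv_id)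
  inv_hom_id := NatTrans.ext (funext fun k => (α k).inv_hom_id)

theorem hom₂_ext {a b : Diag J D} {f g : a ⟶ b} {α β : f ⟶ g} (h : ∀ k, at₂ α k = at₂ β k) :
    α = β :=
  NatTrans.ext (funext h)

theorem step_one (a : Diag J D) {k l : J} (u : k ⟶ l) : step (𝟙 a) u = 𝟙 (𝟙 a.pt) := rfl

theorem step_mul {a b c : Diag J D} (f : a ⟶ b) (g : b ⟶ c) {k l : J} (u : k ⟶ l) :
    step (f ≫ g) u = step f u ▷ at₁ g k ≫ at₁ f l ◁ step g u := rfl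

/-- Whiskering on the left. -/
def whiskerL {a b c : Diag J D} (f : a ⟶ b) {g h : b ⟶ c} (α : g ⟶ h) : f ≫ g ⟶ f ≫ h :=
  mk₂ (f := f ≫ g) (g := f ≫ h) (fun k => at₁ f k ◁ at₂ α k) (fun {k l} u => by
    rw [step_mul, step_mul, Category.assoc, ← Bicategory.whiskerLeft_comp, step_natural α u,
      Bicategory.whiskerLeft_comp, whisker_exchange_assoc])

/-- Whiskering on the right. -/
def whiskerR {a b c : Diag J D} {f g : a ⟶ b} (α : f ⟶ g) (h : b ⟶ c) : f ≫ h ⟶ g ≫ h :=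
  mk₂ (f := f ≫ h) (g := g ≫ h) (fun k => at₂ α k ▷ at₁ h k) (fun {k l} u => by
    rw [step_mul, step_mul, Category.assoc, whisker_exchange,
      ← Bicategory.comp_whiskerRight_assoc, step_natural α u,
      Bicategory.comp_whiskerRight_assoc])

/-- The associator. -/
def assoc {a b c d : Diag J D} (f : a ⟶ b) (g : b ⟶ c) (h : c ⟶ d) :
    (f ≫ g) ≫ h ≅ f ≫ g ≫ h :=
  mkIso (f := (f ≫ g) ≫ h) (g := f ≫ g ≫ h) (fun k => α_ (at₁ f k) (at₁ g k) (at₁ h k))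
    (fun {k l} u => by
      simp only [step_mul]
      change ((step f u ▷ at₁ g k ≫ at₁ f l ◁ step g u) ▷ at₁ h k ≫
        (at₁ f l ≫ at₁ g l) ◁ step h u) ≫ (α_ (at₁ f l) (at₁ g l) (at₁ h l)).hom =
        (α_ (at₁ f k) (at₁ g k) (at₁ h k)).hom ≫ step f u ▷ (at₁ g k ≫ at₁ h k) ≫
        at₁ f l ◁ (step g u ▷ at₁ h k ≫ at₁ g l ◁ step h u)
      simp)

/-- The left unitor. -/
def leftUnitor {a b : Diag J D} (f : a ⟶ b) : 𝟙 a ≫ f ≅ f :=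
  mkIso (f := 𝟙 a ≫ f) (g := f) (fun k => λ_ (at₁ f k)) (fun {k l} u => by
    change (𝟙 (𝟙 _) ▷ at₁ f k ≫ 𝟙 _ ◁ step f u) ≫ (λ_ (at₁ f l)).hom = _
    simp)

/-- The right unitor. -/
def rightUnitor {a b : Diag J D} (f : a ⟶ b) : f ≫ 𝟙 b ≅ f :=
  mkIso (f := f ≫ 𝟙 b) (g := f) (fun k => ρ_ (at₁ f k)) (fun {k l} u => by
    change (step f u ▷ 𝟙 _ ≫ at₁ f l ◁ 𝟙 (𝟙 _)) ≫ (ρ_ (at₁ f l)).hom = _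
    simp)

/-- 2-morphisms are natural transformations, so each axiom is checked index by index in `D`. -/
instance : Bicategory (Diag J D) where
  whiskerLeft f _ _ α := whiskerL f α
  whiskerRight α h := whiskerR α h
  associator f g h := assoc f g h
  leftUnitor f := leftUnitor f
  rightUnitor f := rightUnitor f
  whiskerLeft_id _ _ := hom₂_ext fun _ => Bicategory.whiskerLeft_id _ _
  whiskerLeft_comp _ _ _ _ _ _ := hom₂_ext fun _ => Bicategory.whiskerLeft_comp _ _ _
  id_whiskerLeft _ := hom₂_ext fun _ => Bicategory.id_whiskerLeft _
  comp_whiskerLeft _ _ _ _ _ := hom₂_ext fun _ => Bicategory.comp_whiskerLeft _ _ _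
  id_whiskerRight _ _ := hom₂_ext fun _ => Bicategory.id_whiskerRight _ _
  comp_whiskerRight _ _ _ := hom₂_ext fun _ => Bicategory.comp_whiskerRight _ _ _
  whiskerRight_id _ := hom₂_ext fun _ => Bicategory.whiskerRight_id _
  whiskerRight_comp _ _ _ := hom₂_ext fun _ => Bicategory.whiskerRight_comp _ _ _
  whisker_assoc _ _ _ _ _ := hom₂_ext fun _ => Bicategory.whisker_assoc _ _ _
  whisker_exchange _ _ := hom₂_ext fun _ => Bicategory.whisker_exchange _ _
  pentagon _ _ _ _ := hom₂_ext fun _ => Bicategory.pentagon _ _ _ _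
  triangle _ _ := hom₂_ext fun _ => Bicategory.triangle _ _

theorem hom_ext_cell {a b : Diag J D} {f g : a ⟶ b} (h : ∀ k, at₁ f k = at₁ g k)
    (h' : ∀ {k l : J} (u : k ⟶ l), cell (step f u) = cell (step g u)) : f = g :=
  CategoryTheory.Functor.ext h fun _ _ u => eq_conj_of_cell (h' u) _ _

theorem at₂_eqToHom {a b : Diag J D} {f g : a ⟶ b} (h : f = g) (k : J) :
    at₂ (eqToHom h) k = eqToHom (by rw [h]) := by
  subst h; rfl

variable [Bicategory.Strict D]

instance : Bicategory.Strict (Diag J D) where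
  id_comp f := hom_ext_cell (fun k => Bicategory.Strict.id_comp _) fun {k l} u => by
    rw [step_mul, step_one]
    change cell (𝟙 (𝟙 _) ▷ at₁ f k ≫ 𝟙 _ ◁ step f u) = _
    rw [id_whiskerRight, Category.id_comp, cell_id_whiskerLeft]
  comp_id f := hom_ext_cell (fun k => Bicategory.Strict.comp_id _) fun {k l} u => by
    rw [step_mul, step_one]
    change cell (step f u ▷ 𝟙 _ ≫ at₁ f l ◁ 𝟙 (𝟙 _)) = _
    rw [whiskerLeft_id, Category.comp_id, cell_whiskerRight_id]
  assoc f g h := hom_ext_cell (fun k => Bicategory.Strict.assoc _ _ _) fun {k l} u => by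
    simp only [step_mul, comp_whiskerRight, whiskerLeft_comp, Category.assoc]
    exact cell_comp (cell_whiskerRight_comp _ _ _).symm
      (cell_comp (cell_whisker_assoc _ _ _) (cell_comp_whiskerLeft _ _ _))
  leftUnitor_eqToIso f := Iso.ext (hom₂_ext fun k => by
    rw [eqToIso.hom, at₂_eqToHom]
    exact congrArg Iso.hom (Bicategory.Strict.leftUnitor_eqToIso _))
  rightUnitor_eqToIso f := Iso.ext (hom₂_ext fun k => by
    rw [eqToIso.hom, at₂_eqToHom]
    exact congrArg Iso.hom (Bicategory.Strict.rightUnitor_eqToIso _))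
  associator_eqToIso f g h := Iso.ext (hom₂_ext fun k => by
    rw [eqToIso.hom, at₂_eqToHom]
    exact congrArg Iso.hom (Bicategory.Strict.associator_eqToIso _ _ _))

theorem cell_at₂ {a b a' b' : Diag J D} {f g : a ⟶ b} {f' g' : a' ⟶ b'} {α : f ⟶ g}
    {α' : f' ⟶ g'} (h : cell α = cell α') (k : J) : cell (at₂ α k) = cell (at₂ α' k) := by
  cases h; rfl

theorem cell_step {a b a' b' : Diag J D} {f : a ⟶ b} {f' : a' ⟶ b'} (h : mor f = mor f')
    {k l : J} (u : k ⟶ l) : cell (step f u) = cell (step f' u) := by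
  cases h; rfl

theorem mor_at₁ {a b a' b' : Diag J D} {f : a ⟶ b} {f' : a' ⟶ b'} (h : mor f = mor f')
    (k : J) : mor (at₁ f k) = mor (at₁ f' k) := by
  cases h; rfl

/-- Evaluation at an index. -/
def ev (k : J) : TwoFunctor (Diag J D) D where
  obj a := a.pt
  map f := at₁ f k
  map₂ α := at₂ α k
  map₂_id _ := rfl
  map₂_comp _ _ := rfl
  map_id _ := rfl
  map_comp _ _ := rfl
  map₂_whisker_left _ _ _ _ := Vert.eq_conj _ _ _
  map₂_whisker_right _ _ := Vert.eq_conj _ _ _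

end Diag

end

/-! ### Chains of icons as 2-functors into the pseudo-hom -/

section

set_option linter.unusedSectionVars false

attribute [-instance] CategoryTheory.StrictBicategory.category

/-- A 2-morphism as a square with identity sides. -/
def sqOf {D : Type u₁} [Bicategory.{w₁, v₁} D] {a b : D} {f g : a ⟶ b} (α : f ⟶ g) :
    f ≫ 𝟙 b ⟶ 𝟙 a ≫ g :=
  (ρ_ f).hom ≫ α ≫ (λ_ g).inv

@[simp]
theorem cell_sqOf {D : Type u₁} [Bicategory.{w₁, v₁} D] [Bicategory.Strict D] {a b : D}
    {f g : a ⟶ b} (α : f ⟶ g) : cell (sqOf α) = cell α := by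
  simp [sqOf, Bicategory.Strict.leftUnitor_eqToIso, Bicategory.Strict.rightUnitor_eqToIso]

open scoped CategoryTheory.Oplax.OplaxTrans CategoryTheory.Oplax.OplaxTrans.OplaxFunctor

theorem Vert.hom_ext_cell {B : Type u₁} [Bicategory.{w₁, v₁} B] [Bicategory.Strict B]
    {D : Type u₂} [Bicategory.{w₂, v₂} D] [Bicategory.Strict D] {F G : Vert B D} {η θ : F ⟶ G}
    (happ : ∀ b, mor (app (tr η) b) = mor (app (tr θ) b))
    (hnat : ∀ {a b : B} (f : a ⟶ b), cell (nat (tr η) f) = cell (nat (tr θ) f))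
    (hright : ∀ b, mor (Hom.right η b) = mor (Hom.right θ b))
    (hunit : ∀ b, cell (Hom.adj η b).unit = cell (Hom.adj θ b).unit)
    (hcounit : ∀ b, cell (Hom.adj η b).counit = cell (Hom.adj θ b).counit) : η = θ :=
  have h1 := fun b => mor_inj (happ b)
  have h2 := fun b => mor_inj (hright b)
  hom_ext h1 (fun f => eq_conj_of_cell (hnat f) _ _) h2
    (fun b => (eq_conj_of_cell (hunit b) rfl
      (congrArg₂ (· ≫ ·) (h1 b).symm (h2 b).symm)).trans (Category.id_comp _))
    (fun b => (eq_conj_of_cell (hcounit b)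
      (congrArg₂ (· ≫ ·) (h2 b) (h1 b)) rfl).trans (congrArg (_ ≫ ·) (Category.comp_id _)))

theorem Vert.cell_nat_trans {B : Type u₁} [Bicategory.{w₁, v₁} B] [Bicategory.Strict B]
    {D : Type u₂} [Bicategory.{w₂, v₂} D] [Bicategory.Strict D] {F G H : Vert B D}
    (η : F.toOplax ⟶ G.toOplax) (θ : G.toOplax ⟶ H.toOplax) {x y : B} (f : x ⟶ y) :
    cell (nat (η ≫ θ) f) = cell (nat η f ▷ app θ y ≫
      eqToHom (Bicategory.Strict.assoc _ _ _) ≫ app η x ◁ nat θ f) := by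
  refine (cell_congr (nat_trans η θ f)).trans ((cell_eqToHom_comp _ _).trans
    (cell_comp rfl ?_))
  exact (cell_conj _ _ _).trans (cell_eqToHom_comp _ _).symm

namespace Diag

open Vert hiding hom_ext_cell

variable {B : Type u₁} [Bicategory.{w₁, v₁} B] [Bicategory.Strict B]
  {D : Type u₂} [Bicategory.{w₂, v₂} D] [Bicategory.Strict D] {j : ℕ}
  (G : TwoFunctor B (Diag (Fin (j + 1)) D))

/-- The 2-functor at an index of a family of 2-functors. -/
def vertAt (k : Fin (j + 1)) : Vert B D := ⟨G.comp (ev k)⟩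

theorem cell_step_map_id (x : B) {k l : Fin (j + 1)} (u : k ⟶ l) :
    cell (step (G.map (𝟙 x)) u) = cell (𝟙 (𝟙 (G.obj x).pt)) :=
  cell_step (mor_congr (G.map_id x)) u

theorem cell_step_map_comp {x y z : B} (f : x ⟶ y) (g : y ⟶ z) {k l : Fin (j + 1)} (u : k ⟶ l) :
    cell (step (G.map (f ≫ g)) u) =
      cell (step (G.map f) u ▷ at₁ (G.map g) k ≫ at₁ (G.map f) l ◁ step (G.map g) u) :=
  cell_step (mor_congr (G.map_comp f g)) u

/-- The transformation with identity components between two 2-functors of a family. -/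
def iconTrans {k l : Fin (j + 1)} (u : k ⟶ l) : (vertAt G k).toOplax ⟶ (vertAt G l).toOplax :=
  mkTrans (F := vertAt G k) (G := vertAt G l) (fun x => 𝟙 (G.obj x).pt)
    (fun f => sqOf (step (G.map f) u))
    (fun {x y f g} s => by
      change at₂ (G.map₂ s) k ▷ 𝟙 _ ≫ sqOf _ = sqOf _ ≫ 𝟙 _ ◁ at₂ (G.map₂ s) l
      have := step_natural (G.map₂ s) u
      simp only [sqOf, Bicategory.whiskerRight_id, Bicategory.id_whiskerLeft, Category.assoc,
        Iso.inv_hom_id_assoc]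
      rw [reassoc_of% this])
    (fun x => cell_inj ((cell_sqOf _).trans ((cell_step_map_id G x u).trans
      ((cell_one ((mor_comp_id _).trans
        (congrArg (fun t => mor (at₁ t k)) (G.map_id x)))).symm.trans (cell_eqToHom _).symm))))
    (fun {x y z} f g => cell_inj (by
      refine (cell_sqOf _).trans ((cell_step_map_comp G f g u).trans (Eq.trans ?_
        (cell_eqToHom_comp _ _).symm))
      -- Composition in `Diag` moves the first factor first, whereas an oplax transformation pastes
      -- the square of the second factor first; interchange reconciles them.
      rw [← whisker_exchange]
      exact cell_comp (cell_whiskerLeft rfl (cell_sqOf _).symm)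
        ((cell_whiskerRight (cell_sqOf _).symm rfl).trans (cell_conj _ _ _).symm)))

/-- The 1-morphism of the pseudo-hom with identity components between two 2-functors of a
family. -/
def iconHom {k l : Fin (j + 1)} (u : k ⟶ l) : vertAt G k ⟶ vertAt G l :=
  { trans := iconTrans G u
    right := fun x => 𝟙 (G.obj x).pt
    adj := fun x => Bicategory.Adjunction.id (G.obj x).pt
    isIso_unit := fun x => (ρ_ (𝟙 (G.obj x).pt)).isIso_inv
    isIso_counit := fun x => (ρ_ (𝟙 (G.obj x).pt)).isIso_hom }

theorem iconHom_id (k : Fin (j + 1)) : iconHom G (𝟙 k) = 𝟙 (vertAt G k) :=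
  Vert.hom_ext_cell (fun _ => rfl)
    (fun f => (cell_sqOf _).trans ((cell_congr (step_id _ _)).trans
      ((cell_one (mor_comp_id _).symm).trans ((cell_congr (nat_one (vertAt G k) f)).trans
        (cell_eqToHom _)).symm)))
    (fun _ => rfl) (fun _ => rfl) (fun _ => rfl)

/-- With identity components, pasting of squares reduces to vertical composition of the steps, and
the composite of two identity adjunctions is again an identity adjunction up to transport. -/
theorem iconHom_comp {k l m : Fin (j + 1)} (u : k ⟶ l) (v : l ⟶ m) :
    iconHom G (u ≫ v) = iconHom G u ≫ iconHom G v :=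
  Vert.hom_ext_cell (fun _ => (mor_id_comp _).symm)
    (fun f => by
      refine (cell_sqOf _).trans ((cell_congr (step_comp _ _ _)).trans
        (Eq.trans ?_ (cell_nat_trans (iconTrans G u) (iconTrans G v) f).symm))
      exact cell_comp ((cell_whiskerRight_id _).trans (cell_sqOf _)).symm
        (((cell_id_whiskerLeft _).trans (cell_sqOf _)).symm.trans (cell_eqToHom_comp _ _).symm))
    (fun _ => (mor_id_comp _).symm)
    (fun x => ((cell_congr (id_comp_unit (Bicategory.Adjunction.id (G.obj x).pt))).trans
      (cell_comp_eqToHom _ _)).symm)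
    (fun x => ((cell_congr (id_comp_counit (Bicategory.Adjunction.id (G.obj x).pt))).trans
      (cell_eqToHom_comp _ _)).symm)

/-- A family of 2-functors and icons as a 2-functor out of `O~[j]`. -/
def toVert : TwoFunctor (Osim j) (Vert B D) where
  obj k := vertAt G k.pt
  map f := iconHom G (homOfLE (Osim.hom_le f))
  -- Parallel 1-morphisms of `O~[j]` have the same image, because `iconHom` sees only the endpoints.
  map₂ _ := 𝟙 _
  map₂_id _ := rfl
  map₂_comp _ _ := (Category.comp_id _).symm
  map_id _ := iconHom_id G _
  map_comp _ _ := iconHom_comp G _ _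
  map₂_whisker_left _ _ _ _ := by simp
  map₂_whisker_right _ _ := by simp

end Diag

end

/-! ### Extensionality for elements of the bisimplicial nerve with identity components -/

section

set_option linter.unusedSectionVars false

attribute [-instance] CategoryTheory.StrictBicategory.category

open scoped CategoryTheory.Oplax.OplaxTrans CategoryTheory.Oplax.OplaxTrans.OplaxFunctor

theorem cell_whiskerLeft_one_comp {D : Type u₁} [Bicategory.{w₁, v₁} D] {a b c b' c' : D}
    {f : a ⟶ b} {g h : b ⟶ c} {t : a ⟶ c} {k : b' ⟶ c'} {α : g ⟶ h} (β : f ≫ h ⟶ t)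
    (hα : cell α = cell (𝟙 k)) : cell (f ◁ α ≫ β) = cell β := by
  cases hα; rw [Bicategory.whiskerLeft_id, Category.id_comp]

theorem cell_comp_one_whiskerRight {D : Type u₁} [Bicategory.{w₁, v₁} D] {a b c a' b' : D}
    {f g : a ⟶ b} {h : b ⟶ c} {t : a ⟶ c} {k : a' ⟶ b'} {α : f ⟶ g} (β : t ⟶ f ≫ h)
    (hα : cell α = cell (𝟙 k)) : cell (β ≫ α ▷ h) = cell β := by
  cases hα; rw [Bicategory.id_whiskerRight, Category.comp_id]

namespace Vert

variable {B : Type u₁} [Bicategory.{w₁, v₁} B] [Bicategory.Strict B]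
  {D : Type u₂} [Bicategory.{w₂, v₂} D] [Bicategory.Strict D]

theorem obj_ext {F G : Vert B D} (h : F.fn = G.fn) : F = G := by
  cases F; cases G; cases h; rfl

theorem mor_ext {F F' G G' : Vert B D} (hF : F = F') (hG : G = G') {η : F ⟶ G} {θ : F' ⟶ G'}
    (happ : ∀ b, mor (app (tr η) b) = mor (app (tr θ) b))
    (hnat : ∀ {a b : B} (f : a ⟶ b), cell (nat (tr η) f) = cell (nat (tr θ) f))
    (hright : ∀ b, mor (Hom.right η b) = mor (Hom.right θ b))
    (hunit : ∀ b, cell (Hom.adj η b).unit = cell (Hom.adj θ b).unit)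
    (hcounit : ∀ b, cell (Hom.adj η b).counit = cell (Hom.adj θ b).counit) :
    mor η = mor θ := by
  subst hF hG
  exact mor_congr (hom_ext_cell happ hnat hright hunit hcounit)

theorem cell_ext {F F' G G' : Vert B D} {η θ : F ⟶ G} {η' θ' : F' ⟶ G'} (hη : mor η = mor η')
    (hθ : mor θ = mor θ') {m : η ⟶ θ} {m' : η' ⟶ θ'} (h : ∀ b, cell (cmp m b) = cell (cmp m' b)) :
    cell m = cell m' := by
  cases hη; cases hθ
  exact cell_congr (hom₂_ext fun b => cell_inj (h b))

theorem cell_nat_id {F G : Vert B D} (η : F.toOplax ⟶ G.toOplax) (x : B) :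
    cell (nat η (𝟙 x)) = cell (𝟙 (app η x)) := by
  rw [nat_id, cell_eqToHom]
  refine cell_one ?_
  rw [F.fn.map_id]
  exact mor_id_comp _

theorem cell_nat_comp {F G : Vert B D} (η : F.toOplax ⟶ G.toOplax) {x y z : B} (f : x ⟶ y)
    (g : y ⟶ z) : cell (nat η (f ≫ g)) = cell (F.fn.map f ◁ nat η g ≫
      eqToHom (Bicategory.Strict.assoc _ _ _).symm ≫ nat η f ▷ G.fn.map g) := by
  refine (cell_congr (nat_comp η f g)).trans ((cell_eqToHom_comp _ _).trans
    (cell_comp rfl ?_))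
  exact (cell_conj _ _ _).trans (cell_eqToHom_comp _ _).symm

theorem cell_nat_congr {F G : Vert B D} (η : F.toOplax ⟶ G.toOplax) {x y : B} {f g : x ⟶ y}
    (h : f = g) : cell (nat η f) = cell (nat η g) := by
  rw [h]

/-- Squares over composites are pasted from squares over the factors, and squares over identities
are trivial, so the edges of `O~[i]` suffice. -/
theorem cell_nat_ext_edge {i : ℕ} {F F' G G' : Vert (Osim i) D} (hF : F = F') (hG : G = G')
    (η : F.toOplax ⟶ G.toOplax) (θ : F'.toOplax ⟶ G'.toOplax)
    (happ : ∀ b, mor (app η b) = mor (app θ b))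
    (hnat : ∀ {p q : Osim i} (h : p.pt ≤ q.pt),
      cell (nat η (Osim.edge h)) = cell (nat θ (Osim.edge h)))
    {p q : Osim i} (f : p ⟶ q) : cell (nat η f) = cell (nat θ f) := by
  subst hF hG
  induction f using Osim.hom_induction with
  | h1 p =>
    rw [cell_nat_id, cell_nat_id]
    exact cell_one (happ _)
  | h2 h f ih =>
    rw [cell_nat_comp, cell_nat_comp]
    refine cell_comp (cell_whiskerLeft rfl ih) ?_
    rw [cell_eqToHom_comp, cell_eqToHom_comp]
    exact cell_whiskerRight (hnat h) rfl

end Vert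

open Vert

variable {B : Type u₁} [Bicategory.{w₁, v₁} B] [Bicategory.Strict B]
  {D : Type u₂} [Bicategory.{w₂, v₂} D] [Bicategory.Strict D] {j : ℕ}

/-- A 2-functor from `O~[j]` to the pseudo-hom all of whose components are identities. -/
structure IsIconic (H : TwoFunctor (Osim j) (Vert B D)) : Prop where
  app : ∀ {k l : Osim j} (f : k ⟶ l) (x : B),
    mor (Vert.app (tr (H.map f)) x) = mor (𝟙 ((H.obj k).fn.obj x))
  right : ∀ {k l : Osim j} (f : k ⟶ l) (x : B),
    mor (Hom.right (H.map f) x) = mor (𝟙 ((H.obj k).fn.obj x))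
  unit : ∀ {k l : Osim j} (f : k ⟶ l) (x : B),
    cell (Hom.adj (H.map f) x).unit = cell (𝟙 (𝟙 ((H.obj k).fn.obj x)))
  counit : ∀ {k l : Osim j} (f : k ⟶ l) (x : B),
    cell (Hom.adj (H.map f) x).counit = cell (𝟙 (𝟙 ((H.obj k).fn.obj x)))
  cmp : ∀ {k l : Osim j} {f g : k ⟶ l} (α : f ⟶ g) (x : B),
    cell (Vert.cmp (H.map₂ α) x) = cell (𝟙 (𝟙 ((H.obj k).fn.obj x)))

namespace IsIconic

/-- The 2-morphism from `f` to `g` goes to a modification with identity components, whose axiom then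
says just that the two squares agree. Thus only the endpoints of `f` matter. -/
theorem cell_nat_eq {H : TwoFunctor (Osim j) (Vert B D)} (hH : IsIconic H) {k l : Osim j}
    (f g : k ⟶ l) {x y : B} (s : x ⟶ y) :
    cell (nat (tr (H.map f)) s) = cell (nat (tr (H.map g)) s) := by
  have h := cmp_natural (H.map₂ (Osim.two f g)) s
  exact (cell_comp_one_whiskerRight _ (hH.cmp (Osim.two f g) x)).symm.trans
    ((cell_congr h).symm.trans (cell_whiskerLeft_one_comp _ (hH.cmp (Osim.two f g) y)))

/-- For iconic elements the components, the adjunction data and the modifications are all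
identities, so only the 2-functors at the vertices and the squares are free. The former are known
from edges and triangles (`Osim.twoFunctor_ext_edge`), the latter from pairs of edges
(`cell_nat_eq`, `Vert.cell_nat_ext_edge`). -/
theorem ext {i : ℕ} {H H' : TwoFunctor (Osim j) (Vert (Osim i) D)} (hH : IsIconic H)
    (hH' : IsIconic H') (h0 : ∀ k p, (H.obj k).fn.obj p = (H'.obj k).fn.obj p)
    (h1 : ∀ (k : Osim j) {p q : Osim i} (h : p.pt ≤ q.pt),
      mor ((H.obj k).fn.map (Osim.edge h)) = mor ((H'.obj k).fn.map (Osim.edge h)))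
    (h2 : ∀ (k : Osim j) {p q r : Osim i} (h : p.pt ≤ q.pt) (h' : q.pt ≤ r.pt),
      cell ((H.obj k).fn.map₂ (Osim.tri h h')) = cell ((H'.obj k).fn.map₂ (Osim.tri h h')))
    (h3 : ∀ {k l : Osim j} (u : k.pt ≤ l.pt) {p q : Osim i} (h : p.pt ≤ q.pt),
      cell (nat (tr (H.map (Osim.edge u))) (Osim.edge h)) =
        cell (nat (tr (H'.map (Osim.edge u))) (Osim.edge h))) : H = H' := by
  have ho : ∀ k, H.obj k = H'.obj k := fun k =>
    obj_ext (Osim.twoFunctor_ext_edge (h0 k) (h1 k) (h2 k))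
  have hm : ∀ {k l : Osim j} (f : k ⟶ l), mor (H.map f) = mor (H'.map f) := fun {k l} f =>
    mor_ext (ho k) (ho l)
      (fun p => (hH.app f p).trans ((mor_one (h0 k p)).trans (hH'.app f p).symm))
      (fun s => cell_nat_ext_edge (ho k) (ho l) _ _
        (fun p => (hH.app f p).trans ((mor_one (h0 k p)).trans (hH'.app f p).symm))
        (fun h => (hH.cell_nat_eq f (Osim.edge (Osim.hom_le f)) _).trans
          ((h3 (Osim.hom_le f) h).trans (hH'.cell_nat_eq _ f _))) s)
      (fun p => (hH.right f p).trans ((mor_one (h0 k p)).trans (hH'.right f p).symm))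
      (fun p => (hH.unit f p).trans ((cell_one (mor_one (h0 k p))).trans (hH'.unit f p).symm))
      (fun p => (hH.counit f p).trans
        ((cell_one (mor_one (h0 k p))).trans (hH'.counit f p).symm))
  exact twoFunctor_ext ho hm fun {k l f g} α => cell_ext (hm f) (hm g) fun p =>
    (hH.cmp α p).trans ((cell_one (mor_one (h0 k p))).trans (hH'.cmp α p).symm)

end IsIconic

theorem isIconic_toVert (G : TwoFunctor B (Diag (Fin (j + 1)) D)) : IsIconic (Diag.toVert G) where
  app _ _ := rfl
  right _ _ := rfl
  -- Unit and counit of an identity adjunction are unitors, which are identities up to transport in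
  -- a strict 2-category.
  unit _ _ := cell_rightUnitor_inv _
  counit _ _ := cell_rightUnitor_hom _
  cmp _ _ := rfl

end

/-! ### The comparison of Leinster's nerve with the bisimplicial nerve -/

section

set_option linter.unusedSectionVars false
set_option linter.unusedVariables false

attribute [-instance] CategoryTheory.StrictBicategory.category

open scoped CategoryTheory.Oplax.OplaxTrans CategoryTheory.Oplax.OplaxTrans.OplaxFunctor

theorem cell_one_comp {D : Type u₁} [Bicategory.{w₁, v₁} D] {a b a' b' : D} {f g h : a ⟶ b}
    {k : a' ⟶ b'} {α : f ⟶ g} (β : g ⟶ h) (hα : cell α = cell (𝟙 k)) :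
    cell (α ≫ β) = cell β := by
  cases hα; rw [Category.id_comp]

theorem Diag.cell_ext {J : Type} [SmallCategory J] {D : Type u₁} [Bicategory.{w₁, v₁} D]
    {a b a' b' : Diag J D} {f g : a ⟶ b} {f' g' : a' ⟶ b'} {α : f ⟶ g} {α' : f' ⟶ g'}
    (hf : mor f = mor f') (hg : mor g = mor g')
    (h : ∀ k, cell (Diag.at₂ α k) = cell (Diag.at₂ α' k)) : cell α = cell α' := by
  cases hf; cases hg
  exact cell_congr (Diag.hom₂_ext fun k => cell_inj (h k))

/-! ### Coherence of the compositor of a normal pseudofunctor. -/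

section Normal

variable {B : Type u₁} [Bicategory.{w₁, v₁} B] [Bicategory.Strict B]
  {D : Type u₂} [Bicategory.{w₂, v₂} D] [Bicategory.Strict D]
  (F : StrictlyUnitaryPseudofunctor B D)

/-- The unit constraint of a normal pseudofunctor is trivial, so the left unit axiom leaves nothing
for the compositor but an identity. -/
theorem cell_mapComp_id_left {a b : B} (f : a ⟶ b) :
    cell (F.mapComp (𝟙 a) f).hom = cell (𝟙 (F.map f)) := by
  have h := F.map₂_left_unitor f
  rw [F.mapId_eq_eqToIso, Bicategory.Strict.leftUnitor_eqToIso,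
    Bicategory.Strict.leftUnitor_eqToIso, eqToIso.hom, eqToIso.hom, eqToIso.hom,
    PrelaxFunctor.map₂_eqToHom, eqToHom_whiskerRight] at h
  have h' := cell_congr h
  rw [cell_eqToHom, eqToHom_trans, cell_comp_eqToHom] at h'
  refine h'.symm.trans (cell_one (mor_congr ?_))
  rw [Bicategory.Strict.id_comp]

theorem cell_mapComp_id_right {a b : B} (f : a ⟶ b) :
    cell (F.mapComp f (𝟙 b)).hom = cell (𝟙 (F.map f)) := by
  have h := F.map₂_right_unitor f
  rw [F.mapId_eq_eqToIso, Bicategory.Strict.rightUnitor_eqToIso,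
    Bicategory.Strict.rightUnitor_eqToIso, eqToIso.hom, eqToIso.hom, eqToIso.hom,
    PrelaxFunctor.map₂_eqToHom, whiskerLeft_eqToHom] at h
  have h' := cell_congr h
  rw [cell_eqToHom, eqToHom_trans, cell_comp_eqToHom] at h'
  refine h'.symm.trans (cell_one (mor_congr ?_))
  rw [Bicategory.Strict.comp_id]

theorem cell_mapComp_assoc {a b c d : B} (f : a ⟶ b) (g : b ⟶ c) (h : c ⟶ d) :
    cell ((F.mapComp (f ≫ g) h).hom ≫ (F.mapComp f g).hom ▷ F.map h) =
      cell ((F.mapComp f (g ≫ h)).hom ≫ F.map f ◁ (F.mapComp g h).hom) := by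
  have e := F.mapComp_assoc_right_hom f g h
  rw [Bicategory.Strict.associator_eqToIso, Bicategory.Strict.associator_eqToIso, eqToIso.hom,
    eqToIso.inv, PrelaxFunctor.map₂_eqToHom] at e
  rw [e, cell_eqToHom_comp, ← Category.assoc, cell_comp_eqToHom]

theorem mapComp_natural {a b c : B} {f f' : a ⟶ b} {g g' : b ⟶ c} (α : f ⟶ f') (β : g ⟶ g') :
    F.map₂ (α ▷ g ≫ f' ◁ β) ≫ (F.mapComp f' g').hom =
      (F.mapComp f g).hom ≫ F.map₂ α ▷ F.map g ≫ F.map f' ◁ F.map₂ β := by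
  simp

theorem cell_mapComp_congr {a b c : B} {f f' : a ⟶ b} {g g' : b ⟶ c} (hf : f = f') (hg : g = g') :
    cell (F.mapComp f g).hom = cell (F.mapComp f' g').hom := by
  rw [hf, hg]

theorem cell_normalPre_mapComp {C : Type u₃} [Bicategory.{w₃, v₃} C] [Bicategory.Strict C]
    (P : TwoFunctor C B) {a b c : C} (f : a ⟶ b) (g : b ⟶ c) :
    cell ((normalPre P F).mapComp f g).hom = cell (F.mapComp (P.map f) (P.map g)).hom := by
  refine (cell_congr (normalPre_mapComp P F f g)).trans ?_
  rw [PrelaxFunctor.map₂_eqToHom]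
  exact cell_eqToHom_comp _ _

theorem cell_normalPost_mapComp {E : Type u₃} [Bicategory.{w₃, v₃} E] [Bicategory.Strict E]
    (Q : TwoFunctor D E) {a b c : B} (f : a ⟶ b) (g : b ⟶ c) :
    cell ((normalPost Q F).mapComp f g).hom = cell (Q.map₂ (F.mapComp f g).hom) :=
  (cell_congr (normalPost_mapComp Q F f g)).trans (cell_comp_eqToHom _ _)

end Normal

/-! Constant 1-morphisms of `[i | j, …, j]`. -/

section Const

variable {i j : ℕ}

/-- The 1-morphism of `[i | j, …, j]` all of whose levels are `k`. -/
def constArrow (k : Fin (j + 1)) {p q : (dObj i j).Cell} (h : p.pt ≤ q.pt) : p ⟶ q :=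
  (⟨h, fun _ _ _ => k⟩ : Theta2.Arrow p q)

theorem constArrow_refl (k : Fin (j + 1)) (p : (dObj i j).Cell) :
    constArrow k (le_refl p.pt) = 𝟙 p :=
  Theta2.hom_ext fun l hx hy => absurd (hy.trans hx) (not_le.mpr l.castSucc_lt_succ)

theorem constArrow_comp (k : Fin (j + 1)) {p q r : (dObj i j).Cell} (h : p.pt ≤ q.pt)
    (h' : q.pt ≤ r.pt) : constArrow k (h.trans h') = constArrow k h ≫ constArrow k h' :=
  Theta2.hom_ext fun l hx hz => by
    rcases le_or_gt l.succ q.pt with hy | hy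
    · rw [Theta2.comp_level_left _ _ _ _ _ hy]; rfl
    · rw [Theta2.comp_level_right _ _ _ _ _ (Fin.le_castSucc_iff.mpr hy)]; rfl

theorem constArrow_mono {k l : Fin (j + 1)} (u : k ≤ l) {p q : (dObj i j).Cell}
    (h : p.pt ≤ q.pt) : constArrow k h ≤ constArrow l h :=
  Theta2.le_def.mpr fun _ _ _ => u

/-- The 2-morphism between two constant 1-morphisms. -/
def constCell {k l : Fin (j + 1)} (u : k ≤ l) {p q : (dObj i j).Cell} (h : p.pt ≤ q.pt) :
    constArrow k h ⟶ constArrow l h :=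
  homOfLE (constArrow_mono u h)

/-- This stability of constant 1-morphisms under the simplicial operators is what makes restriction
to them natural in `[i, j]`. -/
theorem dArrow_constArrow {i' j' : ℕ} (α : Fin (i + 1) →o Fin (i' + 1))
    (β : Fin (j + 1) →o Fin (j' + 1)) (k : Fin (j + 1)) {p q : (dObj i j).Cell}
    (h : p.pt ≤ q.pt) : dArrow α β (constArrow k h) =
      constArrow (p := (⟨α p.pt⟩ : (dObj i' j').Cell)) (q := ⟨α q.pt⟩) (β k) (α.monotone h) :=
  Theta2.hom_ext fun _ _ _ => rfl

/-- A vertex of `O~[i]` as an object of `[i | j, …, j]`. -/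
abbrev vtx (j : ℕ) (p : Osim i) : (dObj i j).Cell := ⟨p.pt⟩

end Const

variable {i j : ℕ} {D : Type u₂} [Bicategory.{w₂, v₂} D] [Bicategory.Strict D]

section

variable (F : StrictlyUnitaryPseudofunctor (dObj i j).Cell D)

/-- The chain of 1-morphisms that are the images of the constant ones. -/
def constMap {p q : Osim i} (h : p.pt ≤ q.pt) :
    (⟨F.obj (vtx j p)⟩ : Diag (Fin (j + 1)) D) ⟶ ⟨F.obj (vtx j q)⟩ :=
  { obj := fun k => F.map (constArrow (p := vtx j p) (q := vtx j q) k h)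
    map := fun u => F.map₂ (constCell (leOfHom u) h)
    map_id := fun k => F.map₂_id _
    map_comp := fun u v => F.map₂_comp (constCell (leOfHom u) h) (constCell (leOfHom v) h) }

theorem constMap_refl (p : Osim i) : constMap F (le_refl p.pt) = 𝟙 _ :=
  Diag.hom_ext_cell
    (fun k => (congrArg F.map (constArrow_refl k (vtx j p))).trans (F.map_id _)) fun {k l} u => by
      have h : constCell (leOfHom u) (le_refl (vtx j p).pt) =
        eqToHom ((constArrow_refl k _).trans (constArrow_refl l _).symm) := Subsingleton.elim _ _
      change cell (F.map₂ (constCell (leOfHom u) (le_refl (vtx j p).pt))) = _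
      rw [h, PrelaxFunctor.map₂_eqToHom, cell_eqToHom]
      exact cell_one (mor_congr ((congrArg F.map (constArrow_refl k (vtx j p))).trans
        (F.map_id _)))

/-- The compositor on constant 1-morphisms. -/
def constComp {p q r : Osim i} (h : p.pt ≤ q.pt) (h' : q.pt ≤ r.pt) :
    constMap F (h.trans h') ≅ constMap F h ≫ constMap F h' :=
  Diag.mkIso (fun k => F.map₂Iso (eqToIso (constArrow_comp k
      (p := vtx j p) (q := vtx j q) (r := vtx j r) h h')) ≪≫
      F.mapComp (constArrow k h) (constArrow k h')) fun {k l} u => by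
    change F.map₂ (constCell (leOfHom u) _) ≫ F.map₂ _ ≫ _ = (F.map₂ _ ≫ _) ≫
      (F.map₂ (constCell (leOfHom u) _) ▷ F.map _ ≫ F.map _ ◁ F.map₂ (constCell (leOfHom u) _))
    -- Naturality of the compositor brings both sides to the image of one 2-morphism followed by the
    -- compositor at level `l`; the two 2-morphisms agree since the hom categories of `[i | j, …,
    -- j]` are posets.
    rw [Category.assoc, ← mapComp_natural, ← F.map₂_comp_assoc, ← F.map₂_comp_assoc]
    congr 1

theorem cell_constComp {p q r : Osim i} (h : p.pt ≤ q.pt) (h' : q.pt ≤ r.pt)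
    (k : Fin (j + 1)) : cell (Diag.at₂ (constComp F h h').hom k) =
      cell (F.mapComp (constArrow (p := vtx j p) (q := vtx j q) k h)
        (constArrow (p := vtx j q) (q := vtx j r) k h')).hom := by
  refine cell_one_comp _ ?_ (k := F.map (constArrow (p := vtx j p) (q := vtx j r) k (h.trans h')))
  change cell (F.map₂ (eqToHom (constArrow_comp k (p := vtx j p) (q := vtx j q) (r := vtx j r)
    h h'))) = _
  rw [PrelaxFunctor.map₂_eqToHom, cell_eqToHom]

/-- The chain of icons underlying a normal pseudofunctor on `[i | j, …, j]`. -/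
def restrictConst : Osim.SimplexData i (Diag (Fin (j + 1)) D) where
  obj p := ⟨F.obj (vtx j p)⟩
  map h := constMap F h
  map_refl p := constMap_refl F p
  comp h h' := constComp F h h'
  comp_refl_left {p q} h := Diag.cell_ext rfl
    ((mor_comp (mor_congr (constMap_refl F p)) rfl).trans (mor_id_comp _)) fun k =>
    (cell_constComp F _ _ k).trans ((cell_mapComp_congr F (constArrow_refl k (vtx j p)) rfl).trans
      (cell_mapComp_id_left F _))
  comp_refl_right {p q} h := Diag.cell_ext rfl
    ((mor_comp rfl (mor_congr (constMap_refl F q))).trans (mor_comp_id _)) fun k =>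
    (cell_constComp F _ _ k).trans ((cell_mapComp_congr F rfl (constArrow_refl k (vtx j q))).trans
      (cell_mapComp_id_right F _))
  comp_assoc {p q r s} h h' h'' := Diag.cell_ext rfl (mor_congr (Bicategory.Strict.assoc _ _ _))
    fun k => by
      have e := cell_mapComp_assoc F (constArrow (p := vtx j p) (q := vtx j q) k h)
        (constArrow (p := vtx j q) (q := vtx j r) k h')
        (constArrow (p := vtx j r) (q := vtx j s) k h'')
      refine Eq.trans (cell_comp ((cell_constComp F _ _ k).trans
        (cell_mapComp_congr F (constArrow_comp k _ _) rfl)) (cell_whiskerRight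
          (cell_constComp F _ _ k) rfl)) (e.trans
        (cell_comp ((cell_constComp F _ _ k).trans
        (cell_mapComp_congr F rfl (constArrow_comp k _ _))) (cell_whiskerLeft rfl
          (cell_constComp F _ _ k))).symm)

/-- The element of the bisimplicial nerve given by a normal pseudofunctor on `[i | j, …, j]`. -/
noncomputable def toBisimplex : TwoFunctor (Osim j) (Vert (Osim i) D) :=
  Diag.toVert (restrictConst F).lift

theorem isIconic_toBisimplex : IsIconic (toBisimplex F) := isIconic_toVert _

theorem toBisimplex_edge (k : Osim j) {p q : Osim i} (h : p.pt ≤ q.pt) :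
    mor (((toBisimplex F).obj k).fn.map (Osim.edge h)) =
      mor (F.map (constArrow (p := vtx j p) (q := vtx j q) k.pt h)) :=
  Diag.mor_at₁ (mor_congr ((restrictConst F).lift_map_edge h)) k.pt

theorem toBisimplex_tri (k : Osim j) {p q r : Osim i} (h : p.pt ≤ q.pt) (h' : q.pt ≤ r.pt) :
    cell (((toBisimplex F).obj k).fn.map₂ (Osim.tri h h')) =
      cell (F.mapComp (constArrow (p := vtx j p) (q := vtx j q) k.pt h)
        (constArrow (p := vtx j q) (q := vtx j r) k.pt h')).hom :=
  (Diag.cell_at₂ ((restrictConst F).lift_map₂_tri h h') k.pt).trans (cell_constComp F h h' k.pt)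

theorem toBisimplex_nat {k l : Osim j} (u : k.pt ≤ l.pt) {p q : Osim i} (h : p.pt ≤ q.pt) :
    cell (Vert.nat (Vert.tr ((toBisimplex F).map (Osim.edge u))) (Osim.edge h)) =
      cell (F.map₂ (constCell (p := vtx j p) (q := vtx j q) u h)) :=
  (cell_sqOf _).trans (Diag.cell_step (mor_congr ((restrictConst F).lift_map_edge h)) (homOfLE u))

end

open Vert in
/-- The action of the simplicial operators. -/
def reindex {i' j' : ℕ} (a : Fin (i' + 1) →o Fin (i + 1)) (b : Fin (j' + 1) →o Fin (j + 1))
    (H : TwoFunctor (Osim j) (Vert (Osim i) D)) : TwoFunctor (Osim j') (Vert (Osim i') D) :=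
  (Osim.map b).comp (H.comp (Vert.pre (Osim.map a)))

/-- The components of a reindexed element are among those of the original one. -/
theorem IsIconic.reindex {i' j' : ℕ} (a : Fin (i' + 1) →o Fin (i + 1))
    (b : Fin (j' + 1) →o Fin (j + 1)) {H : TwoFunctor (Osim j) (Vert (Osim i) D)}
    (hH : IsIconic H) : IsIconic (reindex a b H) where
  app f x := hH.app ((Osim.map b).map f) ((Osim.map a).obj x)
  right f x := hH.right ((Osim.map b).map f) ((Osim.map a).obj x)
  unit f x := hH.unit ((Osim.map b).map f) ((Osim.map a).obj x)
  counit f x := hH.counit ((Osim.map b).map f) ((Osim.map a).obj x)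
  cmp α x := hH.cmp ((Osim.map b).map₂ α) ((Osim.map a).obj x)

/-! ### Simplicial operators on edges, triangles and squares. -/

section Reindex

variable {i' j' : ℕ} (a : Fin (i' + 1) →o Fin (i + 1)) (b : Fin (j' + 1) →o Fin (j + 1))
  (H : TwoFunctor (Osim j) (Vert (Osim i) D))

theorem reindex_edge (k : Osim j') {p q : Osim i'} (h : p.pt ≤ q.pt) :
    mor (((reindex a b H).obj k).fn.map (Osim.edge h)) =
      mor ((H.obj ((Osim.map b).obj k)).fn.map (Osim.edge (p := (Osim.map a).obj p)
        (q := (Osim.map a).obj q) (a.monotone h))) :=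
  mor_congr (congrArg (H.obj ((Osim.map b).obj k)).fn.map (Osim.map_edge a h))

theorem cell_map₂_two {n : ℕ} {E : Type u₁} [Bicategory.{w₁, v₁} E] (G : TwoFunctor (Osim n) E)
    {p q : Osim n} {f f' g g' : p ⟶ q} (hf : f = f') (hg : g = g') :
    cell (G.map₂ (Osim.two f g)) = cell (G.map₂ (Osim.two f' g')) := by
  rw [hf, hg]

theorem reindex_tri (k : Osim j') {p q r : Osim i'} (h : p.pt ≤ q.pt) (h' : q.pt ≤ r.pt) :
    cell (((reindex a b H).obj k).fn.map₂ (Osim.tri h h')) =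
      cell ((H.obj ((Osim.map b).obj k)).fn.map₂ (Osim.tri (p := (Osim.map a).obj p)
        (q := (Osim.map a).obj q) (r := (Osim.map a).obj r) (a.monotone h) (a.monotone h'))) :=
  cell_map₂_two (H.obj ((Osim.map b).obj k)).fn (Osim.map_edge a _)
    (((Osim.map a).map_comp _ _).trans (congrArg₂ (· ≫ ·) (Osim.map_edge a h)
      (Osim.map_edge a h')))

theorem reindex_nat {k l : Osim j'} (u : k.pt ≤ l.pt) {p q : Osim i'} (h : p.pt ≤ q.pt) :
    cell (Vert.nat (Vert.tr ((reindex a b H).map (Osim.edge u))) (Osim.edge h)) =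
      cell (Vert.nat (Vert.tr (H.map (Osim.edge (p := (Osim.map b).obj k)
        (q := (Osim.map b).obj l) (b.monotone u)))) (Osim.edge (p := (Osim.map a).obj p)
        (q := (Osim.map a).obj q) (a.monotone h))) := by
  have e1 := congrArg (fun t => cell (Vert.nat (Vert.tr (H.map t)) ((Osim.map a).map
    (Osim.edge h)))) (Osim.map_edge b u)
  refine Eq.trans e1 ?_
  exact Vert.cell_nat_congr _ (Osim.map_edge a h)

end Reindex

/-- Both sides are iconic, and on edges, triangles and squares both evaluate `F` on constant
1-morphisms, which `dMap a b` preserves. -/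
theorem toBisimplex_normalPre {i' j' : ℕ} (a : Fin (i' + 1) →o Fin (i + 1))
    (b : Fin (j' + 1) →o Fin (j + 1)) (F : StrictlyUnitaryPseudofunctor (dObj i j).Cell D) :
    toBisimplex (normalPre (dMap a b) F) = reindex a b (toBisimplex F) :=
  (isIconic_toBisimplex _).ext ((isIconic_toBisimplex F).reindex a b) (fun _ _ => rfl)
    (fun k p q h => (toBisimplex_edge _ k h).trans (((reindex_edge a b _ k h).trans
      (toBisimplex_edge F _ _)).trans
      (mor_congr (congrArg F.map (dArrow_constArrow a b k.pt (p := vtx j' p) (q := vtx j' q)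
        h).symm))).symm)
    (fun k p q r h h' => by
      refine (toBisimplex_tri _ k h h').trans (Eq.trans ?_ ((reindex_tri a b _ k h h').trans
        (toBisimplex_tri F _ _ _)).symm)
      exact (cell_normalPre_mapComp F (dMap a b) _ _).trans (cell_mapComp_congr F
        (dArrow_constArrow a b k.pt (p := vtx j' p) (q := vtx j' q) h)
        (dArrow_constArrow a b k.pt (p := vtx j' q) (q := vtx j' r) h')))
    (fun u p q h => by
      refine (toBisimplex_nat _ u h).trans (Eq.trans ?_ ((reindex_nat a b _ u h).trans
        (toBisimplex_nat F _ _)).symm)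
      rfl)

/-! ### Naturality of the comparison in the target 2-category. -/

section Post

variable {E : Type u₃} [Bicategory.{w₃, v₃} E] [Bicategory.Strict E]

theorem cell_sq {a b b' c : D} (Q : TwoFunctor D E) {p : a ⟶ b} {s : b ⟶ c} {r : a ⟶ b'}
    {q : b' ⟶ c} (n : p ≫ s ⟶ r ≫ q) : cell (Vert.sq Q n) = cell (Q.map₂ n) :=
  cell_conj _ _ _

theorem IsIconic.post {B : Type u₁} [Bicategory.{w₁, v₁} B] [Bicategory.Strict B]
    (Q : TwoFunctor D E) {H : TwoFunctor (Osim j) (Vert B D)} (hH : IsIconic H) :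
    IsIconic (H.comp (Vert.post Q)) where
  app f x := (mor_map Q.toPrelaxFunctor (hH.app f x)).trans (mor_congr (Q.map_id _))
  right f x := (mor_map Q.toPrelaxFunctor (hH.right f x)).trans (mor_congr (Q.map_id _))
  unit f x := (cell_conj _ _ _).trans ((cell_map₂ Q.toPrelaxFunctor (hH.unit f x)).trans
    ((cell_congr (Q.map₂_id _)).trans (cell_one (mor_congr (Q.map_id _)))))
  counit f x := (cell_conj _ _ _).trans ((cell_map₂ Q.toPrelaxFunctor (hH.counit f x)).trans
    ((cell_congr (Q.map₂_id _)).trans (cell_one (mor_congr (Q.map_id _)))))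
  cmp α x := (cell_map₂ Q.toPrelaxFunctor (hH.cmp α x)).trans
    ((cell_congr (Q.map₂_id _)).trans (cell_one (mor_congr (Q.map_id _))))

/-- A 2-functor `Q` preserves identities, so postcomposition keeps elements iconic and
`IsIconic.ext` applies again; both sides are then `Q` applied to the same values of `F`. -/
theorem toBisimplex_normalPost (Q : TwoFunctor D E)
    (F : StrictlyUnitaryPseudofunctor (dObj i j).Cell D) :
    toBisimplex (normalPost Q F) = (toBisimplex F).comp (Vert.post Q) :=
  (isIconic_toBisimplex _).ext ((isIconic_toBisimplex F).post Q) (fun _ _ => rfl)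
    (fun k p q h => (toBisimplex_edge _ k h).trans
      (mor_map Q.toPrelaxFunctor (toBisimplex_edge F k h)).symm)
    (fun k p q r h h' => (toBisimplex_tri _ k h h').trans ((cell_normalPost_mapComp F Q _ _).trans
      (cell_map₂ Q.toPrelaxFunctor (toBisimplex_tri F k h h')).symm))
    (fun u p q h => (toBisimplex_nat _ u h).trans
      ((cell_sq Q _).trans (cell_map₂ Q.toPrelaxFunctor (toBisimplex_nat F u h))).symm)

end Post

end

/-! ### 2-functors from `[i | j, …, j]` to an object of `Θ₂` -/

section

set_option linter.unusedSectionVars false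
set_option linter.unusedVariables false

attribute [-instance] CategoryTheory.StrictBicategory.category

namespace Theta2

variable {θ : Theta2}

/-- Restriction of a 1-morphism to a subinterval. -/
def restrict {x y x' y' : θ.Cell} (f : x ⟶ y) (hx : x.pt ≤ x'.pt) (h : x'.pt ≤ y'.pt)
    (hy : y'.pt ≤ y.pt) : x' ⟶ y' :=
  (⟨h, fun k hk hk' => Arrow.level f k (hx.trans hk) (hk'.trans hy)⟩ : Arrow x' y')

theorem restrict_comp_restrict {x y z : θ.Cell} (f : x ⟶ z) (h : x.pt ≤ y.pt)
    (h' : y.pt ≤ z.pt) : restrict f le_rfl h h' ≫ restrict f h h' le_rfl = f :=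
  hom_ext fun l hx hz => by
    rcases le_or_gt l.succ y.pt with hy | hy
    · rw [comp_level_left _ _ _ _ _ hy]; rfl
    · rw [comp_level_right _ _ _ _ _ (Fin.le_castSucc_iff.mpr hy)]; rfl

variable {i j : ℕ}

theorem restrict_step {p q : (dObj i j).Cell} (φ : p ⟶ q) (e : Fin i) (hp : p.pt ≤ e.castSucc)
    (hq : e.succ ≤ q.pt) : restrict (x' := ⟨e.castSucc⟩) (y' := ⟨e.succ⟩) φ hp
      e.castSucc_lt_succ.le hq = constArrow (Arrow.level φ e hp hq) e.castSucc_lt_succ.le :=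
  hom_ext fun l hx hy => by
    obtain rfl : l = e := le_antisymm (Fin.succ_le_succ_iff.mp hy)
      (Fin.castSucc_le_castSucc_iff.mp hx)
    rfl

/-- Cut `φ` into the part before the step `e`, the step itself and the part after it. Composition in
`θ` is concatenation, so the level at `l`, which is covered by the image of `e`, comes from the
middle factor alone; by `restrict_step` that factor is constant. -/
theorem map_level_eq (s : TwoFunctor (dObj i j).Cell θ.Cell) {p q : (dObj i j).Cell}
    (φ : p ⟶ q) (e : Fin i) (hp : p.pt ≤ e.castSucc) (hq : e.succ ≤ q.pt) (l : Fin θ.len)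
    (hx : (s.obj p).pt ≤ l.castSucc) (hy : l.succ ≤ (s.obj q).pt)
    (hx' : (s.obj ⟨e.castSucc⟩).pt ≤ l.castSucc) (hy' : l.succ ≤ (s.obj ⟨e.succ⟩).pt) :
    Arrow.level (s.map φ) l hx hy = Arrow.level (s.map (constArrow (p := ⟨e.castSucc⟩)
      (q := ⟨e.succ⟩) (Arrow.level φ e hp hq) e.castSucc_lt_succ.le)) l hx' hy' := by
  have h1 : φ = restrict (y' := ⟨e.succ⟩) φ le_rfl (hp.trans e.castSucc_lt_succ.le) hq ≫
    restrict φ (hp.trans e.castSucc_lt_succ.le) hq le_rfl := (restrict_comp_restrict φ _ _).symm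
  have h2 : restrict (y' := ⟨e.succ⟩) φ le_rfl (hp.trans e.castSucc_lt_succ.le) hq =
    restrict (y' := ⟨e.castSucc⟩) φ le_rfl hp (e.castSucc_lt_succ.le.trans hq) ≫
      constArrow (Arrow.level φ e hp hq) e.castSucc_lt_succ.le :=
    (restrict_comp_restrict (x := p) (y := ⟨e.castSucc⟩) (z := ⟨e.succ⟩)
      (restrict (y' := ⟨e.succ⟩) φ le_rfl (hp.trans e.castSucc_lt_succ.le) hq) hp
      e.castSucc_lt_succ.le).symm.trans (congrArg (restrict (y' := ⟨e.castSucc⟩) φ le_rfl hp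
        (e.castSucc_lt_succ.le.trans hq) ≫ ·) (restrict_step φ e hp hq))
  have h3 := (congrArg s.map h1).trans ((s.map_comp _ _).trans
    (congrArg (· ≫ _) ((congrArg s.map h2).trans (s.map_comp _ _))))
  have h4 : ∀ {ψ : s.obj p ⟶ s.obj q}, s.map φ = ψ → Arrow.level (s.map φ) l hx hy =
    Arrow.level ψ l hx hy := by rintro _ rfl; rfl
  rw [h4 h3, comp_level_left _ _ _ _ _ hy', comp_level_right _ _ _ _ _ hx']
  rfl

/-- The action on 1-morphisms of the 2-functor `simplexMap`. -/
noncomputable def simplexArrow (x : Fin (i + 1) →o Fin (θ.len + 1))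
    (h : Fin (j + 1) →o ((⟨x 0⟩ : θ.Cell) ⟶ ⟨x (Fin.last i)⟩)) {p q : (dObj i j).Cell}
    (φ : p ⟶ q) : (⟨x p.pt⟩ : θ.Cell) ⟶ ⟨x q.pt⟩ :=
  (⟨x.monotone (Arrow.le φ), fun l hx hy =>
    Arrow.level (h (Arrow.level φ (exists_step x hx hy).choose
      (exists_step x hx hy).choose_spec.1.1 (exists_step x hx hy).choose_spec.1.2)) l
      ((x.monotone (Fin.zero_le _)).trans hx) (hy.trans (x.monotone (Fin.le_last _)))⟩ :
        Arrow (⟨x p.pt⟩ : θ.Cell) ⟨x q.pt⟩)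

theorem simplexArrow_level (x : Fin (i + 1) →o Fin (θ.len + 1))
    (h : Fin (j + 1) →o ((⟨x 0⟩ : θ.Cell) ⟶ ⟨x (Fin.last i)⟩)) {p q : (dObj i j).Cell}
    (φ : p ⟶ q) (l : Fin θ.len) (hx : x p.pt ≤ l.castSucc) (hy : l.succ ≤ x q.pt) (k : Fin i)
    (hkx : p.pt ≤ k.castSucc) (hky : k.succ ≤ q.pt)
    (hk : x k.castSucc ≤ l.castSucc ∧ l.succ ≤ x k.succ) :
    Arrow.level (simplexArrow x h φ) l hx hy = Arrow.level (h (Arrow.level φ k hkx hky)) l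
      ((x.monotone (Fin.zero_le _)).trans hx) (hy.trans (x.monotone (Fin.le_last _))) := by
  obtain rfl := step_unique x hk (exists_step x hx hy).choose_spec.2
  rfl

/-- The 2-functor `[i | j, …, j] ⥤ θ` given by vertices and a chain of 1-morphisms between the
first and the last one. -/
noncomputable def simplexMap (x : Fin (i + 1) →o Fin (θ.len + 1))
    (h : Fin (j + 1) →o ((⟨x 0⟩ : θ.Cell) ⟶ ⟨x (Fin.last i)⟩)) :
    TwoFunctor (dObj i j).Cell θ.Cell where
  obj p := ⟨x p.pt⟩
  map φ := simplexArrow x h φ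
  map₂ η := homOfLE (le_def.mpr fun _ _ _ =>
    le_def.mp (h.monotone (le_def.mp (leOfHom η) _ _ _)) _ _ _)
  map₂_id _ := Subsingleton.elim _ _
  map₂_comp _ _ := Subsingleton.elim _ _
  map_id _ := hom_ext fun l hx hy => absurd (hy.trans hx) (not_le.mpr l.castSucc_lt_succ)
  map_comp {p q r} f g := hom_ext fun l hx hz => by
    obtain ⟨k, ⟨hkx, hkz⟩, hk⟩ := exists_step x hx hz
    rw [simplexArrow_level x h (f ≫ g) l hx hz k hkx hkz hk]
    rcases le_or_gt k.succ q.pt with hy | hy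
    · have hy' := hk.2.trans (x.monotone hy)
      rw [comp_level_left f g k hkx hkz hy,
        comp_level_left (simplexArrow x h f) (simplexArrow x h g) l hx hz hy',
        simplexArrow_level x h f l hx hy' k hkx hy hk]
    · have hy1 := Fin.le_castSucc_iff.mpr hy
      have hy' := (x.monotone hy1).trans hk.1
      rw [comp_level_right f g k hkx hkz hy1,
        comp_level_right (simplexArrow x h f) (simplexArrow x h g) l hx hz hy',
        simplexArrow_level x h g l hy' hz k hy1 hkz hk]
  map₂_whisker_left _ _ _ _ := Subsingleton.elim _ _
  map₂_whisker_right _ _ := Subsingleton.elim _ _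

theorem arrow_heq {x x' y y' : θ.Cell} (hx : x = x') (hy : y = y') {f : x ⟶ y} {f' : x' ⟶ y'}
    (h : ∀ (l : Fin θ.len) h1 h2 h3 h4, Arrow.level f l h1 h2 = Arrow.level f' l h3 h4) :
    HEq f f' := by
  subst hx hy
  exact heq_of_eq (hom_ext fun l h1 h2 => h l h1 h2 h1 h2)

/-- 2-functors from `[i | j, …, j]` to `θ` are determined by their vertices and by the chain of
1-morphisms between the first and the last vertex. -/
theorem ext_const {s s' : TwoFunctor (dObj i j).Cell θ.Cell}
    (h0 : ∀ p, (s.obj p).pt = (s'.obj p).pt)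
    (h1 : ∀ (k : Fin (j + 1)) (l : Fin θ.len) hx hy hx' hy',
      Arrow.level (s.map (constArrow (p := ⟨0⟩) (q := ⟨Fin.last i⟩) k (Fin.zero_le _))) l hx hy =
        Arrow.level (s'.map (constArrow (p := ⟨0⟩) (q := ⟨Fin.last i⟩) k (Fin.zero_le _))) l
          hx' hy') : s = s' := by
  have hobj : s.obj = s'.obj := by
    funext p
    rcases hs : s.obj p with ⟨a⟩
    rcases hs' : s'.obj p with ⟨a'⟩
    have := h0 p
    rw [hs, hs'] at this
    exact congrArg Cell.mk this
  refine ext_thin hobj fun {p q} φ => ?_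
  have key : ∀ (l : Fin θ.len) hx hy hx' hy', Arrow.level (s.map φ) l hx hy =
      Arrow.level (s'.map φ) l hx' hy' := by
    intro l hx hy hx' hy'
    -- The vertex map is monotone because a constant 1-morphism of any level, here `0`, is sent to
    -- some 1-morphism of `θ`.
    let x : Fin (i + 1) →o Fin (θ.len + 1) :=
      ⟨fun p => (s.obj ⟨p⟩).pt, fun p q h => Arrow.le (s.map (constArrow (p := ⟨p⟩) (q := ⟨q⟩)
        (0 : Fin (j + 1)) h))⟩
    obtain ⟨e, ⟨hp, hq⟩, he, he'⟩ := exists_step x hx hy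
    change (s.obj ⟨e.castSucc⟩).pt ≤ _ at he
    change _ ≤ (s.obj ⟨e.succ⟩).pt at he'
    have e1 : ∀ t : TwoFunctor (dObj i j).Cell θ.Cell, (t.obj ⟨0⟩).pt ≤ (t.obj ⟨e.castSucc⟩).pt :=
      fun t => Arrow.le (t.map (constArrow (p := ⟨0⟩) (q := ⟨e.castSucc⟩) (0 : Fin (j + 1))
        (Fin.zero_le _)))
    have e2 : ∀ t : TwoFunctor (dObj i j).Cell θ.Cell,
        (t.obj ⟨e.succ⟩).pt ≤ (t.obj ⟨Fin.last i⟩).pt :=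
      fun t => Arrow.le (t.map (constArrow (p := ⟨e.succ⟩) (q := ⟨Fin.last i⟩) (0 : Fin (j + 1))
        (Fin.le_last _)))
    rw [map_level_eq s φ e hp hq l hx hy he he',
      map_level_eq s' φ e hp hq l hx' hy' (h0 _ ▸ he) (h0 _ ▸ he')]
    -- Replace `φ` by the longest constant 1-morphism with the level that `φ` has at `e`: the image
    -- at `l` is unchanged, and `h1` covers that case.
    have f1 := map_level_eq s (constArrow (p := ⟨0⟩) (q := ⟨Fin.last i⟩) (Arrow.level φ e hp hq)
      (Fin.zero_le _)) e (Fin.zero_le _) (Fin.le_last _) l ((e1 s).trans he) (he'.trans (e2 s))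
      he he'
    have f2 := map_level_eq s' (constArrow (p := ⟨0⟩) (q := ⟨Fin.last i⟩) (Arrow.level φ e hp hq)
      (Fin.zero_le _)) e (Fin.zero_le _) (Fin.le_last _) l ((e1 s').trans (h0 _ ▸ he))
      ((h0 _ ▸ he' : _ ≤ (s'.obj ⟨e.succ⟩).pt).trans (e2 s')) (h0 _ ▸ he) (h0 _ ▸ he')
    exact f1.symm.trans ((h1 _ _ _ _ _ _).trans f2)
  exact arrow_heq (congrFun hobj p) (congrFun hobj q) key

/-- By `ext_const` only vertices and the longest constant 1-morphisms need checking, and `dMap a b`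
keeps these constant. The purpose is to recognize small faces of `s` as standard test 2-functors. -/
theorem dMap_comp_eq_simplexMap {i' j' : ℕ} (s : TwoFunctor (dObj i j).Cell θ.Cell)
    (a : Fin (i' + 1) →o Fin (i + 1)) (b : Fin (j' + 1) →o Fin (j + 1))
    (x : Fin (i' + 1) →o Fin (θ.len + 1))
    (h : Fin (j' + 1) →o ((⟨x 0⟩ : θ.Cell) ⟶ ⟨x (Fin.last i')⟩))
    (h0 : ∀ p, (s.obj ⟨a p⟩).pt = x p)
    (h1 : ∀ (k : Fin (j' + 1)) (l : Fin θ.len) hx hy hx' hy',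
      Arrow.level (s.map (constArrow (p := ⟨a 0⟩) (q := ⟨a (Fin.last i')⟩) (b k)
        (a.monotone (Fin.zero_le _)))) l hx hy = Arrow.level (h k) l hx' hy') :
    (dMap a b).comp s = simplexMap x h :=
  ext_const (fun p => h0 p.pt) fun k l hx hy hx' hy' => by
    refine Eq.trans ?_ (h1 k l hx hy hx' hy')
    exact congrArg (fun t => Arrow.level (s.map t) l hx hy) (dArrow_constArrow a b k
      (p := ⟨0⟩) (q := ⟨Fin.last i'⟩) (Fin.zero_le _))

end Theta2

end

/-! ### Compatible families of elements of the bisimplicial nerve -/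

section

set_option linter.unusedSectionVars false
set_option linter.unusedVariables false

attribute [-instance] CategoryTheory.StrictBicategory.category

open scoped CategoryTheory.Oplax.OplaxTrans CategoryTheory.Oplax.OplaxTrans.OplaxFunctor

section Chains

variable {α : Type*} [Preorder α] {a b c e : α}

/-- A chain of two elements. -/
def chain₂ (h : a ≤ b) : Fin (1 + 1) →o α where
  toFun := ![a, b]
  monotone' := Fin.monotone_iff_le_succ.mpr fun i => by
    fin_cases i; exact h

/-- A chain of three elements. -/
def chain₃ (h : a ≤ b) (h' : b ≤ c) : Fin (2 + 1) →o α where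
  toFun := ![a, b, c]
  monotone' := Fin.monotone_iff_le_succ.mpr fun i => by
    fin_cases i; exacts [h, h']

/-- A chain of four elements. -/
def chain₄ (h : a ≤ b) (h' : b ≤ c) (h'' : c ≤ e) : Fin (3 + 1) →o α where
  toFun := ![a, b, c, e]
  monotone' := Fin.monotone_iff_le_succ.mpr fun i => by
    fin_cases i; exacts [h, h', h'']

end Chains

/-! ### Test 2-functors into `θ` of small shape, and faces. -/

namespace Theta2

variable {θ : Theta2} {i j : ℕ}

theorem level_congr {x y x' y' : θ.Cell} {f : x ⟶ y} {f' : x' ⟶ y'} (h : mor f = mor f')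
    (l : Fin θ.len) (hx : x.pt ≤ l.castSucc) (hy : l.succ ≤ y.pt) (hx' : x'.pt ≤ l.castSucc)
    (hy' : l.succ ≤ y'.pt) : Arrow.level f l hx hy = Arrow.level f' l hx' hy' := by
  cases h; rfl

theorem dMap_comp_eq {i' j' : ℕ} (s : TwoFunctor (dObj i j).Cell θ.Cell)
    (a : Fin (i' + 1) →o Fin (i + 1)) (b : Fin (j' + 1) →o Fin (j + 1))
    (x : Fin (i' + 1) →o Fin (θ.len + 1))
    (h : Fin (j' + 1) →o ((⟨x 0⟩ : θ.Cell) ⟶ ⟨x (Fin.last i')⟩))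
    (h0 : ∀ p, (s.obj ⟨a p⟩).pt = x p)
    (h1 : ∀ k : Fin (j' + 1), mor (s.map (constArrow (p := ⟨a 0⟩) (q := ⟨a (Fin.last i')⟩) (b k)
        (a.monotone (Fin.zero_le _)))) = mor (h k)) :
    (dMap a b).comp s = simplexMap x h :=
  dMap_comp_eq_simplexMap s a b x h h0 fun k l hx hy hx' hy' =>
    level_congr (h1 k) l hx hy hx' hy'

/-- The object `x` as a 2-functor from `[0 | ]`. -/
noncomputable def point (x : θ.Cell) : TwoFunctor (dObj 0 0).Cell θ.Cell :=
  simplexMap (i := 0) (j := 0) (OrderHom.const _ x.pt) (OrderHom.const _ (𝟙 x))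

variable {x y z w : θ.Cell}

/-- A chain of 1-morphisms as a 2-functor from `[1 | j]`. -/
noncomputable def column (c : Fin (j + 1) →o (x ⟶ y)) : TwoFunctor (dObj 1 j).Cell θ.Cell :=
  simplexMap (i := 1) (chain₂ (Arrow.le (c 0))) c

/-- Two composable chains of 1-morphisms as a 2-functor from `[2 | j, j]`. -/
noncomputable def twoColumns (c : Fin (j + 1) →o (x ⟶ y)) (c' : Fin (j + 1) →o (y ⟶ z)) :
    TwoFunctor (dObj 2 j).Cell θ.Cell :=
  simplexMap (i := 2) (chain₃ (Arrow.le (c 0)) (Arrow.le (c' 0)))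
    ⟨fun k => c k ≫ c' k, fun _ _ h => comp_le_comp (c.monotone h) (c'.monotone h)⟩

/-- Three composable 1-morphisms as a 2-functor from `[3 | 0, 0, 0]`. -/
noncomputable def threeArrows (f : x ⟶ y) (g : y ⟶ z) (h : z ⟶ w) :
    TwoFunctor (dObj 3 0).Cell θ.Cell :=
  simplexMap (i := 3) (chain₄ (Arrow.le f) (Arrow.le g) (Arrow.le h))
    (OrderHom.const _ (f ≫ g ≫ h))

/-- The images of the constant 1-morphisms under a 2-functor form a chain. -/
noncomputable def mapConst (s : TwoFunctor (dObj i j).Cell θ.Cell) {p q : Fin (i + 1)}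
    (h : p ≤ q) : Fin (j + 1) →o (s.obj ⟨p⟩ ⟶ s.obj ⟨q⟩) where
  toFun k := s.map (constArrow (p := ⟨p⟩) (q := ⟨q⟩) k h)
  monotone' k l u := leOfHom (s.map₂ (constCell (p := ⟨p⟩) (q := ⟨q⟩) u h))

/-- A face with one vertex has no levels, so it depends neither on `k` nor on the rest of `s`.
Through this and the next two lemmas, the values of a compatible family on test 2-functors control
its values everywhere. -/
theorem dMap_comp_eq_point (s : TwoFunctor (dObj i j).Cell θ.Cell) (p : Fin (i + 1))
    (k : Fin (j + 1)) :
    (dMap (i := 0) (j := 0) (OrderHom.const _ p) (OrderHom.const _ k)).comp s =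
      point (s.obj ⟨p⟩) :=
  dMap_comp_eq_simplexMap s _ _ _ _ (fun _ => rfl) fun _ l hx hy _ _ =>
    absurd (hy.trans hx) (not_le.mpr l.castSucc_lt_succ)

theorem dMap_comp_eq_column {j' : ℕ} (s : TwoFunctor (dObj i j).Cell θ.Cell) {p q : Fin (i + 1)}
    (h : p ≤ q) (b : Fin (j' + 1) →o Fin (j + 1)) :
    (dMap (i := 1) (chain₂ h) b).comp s = column ((mapConst s h).comp b) :=
  dMap_comp_eq s _ _ _ _ (fun r => by fin_cases r <;> rfl) fun k => rfl

theorem dMap_comp_eq_twoColumns {j' : ℕ} (s : TwoFunctor (dObj i j).Cell θ.Cell)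
    {p q r : Fin (i + 1)} (h : p ≤ q) (h' : q ≤ r) (b : Fin (j' + 1) →o Fin (j + 1)) :
    (dMap (i := 2) (chain₃ h h') b).comp s =
      twoColumns ((mapConst s h).comp b) ((mapConst s h').comp b) :=
  dMap_comp_eq s _ _ _ _ (fun r => by fin_cases r <;> rfl) fun k =>
    mor_congr ((congrArg s.map (constArrow_comp (p := ⟨p⟩) (q := ⟨q⟩) (r := ⟨r⟩) (b k) h h')).trans
      (s.map_comp _ _))

/-- Concatenation keeps both factors intact, so the short edges of a test 2-functor give back the
1-morphisms it was built from. -/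
theorem twoColumns_map₀₁ (c : Fin (j + 1) →o (x ⟶ y)) (c' : Fin (j + 1) →o (y ⟶ z))
    (k : Fin (j + 1)) : mor ((twoColumns c c').map (constArrow (p := ⟨0⟩) (q := ⟨1⟩) k
      (Fin.zero_le _))) = mor (c k) :=
  mor_congr (D := θ.Cell) (a := x) (b := y) (hom_ext fun l hx hy =>
    comp_level_left (c k) (c' k) l hx (hy.trans (Arrow.le (c' k))) hy)

theorem twoColumns_map₁₂ (c : Fin (j + 1) →o (x ⟶ y)) (c' : Fin (j + 1) →o (y ⟶ z))
    (k : Fin (j + 1)) : mor ((twoColumns c c').map (constArrow (p := ⟨1⟩) (q := ⟨2⟩) k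
      (show (1 : Fin 3) ≤ 2 by decide))) = mor (c' k) :=
  mor_congr (D := θ.Cell) (a := y) (b := z) (hom_ext fun l hx hy =>
    comp_level_right (c k) (c' k) l ((Arrow.le (c k)).trans hx) hy hx)

variable (f : x ⟶ y) (g : y ⟶ z) (h : z ⟶ w)

theorem threeArrows_map₀₁ : mor ((threeArrows f g h).map (constArrow (p := ⟨0⟩) (q := ⟨1⟩) 0
    (by decide))) = mor f :=
  mor_congr (D := θ.Cell) (a := x) (b := y) (hom_ext fun l hx hy =>
    comp_level_left f (g ≫ h) l hx (hy.trans (Arrow.le (g ≫ h))) hy)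

theorem threeArrows_map₁₂ : mor ((threeArrows f g h).map (constArrow (p := ⟨1⟩) (q := ⟨2⟩) 0
    (by decide))) = mor g :=
  mor_congr (D := θ.Cell) (a := y) (b := z) (hom_ext fun l hx hy =>
    (comp_level_right f (g ≫ h) l ((Arrow.le f).trans hx) (hy.trans (Arrow.le h)) hx).trans
      (comp_level_left g h l hx (hy.trans (Arrow.le h)) hy))

theorem threeArrows_map₂₃ : mor ((threeArrows f g h).map (constArrow (p := ⟨2⟩) (q := ⟨3⟩) 0
    (by decide))) = mor h :=
  mor_congr (D := θ.Cell) (a := z) (b := w) (hom_ext fun l hx hy =>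
    (comp_level_right f (g ≫ h) l (((Arrow.le f).trans (Arrow.le g)).trans hx) hy
      ((Arrow.le g).trans hx)).trans (comp_level_right g h l ((Arrow.le g).trans hx) hy hx))

end Theta2

/-! Elements that factor through `O~[0]`. -/

theorem Osim.eq_id (p q : Osim 0) (f : p ⟶ q) : mor f = mor (𝟙 (⟨0⟩ : Osim 0)) := by
  obtain ⟨p⟩ := p
  obtain ⟨q⟩ := q
  obtain rfl : p = 0 := Subsingleton.elim (α := Fin 1) _ _
  obtain rfl : q = 0 := Subsingleton.elim (α := Fin 1) _ _
  refine mor_congr (Osim.hom_ext ?_)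
  refine Finset.eq_of_subset_of_card_le (fun x hx => ?_) ?_
  · rw [Subsingleton.elim (α := Fin 1) x 0]; exact (𝟙 (⟨0⟩ : Osim 0) : Osim.Hom _ _).source_mem
  · refine Finset.card_le_card fun x hx => ?_
    rw [Subsingleton.elim (α := Fin 1) x 0]; exact f.source_mem

/-! ### Criteria for identity components. -/

section Iconic

open Vert

variable {B : Type u₁} [Bicategory.{w₁, v₁} B] [Bicategory.Strict B]
  {D : Type u₂} [Bicategory.{w₂, v₂} D] [Bicategory.Strict D] {i j : ℕ}

/-- All 1-morphisms and 2-morphisms of `O~[0]` are identities; a 2-functor preserves them, and an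
identity of the pseudo-hom carries identity components and identity adjunctions. -/
theorem isIconic_of_zero (K : TwoFunctor (Osim 0) (Vert B D)) : IsIconic K := by
  have hK : ∀ {k l : Osim 0} (f : k ⟶ l), mor (K.map f) = mor (𝟙 (K.obj k)) := fun {k l} f =>
    (mor_map K.toPrelaxFunctor ((Osim.eq_id _ _ f).trans (Osim.eq_id _ _ (𝟙 k)).symm)).trans
      (mor_congr (K.map_id k))
  have key : ∀ {F G G' : Vert B D} (η : F ⟶ G) (η' : F ⟶ G'), mor η = mor η' → ∀ x : B,
    mor (app (tr η) x) = mor (app (tr η') x) ∧ mor (Hom.right η x) = mor (Hom.right η' x) ∧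
    cell (Hom.adj η x).unit = cell (Hom.adj η' x).unit ∧
    cell (Hom.adj η x).counit = cell (Hom.adj η' x).counit := by
    intro F G G' η η' h x
    cases h
    exact ⟨rfl, rfl, rfl, rfl⟩
  refine ⟨fun f x => (key _ _ (hK f) x).1, fun f x => (key _ _ (hK f) x).2.1,
    fun f x => (key _ _ (hK f) x).2.2.1.trans (cell_rightUnitor_inv _),
    fun f x => (key _ _ (hK f) x).2.2.2.trans (cell_rightUnitor_hom _), fun {k l f g} α x => ?_⟩
  obtain rfl : f = g := mor_inj ((Osim.eq_id _ _ f).trans (Osim.eq_id _ _ g).symm)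
  obtain rfl : α = 𝟙 f := Subsingleton.elim _ _
  refine (cell_congr (congrArg (fun m => cmp m x) (K.map₂_id f))).trans ?_
  exact cell_one (f := app (tr (K.map f)) x) (key _ _ (hK f) x).1

/-- Every condition concerns one vertex `p` of `O~[i]` at a time and is visible after restriction
along `p : [0] ⟶ [i]`. -/
theorem isIconic_of_pre (H : TwoFunctor (Osim j) (Vert (Osim i) D))
    (h : ∀ p : Fin (i + 1), IsIconic (reindex (i' := 0) (OrderHom.const _ p) OrderHom.id H)) :
    IsIconic H := by
  have h' : ∀ p : Fin (i + 1),
      IsIconic (H.comp (pre (Osim.map (m := 0) (OrderHom.const _ p)))) := by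
    intro p
    have := h p
    unfold reindex at this
    rwa [Osim.map_id] at this
  exact ⟨fun f x => (h' x.pt).app f ⟨0⟩, fun f x => (h' x.pt).right f ⟨0⟩,
    fun f x => (h' x.pt).unit f ⟨0⟩, fun f x => (h' x.pt).counit f ⟨0⟩,
    fun α x => (h' x.pt).cmp α ⟨0⟩⟩

end Iconic

/-- A family of elements of the bisimplicial nerve of `D` indexed by the 2-functors from the
`[i | j, …, j]` to `θ`, compatible with the simplicial operators. -/
structure NerveFamily (θ : Theta2) (D : Type u₂) [Bicategory.{w₂, v₂} D] [Bicategory.Strict D] where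
  /-- The members of the family. -/
  elt : ∀ {i j : ℕ}, TwoFunctor (dObj i j).Cell θ.Cell → TwoFunctor (Osim j) (Vert (Osim i) D)
  elt_comp : ∀ {i j i' j' : ℕ} (a : Fin (i' + 1) →o Fin (i + 1)) (b : Fin (j' + 1) →o Fin (j + 1))
    (s : TwoFunctor (dObj i j).Cell θ.Cell), elt ((dMap a b).comp s) = reindex a b (elt s)

namespace NerveFamily

open Vert Theta2

variable {θ : Theta2} {D : Type u₂} [Bicategory.{w₂, v₂} D] [Bicategory.Strict D]
  (X : NerveFamily θ D) {i j : ℕ} (s : TwoFunctor (dObj i j).Cell θ.Cell)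

/-- Here compatibility eliminates the nontrivial adjoint equivalences. Since `[0 | ]` carries no
widths, each 2-functor from `d [0, j]` to `θ` factors through `d [0, 0]`. So the restriction of a
member to a vertex is reindexed from a 2-functor on `O~[0]`, to which `isIconic_of_zero` applies. -/
theorem isIconic : IsIconic (X.elt s) :=
  isIconic_of_pre _ fun p => by
    have h : (dMap (i := 0) (OrderHom.const _ p) OrderHom.id).comp s =
      (dMap OrderHom.id (OrderHom.const _ 0)).comp
        ((dMap (i := 0) (j := 0) (OrderHom.const _ p) (OrderHom.const _ 0)).comp s) :=
      ext_const (fun _ => rfl) fun k l hx hy _ _ =>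
        absurd (hy.trans hx) (not_le.mpr l.castSucc_lt_succ)
    rw [← X.elt_comp, h, X.elt_comp]
    exact (isIconic_of_zero _).reindex _ _

/-- The action on objects. -/
noncomputable def obj (x : θ.Cell) : D := ((X.elt (point x)).obj ⟨0⟩).fn.obj ⟨0⟩

/-- Restriction along a vertex turns `s` into a `point`, so compatibility leaves a value depending
only on the image object. `elt_map`, `elt_nat` and `elt_tri` repeat the argument for edges, squares
and triangles. -/
theorem elt_obj (k : Osim j) (p : Osim i) :
    ((X.elt s).obj k).fn.obj p = X.obj (s.obj (vtx j p)) :=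
  (congrArg (fun H => (Vert.fn (H.obj ⟨0⟩)).obj ⟨0⟩) ((congrArg X.elt
    (dMap_comp_eq_point s p.pt k.pt)).symm.trans (X.elt_comp _ _ s))).symm

variable {x y z : θ.Cell}

/-- The 2-functor on `[1 | 0]` given by a 1-morphism. -/
noncomputable abbrev arr (f : x ⟶ y) : TwoFunctor (dObj 1 0).Cell θ.Cell :=
  column (OrderHom.const _ f)

/-- The action on 1-morphisms. -/
noncomputable def map (f : x ⟶ y) : X.obj x ⟶ X.obj y :=
  castHom (X.elt_obj (arr f) ⟨0⟩ ⟨0⟩) (X.elt_obj (arr f) ⟨0⟩ ⟨1⟩)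
    (((X.elt (arr f)).obj ⟨0⟩).fn.map (Osim.edge (Fin.zero_le _)))

theorem elt_map (k : Osim j) {p q : Osim i} (h : p.pt ≤ q.pt) :
    mor (((X.elt s).obj k).fn.map (Osim.edge h)) =
      mor (X.map (s.map (constArrow (p := vtx j p) (q := vtx j q) k.pt h))) := by
  refine ((mor_castHom _ _ _).trans ?_).symm
  refine (congrArg (fun H => mor ((Vert.fn (H.obj ⟨0⟩)).map (Osim.edge (p := ⟨0⟩) (q := ⟨1⟩)
    (Fin.zero_le _)))) ((congrArg X.elt (dMap_comp_eq_column (j' := 0) s h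
      (OrderHom.const _ k.pt))).symm.trans (X.elt_comp _ _ s))).trans ?_
  exact reindex_edge (i' := 1) (j' := 0) (chain₂ h) (OrderHom.const _ k.pt) (X.elt s) ⟨0⟩
    (p := ⟨0⟩) (q := ⟨1⟩) (Fin.zero_le _)

theorem mor_map_congr {x' y' : θ.Cell} {f : x ⟶ y} {f' : x' ⟶ y'} (h : mor f = mor f') :
    mor (X.map f) = mor (X.map f') := by
  cases h; rfl

/-- The degenerate edge of `point x` read in two ways: as an identity of `O~[0]`, preserved by the
member at `point x`, and as a constant 1-morphism that `point x` sends to `𝟙 x`. -/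
theorem map_id (x : θ.Cell) : X.map (𝟙 x) = 𝟙 (X.obj x) := by
  have h := X.elt_map (point x) ⟨0⟩ (p := ⟨0⟩) (q := ⟨0⟩) le_rfl
  have h1 : (point x).map (constArrow (p := vtx 0 ⟨0⟩) (q := vtx 0 ⟨0⟩) 0 le_rfl) = 𝟙 x :=
    ((congrArg (point x).map (constArrow_refl _ _)).trans ((point x).map_id _))
  refine mor_inj ((X.mor_map_congr (mor_congr h1)).symm.trans (h.symm.trans ?_))
  exact mor_congr ((congrArg ((X.elt (point x)).obj ⟨0⟩).fn.map (Osim.edge_refl ⟨0⟩)).trans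
    (((X.elt (point x)).obj ⟨0⟩).fn.map_id ⟨0⟩))

end NerveFamily

end

/-! ### The normal pseudofunctor of a compatible family -/

section

set_option linter.unusedSectionVars false
set_option linter.unusedVariables false

attribute [-instance] CategoryTheory.StrictBicategory.category

open scoped CategoryTheory.Oplax.OplaxTrans CategoryTheory.Oplax.OplaxTrans.OplaxFunctor

section

variable {D : Type u₁} [Bicategory.{w₁, v₁} D] [Bicategory.Strict D]

theorem mor_comp_of_right_one {a b c a' : D} {f : a ⟶ b} {g : b ⟶ c} (h : mor g = mor (𝟙 a')) :
    mor (f ≫ g) = mor f := by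
  cases h; exact mor_comp_id f

theorem mor_comp_of_left_one {a b c a' : D} {f : a ⟶ b} {g : b ⟶ c} (h : mor f = mor (𝟙 a')) :
    mor (f ≫ g) = mor g := by
  cases h; exact mor_id_comp g

theorem cell_whiskerRight_of_one {a b c a' : D} {f f' : a ⟶ b} {g : b ⟶ c} {α : f ⟶ f'}
    (h : mor g = mor (𝟙 a')) : cell (α ▷ g) = cell α := by
  cases h; exact cell_whiskerRight_id α

theorem cell_whiskerLeft_of_one {a b c a' : D} {f : a ⟶ b} {g g' : b ⟶ c} {α : g ⟶ g'}
    (h : mor f = mor (𝟙 a')) : cell (f ◁ α) = cell α := by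
  cases h; exact cell_id_whiskerLeft α

end

theorem Vert.cell_nat_one {B : Type u₁} [Bicategory.{w₁, v₁} B] [Bicategory.Strict B]
    {D : Type u₂} [Bicategory.{w₂, v₂} D] [Bicategory.Strict D] (F : Vert B D) {x y : B}
    (f : x ⟶ y) : cell (nat (tr (𝟙 F)) f) = cell (𝟙 (F.fn.map f)) := by
  refine (cell_congr (nat_one F f)).trans ((cell_eqToHom _).trans (cell_one ?_))
  exact mor_comp_id _

namespace NerveFamily

open Vert Theta2

variable {θ : Theta2} {D : Type u₂} [Bicategory.{w₂, v₂} D] [Bicategory.Strict D]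
  (X : NerveFamily θ D) {i j : ℕ} (s : TwoFunctor (dObj i j).Cell θ.Cell)

variable {x y z w : θ.Cell}

theorem elt_app {k l : Osim j} (u : k ⟶ l) (p : Osim i) :
    mor (app (tr ((X.elt s).map u)) p) = mor (𝟙 (((X.elt s).obj k).fn.obj p)) :=
  (X.isIconic s).app u p

/-- The 2-functor on `[1 | 1]` given by a 2-morphism. -/
noncomputable abbrev cel {f g : x ⟶ y} (η : f ⟶ g) : TwoFunctor (dObj 1 1).Cell θ.Cell :=
  column (chain₂ (leOfHom η))

/-- The action on 2-morphisms. -/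
noncomputable def map₂ {f g : x ⟶ y} (η : f ⟶ g) : X.map f ⟶ X.map g :=
  -- The sides of the square are identities by `isIconic`, so in the strict 2-category `D` the
  -- square is a 2-morphism between the images of `f` and `g`.
  castCell
    ((mor_comp_of_right_one (X.elt_app (cel η) (Osim.edge (p := ⟨0⟩) (q := ⟨1⟩)
      (Fin.zero_le _)) ⟨1⟩)).trans (X.elt_map (cel η) ⟨0⟩ (p := ⟨0⟩) (q := ⟨1⟩) (Fin.zero_le _)))
    ((mor_comp_of_left_one (X.elt_app (cel η) (Osim.edge (p := ⟨0⟩) (q := ⟨1⟩)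
      (Fin.zero_le _)) ⟨0⟩)).trans (X.elt_map (cel η) ⟨1⟩ (p := ⟨0⟩) (q := ⟨1⟩) (Fin.zero_le _)))
    (nat (tr ((X.elt (cel η)).map (Osim.edge (p := ⟨0⟩) (q := ⟨1⟩) (Fin.zero_le _))))
      (Osim.edge (p := ⟨0⟩) (q := ⟨1⟩) (Fin.zero_le _)))

theorem elt_nat {k l : Osim j} (u : k.pt ≤ l.pt) {p q : Osim i} (h : p.pt ≤ q.pt) :
    cell (nat (tr ((X.elt s).map (Osim.edge u))) (Osim.edge h)) =
      cell (X.map₂ (s.map₂ (constCell (p := vtx j p) (q := vtx j q) u h))) := by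
  refine ((cell_castCell _ _ _).trans ?_).symm
  have e : (mapConst s h).comp (chain₂ u) =
      chain₂ (leOfHom (s.map₂ (constCell (p := vtx j p) (q := vtx j q) u h))) :=
    OrderHom.ext _ _ (funext fun r => by fin_cases r <;> rfl)
  refine (congrArg (fun H => cell (nat (tr (H.map (Osim.edge (p := ⟨0⟩) (q := ⟨1⟩)
    (Fin.zero_le _)))) (Osim.edge (p := ⟨0⟩) (q := ⟨1⟩) (Fin.zero_le _))))
    ((congrArg X.elt ((dMap_comp_eq_column (j' := 1) s h (chain₂ u)).trans
      (congrArg column e))).symm.trans (X.elt_comp _ _ s))).trans ?_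
  exact reindex_nat (i' := 1) (j' := 1) (chain₂ h) (chain₂ u) (X.elt s) (k := ⟨0⟩) (l := ⟨1⟩)
    (Fin.zero_le _) (p := ⟨0⟩) (q := ⟨1⟩) (Fin.zero_le _)

/-- Parallel 2-morphisms of `θ` are equal, so only the boundary matters. -/
theorem cell_map₂_congr {x' y' : θ.Cell} {f g : x ⟶ y} {f' g' : x' ⟶ y'} (hf : mor f = mor f')
    (hg : mor g = mor g') (η : f ⟶ g) (η' : f' ⟶ g') : cell (X.map₂ η) = cell (X.map₂ η') := by
  cases hf; cases hg
  rw [Subsingleton.elim η η']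

/-- The 2-functor on `[2 | 0, 0]` given by two composable 1-morphisms. -/
noncomputable abbrev two (f : x ⟶ y) (g : y ⟶ z) : TwoFunctor (dObj 2 0).Cell θ.Cell :=
  twoColumns (OrderHom.const _ f) (OrderHom.const _ g)

theorem mor_two₁ (f : x ⟶ y) (g : y ⟶ z) :
    mor (((X.elt (two f g)).obj ⟨0⟩).fn.map (Osim.edge (p := ⟨0⟩) (q := ⟨1⟩) (Fin.zero_le _))) =
      mor (X.map f) :=
  (X.elt_map (two f g) ⟨0⟩ (p := ⟨0⟩) (q := ⟨1⟩) (Fin.zero_le _)).trans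
    (X.mor_map_congr (twoColumns_map₀₁ _ _ 0))

theorem mor_two₂ (f : x ⟶ y) (g : y ⟶ z) :
    mor (((X.elt (two f g)).obj ⟨0⟩).fn.map (Osim.edge (p := ⟨1⟩) (q := ⟨2⟩)
      (show (1 : Fin 3) ≤ 2 by decide))) = mor (X.map g) :=
  (X.elt_map (two f g) ⟨0⟩ (p := ⟨1⟩) (q := ⟨2⟩) (show (1 : Fin 3) ≤ 2 by decide)).trans
    (X.mor_map_congr (twoColumns_map₁₂ _ _ 0))

/-- The compositor. -/
noncomputable def mapComp (f : x ⟶ y) (g : y ⟶ z) : X.map (f ≫ g) ≅ X.map f ≫ X.map g :=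
  castIso (X.elt_map (two f g) ⟨0⟩ (p := ⟨0⟩) (q := ⟨2⟩) (Fin.zero_le _))
    ((mor_map_comp ((X.elt (two f g)).obj ⟨0⟩).fn _ _).trans
      (mor_comp (X.mor_two₁ f g) (X.mor_two₂ f g)))
    (((X.elt (two f g)).obj ⟨0⟩).fn.map₂Iso (Osim.twoIso (Osim.edge (p := ⟨0⟩) (q := ⟨2⟩)
      (Fin.zero_le _)) (Osim.edge (p := ⟨0⟩) (q := ⟨1⟩) (Fin.zero_le _) ≫
        Osim.edge (p := ⟨1⟩) (q := ⟨2⟩) (show (1 : Fin 3) ≤ 2 by decide))))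

theorem elt_tri (k : Osim j) {p q r : Osim i} (h : p.pt ≤ q.pt) (h' : q.pt ≤ r.pt) :
    cell (((X.elt s).obj k).fn.map₂ (Osim.tri h h')) =
      cell (X.mapComp (s.map (constArrow (p := vtx j p) (q := vtx j q) k.pt h))
        (s.map (constArrow (p := vtx j q) (q := vtx j r) k.pt h'))).hom := by
  refine ((cell_castIso_hom _ _ _).trans ?_).symm
  refine (congrArg (fun H => cell ((Vert.fn (H.obj ⟨0⟩)).map₂ (Osim.tri (p := ⟨0⟩) (q := ⟨1⟩)
    (r := ⟨2⟩) (Fin.zero_le _) (show (1 : Fin 3) ≤ 2 by decide))))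
    ((congrArg X.elt (dMap_comp_eq_twoColumns (j' := 0) s h h'
      (OrderHom.const _ k.pt))).symm.trans (X.elt_comp _ _ s))).trans ?_
  exact reindex_tri (i' := 2) (j' := 0) (chain₃ h h') (OrderHom.const _ k.pt) (X.elt s) ⟨0⟩
    (p := ⟨0⟩) (q := ⟨1⟩) (r := ⟨2⟩) (Fin.zero_le _) (show (1 : Fin 3) ≤ 2 by decide)

theorem cell_mapComp_congr {x' y' z' : θ.Cell} {f : x ⟶ y} {g : y ⟶ z} {f' : x' ⟶ y'}
    {g' : y' ⟶ z'} (hf : mor f = mor f') (hg : mor g = mor g') :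
    cell (X.mapComp f g).hom = cell (X.mapComp f' g').hom := by
  cases hf; cases hg; rfl

/-- At `[1 | 0]` the only vertical edge is an identity of `O~[0]`, and its squares are identities.
-/
theorem cell_map₂_id (f : x ⟶ y) : cell (X.map₂ (𝟙 f)) = cell (𝟙 (X.map f)) := by
  have h := X.elt_nat (arr f) (k := ⟨0⟩) (l := ⟨0⟩) le_rfl (p := ⟨0⟩) (q := ⟨1⟩) (Fin.zero_le _)
  refine (X.cell_map₂_congr rfl rfl _ _).trans (h.symm.trans ?_)
  refine (congrArg (fun t => cell (nat (tr t) (Osim.edge (p := ⟨0⟩) (q := ⟨1⟩) (Fin.zero_le _))))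
    ((congrArg (X.elt (arr f)).map (Osim.edge_refl ⟨0⟩)).trans
      ((X.elt (arr f)).map_id ⟨0⟩))).trans ?_
  exact (cell_nat_one _ _).trans (cell_one (X.elt_map (arr f) ⟨0⟩ (p := ⟨0⟩) (q := ⟨1⟩)
    (Fin.zero_le _)))

/-- This comes from the shape `[1 | 2]`. In `O~[2]` the 1-morphisms `{0, 2}` and `{0, 1, 2}` have
the same squares by `cell_nat_eq`; the second is a composite, so its square is pasted from those of
`{0, 1}` and `{1, 2}`. -/
theorem map₂_comp {f g h : x ⟶ y} (η : f ⟶ g) (ι : g ⟶ h) :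
    X.map₂ (η ≫ ι) = X.map₂ η ≫ X.map₂ ι := by
  let t := column (chain₃ (leOfHom η) (leOfHom ι))
  have h₀₁ := X.elt_nat t (k := ⟨0⟩) (l := ⟨1⟩) (Fin.zero_le _) (p := ⟨0⟩) (q := ⟨1⟩)
    (Fin.zero_le _)
  have h₁₂ := X.elt_nat t (k := ⟨1⟩) (l := ⟨2⟩) (show (1 : Fin 3) ≤ 2 by decide) (p := ⟨0⟩)
    (q := ⟨1⟩) (Fin.zero_le _)
  have h₀₂ := X.elt_nat t (k := ⟨0⟩) (l := ⟨2⟩) (Fin.zero_le _) (p := ⟨0⟩) (q := ⟨1⟩)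
    (Fin.zero_le _)
  refine cell_inj ((X.cell_map₂_congr rfl rfl _ _).trans (h₀₂.symm.trans ?_))
  refine ((X.isIconic t).cell_nat_eq _ (Osim.edge (p := ⟨0⟩) (q := ⟨1⟩) (Fin.zero_le _) ≫
    Osim.edge (p := ⟨1⟩) (q := ⟨2⟩) (show (1 : Fin 3) ≤ 2 by decide)) _).trans ?_
  refine (congrArg (fun m => cell (nat (tr m) (Osim.edge (p := ⟨0⟩) (q := ⟨1⟩) (Fin.zero_le _))))
    ((X.elt t).map_comp _ _)).trans ?_
  refine (cell_nat_trans _ _ _).trans (cell_comp ?_ ((cell_eqToHom_comp _ _).trans ?_))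
  · exact (cell_whiskerRight_of_one (X.elt_app t _ _)).trans
      (h₀₁.trans (X.cell_map₂_congr rfl rfl _ _))
  · exact (cell_whiskerLeft_of_one (X.elt_app t _ _)).trans
      (h₁₂.trans (X.cell_map₂_congr rfl rfl _ _))

/-- This comes from the shape `[2 | 1, 1]`: it is naturality of the transformation over the vertical
edge `{0, 1}` with respect to the 2-morphism `{0, 2} ⟶ {0, 1, 2}`. The square over `{0, 2}` is the
image of the horizontal composite, and the one over `{0, 1, 2}` is pasted from the images of `η` and
`ι`. -/
theorem mapComp_natural {f f' : x ⟶ y} {g g' : y ⟶ z} (η : f ⟶ f') (ι : g ⟶ g') :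
    (X.mapComp f g).hom ≫ X.map f ◁ X.map₂ ι ≫ X.map₂ η ▷ X.map g' =
      X.map₂ (f ◁ ι ≫ η ▷ g') ≫ (X.mapComp f' g').hom := by
  let c := chain₂ (leOfHom η)
  let c' := chain₂ (leOfHom ι)
  let t := twoColumns c c'
  have h12 : (1 : Fin 3) ≤ 2 := by decide
  let u : (⟨0⟩ : Osim 1) ⟶ ⟨1⟩ := Osim.edge (Fin.zero_le _)
  let e₀₁ : (⟨0⟩ : Osim 2) ⟶ ⟨1⟩ := Osim.edge (Fin.zero_le _)
  let e₁₂ : (⟨1⟩ : Osim 2) ⟶ ⟨2⟩ := Osim.edge h12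
  have hn := nat_natural (tr ((X.elt t).map u)) (Osim.tri (p := ⟨0⟩) (q := ⟨1⟩) (r := ⟨2⟩)
    (Fin.zero_le _) h12)
  refine cell_inj (Eq.trans (Eq.trans ?_ (cell_congr hn)) ?_)
  · refine cell_comp ?_ (Eq.trans ?_ (cell_nat_comp _ e₀₁ e₁₂).symm)
    · refine Eq.trans ?_ (cell_whiskerRight_of_one (X.elt_app t _ _)).symm
      exact Eq.trans (X.cell_mapComp_congr (twoColumns_map₀₁ c c' 0).symm
        (twoColumns_map₁₂ c c' 0).symm) (X.elt_tri t ⟨0⟩ (p := ⟨0⟩) (q := ⟨1⟩) (r := ⟨2⟩)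
          (Fin.zero_le _) h12).symm
    · refine cell_comp (cell_whiskerLeft ?_ ?_) (Eq.trans (cell_whiskerRight ?_ ?_)
        (cell_eqToHom_comp _ _).symm)
      · exact ((X.elt_map t ⟨0⟩ (p := ⟨0⟩) (q := ⟨1⟩) (Fin.zero_le _)).trans
          (X.mor_map_congr (twoColumns_map₀₁ c c' 0))).symm
      · exact ((X.elt_nat t (k := ⟨0⟩) (l := ⟨1⟩) (Fin.zero_le _) (p := ⟨1⟩) (q := ⟨2⟩)
          h12).trans (X.cell_map₂_congr (twoColumns_map₁₂ c c' 0) (twoColumns_map₁₂ c c' 1)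
            _ _)).symm
      · exact ((X.elt_nat t (k := ⟨0⟩) (l := ⟨1⟩) (Fin.zero_le _) (p := ⟨0⟩) (q := ⟨1⟩)
          (Fin.zero_le _)).trans (X.cell_map₂_congr (twoColumns_map₀₁ c c' 0)
            (twoColumns_map₀₁ c c' 1) _ _)).symm
      · exact ((X.elt_map t ⟨1⟩ (p := ⟨1⟩) (q := ⟨2⟩) h12).trans
          (X.mor_map_congr (twoColumns_map₁₂ c c' 1))).symm
  · refine cell_comp ?_ ?_
    · exact (X.elt_nat t (k := ⟨0⟩) (l := ⟨1⟩) (Fin.zero_le _) (p := ⟨0⟩) (q := ⟨2⟩)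
        (Fin.zero_le _)).trans (X.cell_map₂_congr rfl rfl _ _)
    · refine Eq.trans (cell_whiskerLeft_of_one (X.elt_app t _ _)) ?_
      exact (X.elt_tri t ⟨1⟩ (p := ⟨0⟩) (q := ⟨1⟩) (r := ⟨2⟩) (Fin.zero_le _) h12).trans
        (X.cell_mapComp_congr (twoColumns_map₀₁ c c' 1) (twoColumns_map₁₂ c c' 1))

/-- The triangle on the vertices `0, 0, 1` is an identity up to transport in `O~[1]`, and its image
is this compositor. -/
theorem cell_mapComp_id_left (f : x ⟶ y) :
    cell (X.mapComp (𝟙 x) f).hom = cell (𝟙 (X.map f)) := by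
  have h := X.elt_tri (arr f) ⟨0⟩ (p := ⟨0⟩) (q := ⟨0⟩) (r := ⟨1⟩) le_rfl (Fin.zero_le _)
  have h1 : mor ((arr f).map (constArrow (p := vtx 0 ⟨0⟩) (q := vtx 0 ⟨0⟩) 0 le_rfl)) =
      mor (𝟙 x) :=
    mor_congr ((congrArg (arr f).map (constArrow_refl _ _)).trans ((arr f).map_id _))
  refine (X.cell_mapComp_congr h1.symm rfl).trans (h.symm.trans ?_)
  rw [Osim.tri, Osim.two_eq_eqToHom (by rw [Osim.edge_refl, Bicategory.Strict.id_comp]),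
    PrelaxFunctor.map₂_eqToHom, cell_eqToHom]
  exact cell_one (X.elt_map (arr f) ⟨0⟩ (p := ⟨0⟩) (q := ⟨1⟩) (Fin.zero_le _))

theorem cell_mapComp_id_right (f : x ⟶ y) :
    cell (X.mapComp f (𝟙 y)).hom = cell (𝟙 (X.map f)) := by
  have h := X.elt_tri (arr f) ⟨0⟩ (p := ⟨0⟩) (q := ⟨1⟩) (r := ⟨1⟩) (Fin.zero_le _) le_rfl
  have h1 : mor ((arr f).map (constArrow (p := vtx 0 ⟨1⟩) (q := vtx 0 ⟨1⟩) 0 le_rfl)) =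
      mor (𝟙 y) :=
    mor_congr ((congrArg (arr f).map (constArrow_refl _ _)).trans ((arr f).map_id _))
  refine (X.cell_mapComp_congr rfl h1.symm).trans (h.symm.trans ?_)
  rw [Osim.tri, Osim.two_eq_eqToHom (by rw [Osim.edge_refl, Bicategory.Strict.comp_id]),
    PrelaxFunctor.map₂_eqToHom, cell_eqToHom]
  exact cell_one (X.elt_map (arr f) ⟨0⟩ (p := ⟨0⟩) (q := ⟨1⟩) (Fin.zero_le _))

/-- This comes from the shape `[3 | 0, 0, 0]`: the refinements of `{0, 3}` to `{0, 1, 2, 3}` through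
`{0, 2, 3}` and through `{0, 1, 3}` coincide in `O~[3]`, where 2-morphisms are unique. -/
theorem cell_mapComp_assoc (f : x ⟶ y) (g : y ⟶ z) (h : z ⟶ w) :
    cell ((X.mapComp (f ≫ g) h).hom ≫ (X.mapComp f g).hom ▷ X.map h) =
      cell ((X.mapComp f (g ≫ h)).hom ≫ X.map f ◁ (X.mapComp g h).hom) := by
  let t := threeArrows f g h
  have k12 : (1 : Fin 4) ≤ 2 := by decide
  have k23 : (2 : Fin 4) ≤ 3 := by decide
  let G := ((X.elt t).obj ⟨0⟩).fn
  let e₀₁ : (⟨0⟩ : Osim 3) ⟶ ⟨1⟩ := Osim.edge (Fin.zero_le _)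
  let e₁₂ : (⟨1⟩ : Osim 3) ⟶ ⟨2⟩ := Osim.edge k12
  let e₂₃ : (⟨2⟩ : Osim 3) ⟶ ⟨3⟩ := Osim.edge k23
  let t₀₁₂ := Osim.tri (p := ⟨0⟩) (q := ⟨1⟩) (r := ⟨2⟩) (Fin.zero_le _) k12
  let t₁₂₃ := Osim.tri (p := ⟨1⟩) (q := ⟨2⟩) (r := ⟨3⟩) k12 k23
  let t₀₁₃ := Osim.tri (p := ⟨0⟩) (q := ⟨1⟩) (r := ⟨3⟩) (Fin.zero_le _) (k12.trans k23)
  let t₀₂₃ := Osim.tri (p := ⟨0⟩) (q := ⟨2⟩) (r := ⟨3⟩) (Fin.zero_le _) k23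
  have m₀₁ := threeArrows_map₀₁ f g h
  have m₁₂ := threeArrows_map₁₂ f g h
  have m₂₃ := threeArrows_map₂₃ f g h
  have m₀₂ : mor (t.map (constArrow (p := ⟨0⟩) (q := ⟨2⟩) 0 (Fin.zero_le _))) = mor (f ≫ g) :=
    (mor_congr ((congrArg t.map (constArrow_comp (p := ⟨0⟩) (q := ⟨1⟩) (r := ⟨2⟩) 0
      (Fin.zero_le _) k12)).trans (t.map_comp _ _))).trans (mor_comp m₀₁ m₁₂)
  have m₁₃ : mor (t.map (constArrow (p := ⟨1⟩) (q := ⟨3⟩) 0 (k12.trans k23))) = mor (g ≫ h) :=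
    (mor_congr ((congrArg t.map (constArrow_comp (p := ⟨1⟩) (q := ⟨2⟩) (r := ⟨3⟩) 0
      k12 k23)).trans (t.map_comp _ _))).trans (mor_comp m₁₂ m₂₃)
  have l₀₂₃ : cell (G.map₂ t₀₂₃) = cell (X.mapComp (f ≫ g) h).hom :=
    (X.elt_tri t ⟨0⟩ (p := ⟨0⟩) (q := ⟨2⟩) (r := ⟨3⟩) (Fin.zero_le _) k23).trans
      (X.cell_mapComp_congr m₀₂ m₂₃)
  have l₀₁₂ : cell (G.map₂ t₀₁₂) = cell (X.mapComp f g).hom :=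
    (X.elt_tri t ⟨0⟩ (p := ⟨0⟩) (q := ⟨1⟩) (r := ⟨2⟩) (Fin.zero_le _) k12).trans
      (X.cell_mapComp_congr m₀₁ m₁₂)
  have l₀₁₃ : cell (G.map₂ t₀₁₃) = cell (X.mapComp f (g ≫ h)).hom :=
    (X.elt_tri t ⟨0⟩ (p := ⟨0⟩) (q := ⟨1⟩) (r := ⟨3⟩) (Fin.zero_le _) (k12.trans k23)).trans
      (X.cell_mapComp_congr m₀₁ m₁₃)
  have l₁₂₃ : cell (G.map₂ t₁₂₃) = cell (X.mapComp g h).hom :=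
    (X.elt_tri t ⟨0⟩ (p := ⟨1⟩) (q := ⟨2⟩) (r := ⟨3⟩) k12 k23).trans
      (X.cell_mapComp_congr m₁₂ m₂₃)
  have n₀₁ : mor (G.map e₀₁) = mor (X.map f) :=
    (X.elt_map t ⟨0⟩ (p := ⟨0⟩) (q := ⟨1⟩) (Fin.zero_le _)).trans (X.mor_map_congr m₀₁)
  have n₂₃ : mor (G.map e₂₃) = mor (X.map h) :=
    (X.elt_map t ⟨0⟩ (p := ⟨2⟩) (q := ⟨3⟩) k23).trans (X.mor_map_congr m₂₃)
  have c₁ : cell (G.map₂ (t₀₂₃ ≫ t₀₁₂ ▷ e₂₃)) =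
      cell ((X.mapComp (f ≫ g) h).hom ≫ (X.mapComp f g).hom ▷ X.map h) :=
    (cell_congr (G.map₂_comp _ _)).trans (cell_comp l₀₂₃ ((cell_map₂_whiskerRight G _ _).trans
      (cell_whiskerRight l₀₁₂ n₂₃)))
  have c₂ : cell (G.map₂ (t₀₁₃ ≫ e₀₁ ◁ t₁₂₃)) =
      cell ((X.mapComp f (g ≫ h)).hom ≫ X.map f ◁ (X.mapComp g h).hom) :=
    (cell_congr (G.map₂_comp _ _)).trans (cell_comp l₀₁₃ ((cell_map₂_whiskerLeft G _ _).trans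
      (cell_whiskerLeft n₀₁ l₁₂₃)))
  exact c₁.symm.trans ((cell_map₂_two G rfl (Bicategory.Strict.assoc e₀₁ e₁₂ e₂₃)).trans c₂)

theorem cell_map₂_of_eq {f g : x ⟶ y} (h : f = g) (η : f ⟶ g) :
    cell (X.map₂ η) = cell (𝟙 (X.map f)) :=
  (X.cell_map₂_congr rfl (mor_congr h.symm) η (𝟙 f)).trans (X.cell_map₂_id f)

/-- The normal pseudofunctor of a compatible family. -/
noncomputable def toNormal : StrictlyUnitaryPseudofunctor θ.Cell D :=
  StrictlyUnitaryPseudofunctor.mk'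
    { obj := X.obj
      map := X.map
      map_id := X.map_id
      map₂ := X.map₂
      map₂_id := fun f => cell_inj (X.cell_map₂_id f)
      map₂_comp := X.map₂_comp
      mapComp := X.mapComp
      -- The two whiskering axioms are `mapComp_natural` with one of the 2-morphisms an identity.
      map₂_whisker_left := fun {a b c} f {g h} η => by
        have e := X.mapComp_natural (𝟙 f) η
        rw [cell_inj (X.cell_map₂_id f), Bicategory.id_whiskerRight, Category.comp_id,
          Subsingleton.elim (f ◁ η ≫ 𝟙 f ▷ h) (f ◁ η)] at e
        rw [← Category.assoc, e, Category.assoc, Iso.hom_inv_id, Category.comp_id]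
      map₂_whisker_right := fun {a b c f g} η h => by
        have e := X.mapComp_natural η (𝟙 h)
        rw [cell_inj (X.cell_map₂_id h), Bicategory.whiskerLeft_id, Category.id_comp,
          Subsingleton.elim (f ◁ 𝟙 h ≫ η ▷ h) (η ▷ h)] at e
        rw [← Category.assoc, e, Category.assoc, Iso.hom_inv_id, Category.comp_id]
      map₂_left_unitor := fun {a b} f => cell_inj <| by
        rw [Bicategory.Strict.leftUnitor_eqToIso (X.map f), eqToIso.hom, eqToHom_trans,
          cell_comp_eqToHom, X.cell_mapComp_id_left]
        exact (X.cell_map₂_of_eq (Bicategory.Strict.id_comp f) _).trans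
          (cell_one (mor_congr (congrArg X.map (Bicategory.Strict.id_comp f))))
      map₂_right_unitor := fun {a b} f => cell_inj <| by
        rw [Bicategory.Strict.rightUnitor_eqToIso (X.map f), eqToIso.hom, eqToHom_trans,
          cell_comp_eqToHom, X.cell_mapComp_id_right]
        exact (X.cell_map₂_of_eq (Bicategory.Strict.comp_id f) _).trans
          (cell_one (mor_congr (congrArg X.map (Bicategory.Strict.comp_id f))))
      map₂_associator := fun {a b c d} f g h => by
        -- `cell_mapComp_assoc` with the associators put back; the image of an associator of `θ` is
        -- trivial by `cell_map₂_of_eq`.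
        have e : X.map₂ (α_ f g h).hom ≫ (X.mapComp f (g ≫ h)).hom ≫
            X.map f ◁ (X.mapComp g h).hom = (X.mapComp (f ≫ g) h).hom ≫
              (X.mapComp f g).hom ▷ X.map h ≫ (α_ (X.map f) (X.map g) (X.map h)).hom := by
          refine cell_inj ((cell_one_comp _ (X.cell_map₂_of_eq
            (Bicategory.Strict.assoc f g h) _)).trans ((X.cell_mapComp_assoc f g h).symm.trans ?_))
          rw [Bicategory.Strict.associator_eqToIso, eqToIso.hom, ← Category.assoc,
            cell_comp_eqToHom]
        rw [← reassoc_of% e]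
        simp }

/-- Existence half of the universal property: the data of `toNormal` were read off from the family
on test shapes, and the `elt_` lemmas say that these data reproduce every member. -/
theorem toBisimplex_toNormal : toBisimplex (normalPre s X.toNormal) = X.elt s :=
  (isIconic_toBisimplex _).ext (X.isIconic s) (fun k p => (X.elt_obj s k p).symm)
    (fun k p q h => (toBisimplex_edge _ k h).trans (X.elt_map s k h).symm)
    (fun k p q r h h' => (toBisimplex_tri _ k h h').trans
      ((cell_normalPre_mapComp X.toNormal s _ _).trans (X.elt_tri s k h h').symm))
    (fun u p q h => (toBisimplex_nat _ u h).trans (X.elt_nat s u h).symm)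

end NerveFamily

open Theta2 in
/-- A normal pseudofunctor is determined by its elements of the bisimplicial nerve. -/
theorem normal_ext_toBisimplex {θ : Theta2} {D : Type u₂} [Bicategory.{w₂, v₂} D]
    [Bicategory.Strict D] {F F' : StrictlyUnitaryPseudofunctor θ.Cell D}
    (h : ∀ {i j : ℕ} (s : TwoFunctor (dObj i j).Cell θ.Cell),
      toBisimplex (normalPre s F) = toBisimplex (normalPre s F')) : F = F' := by
  have h12 : (1 : Fin 3) ≤ 2 := by decide
  -- Objects are visible on `point`, 1-morphisms on `[1 | 0]`, 2-morphisms on `[1 | 1]` and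
  -- compositors on `[2 | 0, 0]`. Every 1-morphism of `θ` occurs as a constant one for a suitable
  -- test 2-functor.
  refine normal_ext_cell (fun x => ?_) (fun {x y} f => ?_) (fun {x y f g} η => ?_)
    (fun {x y z} f g => ?_)
  · exact congrArg (fun H => (Vert.fn (H.obj ⟨0⟩)).obj ⟨0⟩) (h (point x))
  · exact (toBisimplex_edge (normalPre (NerveFamily.arr f) F) ⟨0⟩ (p := ⟨0⟩) (q := ⟨1⟩)
      (Fin.zero_le _)).symm.trans ((congrArg (fun H => mor ((Vert.fn (H.obj ⟨0⟩)).map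
        (Osim.edge (p := ⟨0⟩) (q := ⟨1⟩) (Fin.zero_le _)))) (h (NerveFamily.arr f))).trans
        (toBisimplex_edge (normalPre (NerveFamily.arr f) F') ⟨0⟩ (p := ⟨0⟩) (q := ⟨1⟩)
          (Fin.zero_le _)))
  · exact (toBisimplex_nat (normalPre (NerveFamily.cel η) F) (k := ⟨0⟩) (l := ⟨1⟩)
      (Fin.zero_le _) (p := ⟨0⟩) (q := ⟨1⟩) (Fin.zero_le _)).symm.trans
      ((congrArg (fun H => cell (Vert.nat (Vert.tr (H.map (Osim.edge (p := ⟨0⟩) (q := ⟨1⟩)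
        (Fin.zero_le _)))) (Osim.edge (p := ⟨0⟩) (q := ⟨1⟩) (Fin.zero_le _))))
        (h (NerveFamily.cel η))).trans
        (toBisimplex_nat (normalPre (NerveFamily.cel η) F') (k := ⟨0⟩) (l := ⟨1⟩)
          (Fin.zero_le _) (p := ⟨0⟩) (q := ⟨1⟩) (Fin.zero_le _)))
  · have e : ∀ G : StrictlyUnitaryPseudofunctor θ.Cell D,
        cell (G.mapComp f g).hom = cell (G.mapComp ((NerveFamily.two f g).map (constArrow
          (p := ⟨0⟩) (q := ⟨1⟩) 0 (Fin.zero_le _))) ((NerveFamily.two f g).map (constArrow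
          (p := ⟨1⟩) (q := ⟨2⟩) 0 h12))).hom := fun G =>
      cell_mapComp_congr G (mor_inj (twoColumns_map₀₁ (OrderHom.const _ f)
        (OrderHom.const _ g) 0)).symm (mor_inj (twoColumns_map₁₂ (OrderHom.const _ f)
        (OrderHom.const _ g) 0)).symm
    let s := NerveFamily.two f g
    have k := congrArg (fun H => cell ((Vert.fn (H.obj ⟨0⟩)).map₂ (Osim.tri (p := ⟨0⟩) (q := ⟨1⟩)
      (r := ⟨2⟩) (Fin.zero_le _) h12))) (h s)
    have e' : ∀ G : StrictlyUnitaryPseudofunctor θ.Cell D, _ = _ := fun G =>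
      (toBisimplex_tri (normalPre s G) ⟨0⟩ (p := ⟨0⟩) (q := ⟨1⟩) (r := ⟨2⟩) (Fin.zero_le _)
        h12).trans ((cell_normalPre_mapComp G s _ _).trans (e G).symm)
    exact (e' F).symm.trans (k.trans (e' F'))

end

/-! ### Leinster's nerve as a right Kan extension -/

section

set_option linter.unusedSectionVars false
set_option linter.unusedVariables false

/-- The comparison of the restriction of Leinster's nerve along `d` with the bisimplicial nerve. -/
noncomputable def comparison : leinsterNerve.{u} ⋙
    (Functor.whiskeringLeft _ _ (Type u)).obj d.op ⟶ bisimplicialNerveZero.{u} where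
  app D :=
    { app := fun p => ↾fun F => toBisimplex (i := p.unop.1.len) (j := p.unop.2.len) F
      naturality := fun p q φ => by
        ext F
        exact toBisimplex_normalPre φ.unop.1.toOrderHom φ.unop.2.toOrderHom F }
  naturality D E Q := by
    ext p F
    exact toBisimplex_normalPost (i := p.unop.1.len) (j := p.unop.2.len) Q F

/-- The compatible family given by a section over the category of elements of `θ`. -/
noncomputable def NerveFamily.ofSection {D : TwoCat.{u}} {θ : Theta2ᵒᵖ}
    (σ : ∀ e : StructuredArrow θ d.op,
      (StructuredArrow.proj θ d.op ⋙ bisimplicialNerveZeroObj D).obj e)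
    (hσ : σ ∈ (StructuredArrow.proj θ d.op ⋙ bisimplicialNerveZeroObj D).sections) :
    NerveFamily θ.unop D.carrier where
  elt {i j} s := σ (StructuredArrow.mk (Y := op (SimplexCategory.mk i, SimplexCategory.mk j))
    (Quiver.Hom.op (V := Theta2) (X := dObj i j) (Y := θ.unop) s))
  elt_comp {i j i' j'} a b s := by
    -- The operator `(a, b)` as a morphism of structured arrows; the section condition along it is
    -- the required compatibility.
    let f : StructuredArrow.mk (S := θ) (T := d.op)
        (Y := op (SimplexCategory.mk i, SimplexCategory.mk j))
        (Quiver.Hom.op (V := Theta2) (X := dObj i j) (Y := θ.unop) s) ⟶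
      StructuredArrow.mk (Y := op (SimplexCategory.mk i', SimplexCategory.mk j'))
        (Quiver.Hom.op (V := Theta2) (X := dObj i' j') (Y := θ.unop) ((dMap a b).comp s)) :=
      StructuredArrow.homMk (Quiver.Hom.op
        ((SimplexCategory.Hom.mk a, SimplexCategory.Hom.mk b) :
          (SimplexCategory.mk i', SimplexCategory.mk j') ⟶
            (SimplexCategory.mk i, SimplexCategory.mk j))) rfl
    exact (hσ f).symm

/-- A cone of types is a limit when each section comes from exactly one element. Sections over the
structured arrows are compatible families, so `toBisimplex_toNormal` gives existence and
`normal_ext_toBisimplex` uniqueness. -/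
theorem isPointwiseRightKanExtension (D : TwoCat.{u}) :
    Nonempty (Functor.RightExtension.mk (leinsterNerve.obj D)
      (comparison.app D)).IsPointwiseRightKanExtension := by
  refine ⟨fun θ => Nonempty.some ((Limits.Types.isLimit_iff _).mpr fun σ hσ => ?_)⟩
  let X := NerveFamily.ofSection σ hσ
  refine ⟨X.toNormal, fun e => X.toBisimplex_toNormal e.hom.unop, fun F hF => ?_⟩
  refine normal_ext_toBisimplex fun {i j} s => ?_
  exact (hF (StructuredArrow.mk (Y := op (SimplexCategory.mk i, SimplexCategory.mk j))
    (Quiver.Hom.op (V := Theta2) (X := dObj i j) (Y := θ.unop) s))).trans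
      (X.toBisimplex_toNormal s).symm

/-- The transformation from Leinster's nerve to the right Kan extension of the bisimplicial
nerve. -/
noncomputable def toRan : leinsterNerve.{u} ⟶ bisimplicialNerveZero.{u} ⋙ d.op.ran where
  app D := (d.op.ranAdjunction (Type u)).homEquiv _ _ (comparison.app D)
  naturality D E Q := by
    -- Transposition along the adjunction is natural in both variables, so naturality of
    -- `comparison` in `D` carries over.
    refine ((d.op.ranAdjunction (Type u)).homEquiv_naturality_left _ _).symm.trans
      (Eq.trans ?_ ((d.op.ranAdjunction (Type u)).homEquiv_naturality_right _ _))
    exact congrArg _ (comparison.naturality Q)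

/-- The transpose of a transformation is invertible exactly when the transformation exhibits a right
Kan extension, and a pointwise one does. -/
instance : IsIso toRan.{u} := by
  refine (NatTrans.isIso_iff_isIso_app _).mpr fun D => ?_
  exact (Functor.isIso_ranAdjunction_homEquiv_iff _ (comparison.app D)).mpr
    (isPointwiseRightKanExtension D).some.isRightKanExtension

end

end TwoNerve

theorem mainTheorem5 :
    Nonempty (TwoNerve.bisimplicialNerveZero.{u} ⋙
        (Functor.ran TwoNerve.d.op :
          ((SimplexCategory × SimplexCategory)ᵒᵖ ⥤ Type u) ⥤ (TwoNerve.Theta2ᵒᵖ ⥤ Type u)) ≅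
      TwoNerve.leinsterNerve.{u}) :=
  ⟨(asIso TwoNerve.toRan).symm⟩
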